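/- Let $n\ge 3$ and let $C\ell_{0,n}$ be the real Clifford algebra generated by $e_1,\dots,e_n$ with $e_ie_j+e_je_i=-2\delta_{ij}$, with conjugation $a\mapsto\overline a$ (the linear anti-automorphism with $\overline{e_i}=-e_i$) and scalar part $\mathrm{Sc}\,a=a_\emptyset$ of $a=\sum_A a_Ae_A$; vectors $x\in\mathbb R^n$ are identified with $\sum_i x_ie_i$. Let $D=\sum_{i=1}^n e_i\partial_i$, $Cw=\overline w$ and $M^\alpha w=w\alpha$, so that $(D-\alpha C)w=Dw-\alpha\overline w$ and $(D-M^\alpha C)w=Dw-\overline w\,\alpha$. Let $\Omega\subset\mathbb R^n$ be a bounded domain with Lipschitz boundary, with surface measure $ds$ and outward unit normal $\eta$, and let $\alpha\in L^\infty(\Omega,C\ell_{0,n})$. A solution of $(D-\alpha C)w=0$ or $(D-M^\alpha C)w=0$ is a function satisfying the equation in the sense of distributions in $\Omega$; it is represented in $\Omega$ by its continuous representative. Its boundary values are well-defined, and given by $w|_{\partial\Omega}$, if there are $v_k\in C^1(\overline\Omega,C\ell_{0,n})$ and a function $d$ on $\Omega$ with $v_k\to w$ and $Dv_k\to d$ in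 $L^1(\Omega)$ and $v_k|_{\partial\Omega}\to w|_{\partial\Omega}$ in $L^1(\partial\Omega,ds)$ (for instance, if $w\in C^1(\overline\Omega)$, or $w\in W^{1,p}(\Omega)$, $1\le p<\infty$, with its Sobolev trace). Let $x\in\mathbb R^n\setminus\partial\Omega$. For an operator $L\in\{D-\alpha C,\ D-M^\alpha C\}$, call a $C\ell_{0,n}$-valued function $K$, with $y\mapsto K(y-x)$ continuous on $\overline\Omega\setminus\{x\}$, *admissible for $L$ at $x$* if $y\mapsto-\overline{K(y-x)}$ is locally integrable on $\Omega$ and is a normalized fundamental solution of $L$ with pole $x$, that is, $L_y\big(-\overline{K(y-x)}\big)=\delta_x(y)$ in the sense of distributions in $\Omega$ (so the right-hand side is $0$ if $x\notin\overline\Omega$), and if, in case $x\in\Omega$, $$\lim_{\epsilon\to0^+}\int_{\partial B(x;\epsilon)}K(y-x)\,\eta(y)\,v(y)\,ds_y=v(x)\qquad\text{for all } v\in C^1(\overline\Omega,C\ell_{0,n}),$$ where $\eta$ here is the outward unit normal of the ball $B(x;\epsilon)$. (1) If $w$ is a solution of the Vekua equation $Dw=\alpha\overline w$ in $\Omega$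 whose boundary values are well-defined, and $\Phi$ is admissible for $D-M^\alpha C$ at $x$, then the integrand below is integrable on $\partial\Omega$ and $$\mathrm{Sc}\int_{\partial\Omega}\Phi(y-x)\,\eta(y)\,w(y)\,ds_y=\begin{cases}\mathrm{Sc}\,w(x), & x\in\Omega,\\ 0, & x\in\mathbb R^n\setminus\overline\Omega.\end{cases}$$ (2) If $w^*$ is a solution of $Dw^*=\overline{w^*}\,\alpha$ in $\Omega$ whose boundary values are well-defined, and $\Psi$ is admissible for $D-\alpha C$ at $x$, then the integrand below is integrable on $\partial\Omega$ and $$\mathrm{Sc}\int_{\partial\Omega}\Psi(y-x)\,\eta(y)\,w^*(y)\,ds_y=\begin{cases}\mathrm{Sc}\,w^*(x), & x\in\Omega,\\ 0, & x\in\mathbb R^n\setminus\overline\Omega.\end{cases}$$ -/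

import Mathlib

open MeasureTheory Filter Topology Set
open scoped RealInnerProductSpace ENNReal NNReal ContDiff

noncomputable section

namespace VekuaCauchy

/-! ### The real Clifford algebra `Cl_{0,n}` -/

/-- Euclidean space `ℝⁿ`. -/
abbrev Vec (n : ℕ) : Type := EuclideanSpace ℝ (Fin n)

/-- The negative definite form `x ↦ -|x|²` on `ℝⁿ`. -/
def negForm (n : ℕ) : QuadraticForm ℝ (Vec n) :=
  -(LinearMap.BilinMap.toQuadraticMap (innerₗ (Vec n)))

/-- The Clifford algebra `Cl_{0,n}`: generators `e₁, …, eₙ` with `eᵢ eⱼ + eⱼ eᵢ = -2 δᵢⱼ`.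
Its conjugation (the anti-automorphism with `eᵢ ↦ -eᵢ`) is Mathlib's `star`. -/
abbrev Cl (n : ℕ) : Type := CliffordAlgebra (negForm n)

/-- The embedding of vectors `x = ∑ xᵢ eᵢ` in the Clifford algebra. -/
def vec {n : ℕ} (x : Vec n) : Cl n := CliffordAlgebra.ι (negForm n) x

/-- The `i`-th standard unit vector of `ℝⁿ`. -/
def unitVec {n : ℕ} (i : Fin n) : Vec n := EuclideanSpace.single i 1

/-- The standard basis `(e_A)` of `Cl_{0,n}`, indexed by `A ⊆ {1, …, n}`. -/
def blade (n : ℕ) : Module.Basis (Finset (Fin n)) ℝ (Cl n) :=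
  (Module.Basis.ExteriorAlgebra (EuclideanSpace.basisFun (Fin n) ℝ).toBasis).map
    (CliffordAlgebra.equivExterior (negForm n)).symm

instance instFiniteDimensionalCl (n : ℕ) : FiniteDimensional ℝ (Cl n) :=
  (blade n).finiteDimensional_of_finite

/-- The coordinates `(a_A)` of `a = ∑ a_A e_A`, as a vector of a Euclidean space. -/
def coords (n : ℕ) : Cl n →ₗ[ℝ] EuclideanSpace ℝ (Finset (Fin n)) :=
  (WithLp.linearEquiv 2 ℝ (Finset (Fin n) → ℝ)).symm.toLinearMap ∘ₗ (blade n).equivFun.toLinearMap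

theorem coords_injective (n : ℕ) : Function.Injective (coords n) :=
  (WithLp.linearEquiv 2 ℝ (Finset (Fin n) → ℝ)).symm.injective.comp (blade n).equivFun.injective

/-- The norm `|a|² = ∑ a_A²`. -/
instance instNormedAddCommGroupCl (n : ℕ) : NormedAddCommGroup (Cl n) :=
  NormedAddCommGroup.induced (Cl n) (EuclideanSpace ℝ (Finset (Fin n))) (coords n)
    (coords_injective n)

instance instNormedSpaceCl (n : ℕ) : NormedSpace ℝ (Cl n) :=
  NormedSpace.induced ℝ (Cl n) (EuclideanSpace ℝ (Finset (Fin n))) (coords n)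

instance instCompleteSpaceCl (n : ℕ) : CompleteSpace (Cl n) := FiniteDimensional.complete ℝ (Cl n)

/-- The scalar part `Sc a = a_∅`. -/
def Sc {n : ℕ} (a : Cl n) : ℝ := (blade n).coord ∅ a

/-! ### Lipschitz domains, surface measure, outward unit normal -/

/-- `Ω` has Lipschitz boundary: near each boundary point it is the set of points lying strictly
above the graph of a Lipschitz function, with respect to some unit vector `e` as the upward
direction. -/
def HasLipschitzBoundary {n : ℕ} (Ω : Set (Vec n)) : Prop :=
  ∀ y ∈ frontier Ω, ∃ (e : Vec n) (φ : (ℝ ∙ e)ᗮ → ℝ) (L : ℝ≥0),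
    ‖e‖ = 1 ∧ LipschitzWith L φ ∧
      ∀ᶠ z in 𝓝 y, (z ∈ Ω ↔ φ ((ℝ ∙ e)ᗮ.orthogonalProjectionOnto z) < ⟪e, z⟫)

/-- The surface measure `ds` on `∂U`: the Hausdorff measure of dimension `n - 1`, normalized to
agree with Lebesgue measure on hyperplanes. -/
def surfaceMeasure {n : ℕ} (U : Set (Vec n)) : Measure (Vec n) :=
  (μHE[n - 1] : Measure (Vec n)).restrict (frontier U)

/-- `ν` is the outward unit normal to `U` at `y`: to first order at `y`, the set `U` is the half
space `{z | ⟪z - y, ν⟫ < 0}`. -/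
def IsOutwardNormal {n : ℕ} (U : Set (Vec n)) (y ν : Vec n) : Prop :=
  ‖ν‖ = 1 ∧ ∀ ε : ℝ, 0 < ε → ∀ᶠ z in 𝓝 y,
    (z ∈ U → ⟪z - y, ν⟫ ≤ ε * ‖z - y‖) ∧ (z ∉ U → -(ε * ‖z - y‖) ≤ ⟪z - y, ν⟫)

open Classical in
/-- The outward unit normal `η(y)` to `U` at `y ∈ ∂U` (there is at most one at a boundary point of
a Lipschitz domain, and exactly one at almost every boundary point; `0` where there is none). -/
def outwardNormal {n : ℕ} (U : Set (Vec n)) (y : Vec n) : Vec n :=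
  if h : ∃ ν, IsOutwardNormal U y ν then h.choose else 0

/-- The function `y ↦ u(y) η(y) v(y)` on `∂U`. -/
def boundaryIntegrand {n : ℕ} (U : Set (Vec n)) (u v : Vec n → Cl n) (y : Vec n) : Cl n :=
  u y * vec (outwardNormal U y) * v y

/-- The Clifford-valued surface integral `∫_{∂U} u(y) η(y) v(y) ds_y`. -/
def boundaryIntegral {n : ℕ} (U : Set (Vec n)) (u v : Vec n → Cl n) : Cl n :=
  ∫ y, boundaryIntegrand U u v y ∂(surfaceMeasure U)

/-! ### The Moisil-Teodorescu operator and the Vekua operators -/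

/-- The Moisil-Teodorescu operator `D v = ∑ eᵢ ∂ᵢ v` on differentiable functions. -/
def dirac {n : ℕ} (v : Vec n → Cl n) (y : Vec n) : Cl n :=
  ∑ i : Fin n, vec (unitVec i) * fderiv ℝ v y (unitVec i)

/-- The zero-order term `α C` : `w ↦ α w̄`. -/
def vekuaTerm {n : ℕ} (α : Vec n → Cl n) (w : Vec n → Cl n) (y : Vec n) : Cl n :=
  α y * star (w y)

/-- The zero-order term `M^α C` : `w ↦ w̄ α`. -/
def vekuaAdjTerm {n : ℕ} (α : Vec n → Cl n) (w : Vec n → Cl n) (y : Vec n) : Cl n :=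
  star (w y) * α y

/-- Real-valued test functions `φ ∈ C_c^∞(Ω)`. -/
structure IsTestFunction {n : ℕ} (Ω : Set (Vec n)) (φ : Vec n → ℝ) : Prop where
  smooth : ContDiff ℝ ∞ φ
  compact : HasCompactSupport φ
  support : tsupport φ ⊆ Ω

/-- The distribution `D w - T w` on `Ω`, applied to the test function `φ`:
`-∫_Ω ∑ (∂ᵢ φ) eᵢ w dy - ∫_Ω φ (T w) dy`. -/
def distPairing {n : ℕ} (T : (Vec n → Cl n) → Vec n → Cl n) (Ω : Set (Vec n))
    (w : Vec n → Cl n) (φ : Vec n → ℝ) : Cl n :=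
  -(∫ y in Ω, ∑ i : Fin n, fderiv ℝ φ y (unitVec i) • (vec (unitVec i) * w y))
    - ∫ y in Ω, φ y • T w y

/-- `w ∈ Ker (D - T)` on `Ω`: the equation `D w = T w` holds in the sense of distributions.
For a bounded coefficient each solution agrees a.e. with a unique continuous function; `w` is that
representative in `Ω`, so that its point values make sense. -/
structure IsSolution {n : ℕ} (T : (Vec n → Cl n) → Vec n → Cl n) (Ω : Set (Vec n))
    (w : Vec n → Cl n) : Prop where
  continuousOn : ContinuousOn w Ω
  equation : ∀ φ : Vec n → ℝ, IsTestFunction Ω φ → distPairing T Ω w φ = 0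

/-- `G` is a (normalized) fundamental solution of `D - T` with pole `x`, on `Ω`:
`(D - T) G = δ_x` in the sense of distributions on `Ω`. If `x ∉ Ω` the right-hand side vanishes. -/
structure IsFundamentalSolution {n : ℕ} (T : (Vec n → Cl n) → Vec n → Cl n) (Ω : Set (Vec n))
    (x : Vec n) (G : Vec n → Cl n) : Prop where
  locallyIntegrable : LocallyIntegrableOn G Ω
  equation : ∀ φ : Vec n → ℝ, IsTestFunction Ω φ → distPairing T Ω G φ = φ x • (1 : Cl n)

/-- The constraint at the pole: for `v` of class `C¹`, the integral of `K η v` over the sphere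
`∂B(x; ε)` tends to `v(x)` as `ε → 0`. -/
def PoleConstraint {n : ℕ} (x : Vec n) (K : Vec n → Cl n) : Prop :=
  ∀ v : Vec n → Cl n, ContDiff ℝ 1 v →
    Tendsto (fun ε : ℝ => boundaryIntegral (Metric.ball x ε) K v) (𝓝[>] 0) (𝓝 (v x))

/-- The boundary values of `w` on `∂Ω` are well-defined, and given by the values of `w` there:
`w` is a limit of functions `v k` that are `C¹` up to the boundary (restrictions of `C¹` functions
on `ℝⁿ`; on a Lipschitz domain every function in `C¹` of the closure is one), in the graph norm
`‖v‖_{L¹(Ω)} + ‖D v‖_{L¹(Ω)}`, and the restrictions of the `v k` to `∂Ω` tend to `w|_∂Ω`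
in `L¹(∂Ω)`. This covers functions in `C¹` of the closure (take `v k = w`), and functions of
`W^{1,p}(Ω)`, `1 ≤ p < ∞`, with their Sobolev traces. -/
def HasBoundaryValues {n : ℕ} (Ω : Set (Vec n)) (w : Vec n → Cl n) : Prop :=
  AEStronglyMeasurable w (surfaceMeasure Ω) ∧
  ∃ (d : Vec n → Cl n) (v : ℕ → Vec n → Cl n),
    AEStronglyMeasurable d (volume.restrict Ω) ∧
    (∀ k, ContDiff ℝ 1 (v k)) ∧
    Tendsto (fun k => ∫⁻ y in Ω, ‖v k y - w y‖ₑ) atTop (𝓝 0) ∧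
    Tendsto (fun k => ∫⁻ y in Ω, ‖dirac (v k) y - d y‖ₑ) atTop (𝓝 0) ∧
    Tendsto (fun k => ∫⁻ y, ‖v k y - w y‖ₑ ∂(surfaceMeasure Ω)) atTop (𝓝 0)

end VekuaCauchy

end

noncomputable section

/-! ### Contractions, reversal and the scalar part of a Clifford algebra -/

namespace CliffordAlgebra

variable {R M : Type*} [CommRing R] [AddCommGroup M] [Module R M] {Q Q' : QuadraticForm R M}

/-! Write `T` for the zero-order term of the equation `D w = T w` and `T'` for that of the equation
solved by `-K̄`. Conjugation reverses products and changes the sign of the `eᵢ`, so it turns `(D -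
T')(-K̄) = δ_x` into the right-handed equation `∑ (∂ᵢK) eᵢ = δ_x + g`, where `g` is the conjugate of
`T'(-K̄)`. The product rule `∑ ∂ᵢ(K eᵢ w) = (∑ (∂ᵢK) eᵢ) w + K (D w)` and the divergence theorem
then give the Borel-Pompeiu formula `∫_∂Ω K η w = ∫_Ω (K (T w) + g w) + w(x)`, without the last term
if `x` lies outside; this is `IsSolution.boundaryIntegral_eq`.

For `T w = α w̄` and `T' G = Ḡ α` the volume integrand is `K α w̄ - ᾱ K̄ w`. Its two terms have
opposite scalar parts, because `Sc` is invariant under conjugation (`Sc_star`) and is a trace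
(`Sc_mul_comm`). So the scalar part of the volume integral vanishes, and the same happens with the
roles of `T` and `T'` exchanged.

The analysis has two difficulties. The first is the divergence theorem on a Lipschitz domain, where
the surface measure is a Hausdorff measure and the normal exists only almost everywhere
(`divergence_theorem`). Near a boundary point `Ω` lies above a graph. The distributional equation is
tested with `u` times a ramp in `h / t`, where `h` is the height above the graph; the derivative of
the ramp produces the flux through a layer of thickness of order `t`, which tends to the flux
through the graph as `t → 0`. The area formula `comap_graph_eq` identifies the latter with a surface
integral, and a partition of unity makes the result global.

The second difficulty is that no single approximation of `w` serves everywhere: `K` is merely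
integrable near the pole, and `w` is merely a limit in the mean near the boundary. A cutoff `χ`,
equal to `1` near an interior pole, separates the two. On the part `χ`, `w` is continuous and its
mollifications converge boundedly, which suffices against an integrable `K`
(`IsSolution.integral_cutoff`). On the part `1 - χ` the multipliers are bounded, and convergence in
the graph norm suffices (`boundaryIntegral_eq_of_cutoff`). -/

theorem contractLeft_mul_ι (d : Module.Dual R M) (v : M) (x : CliffordAlgebra Q) :
    contractLeft d (x * ι Q v) = contractLeft d x * ι Q v + d v • involute x := by
  induction x using CliffordAlgebra.left_induction with
  | algebraMap r =>
    rw [contractLeft_algebraMap_mul, contractLeft_ι, contractLeft_algebraMap, zero_mul, zero_add,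
      AlgHom.commutes, ← map_mul, Algebra.smul_def, ← map_mul, mul_comm]
  | add x y hx hy => rw [add_mul, map_add, hx, hy, map_add, map_add, add_mul, smul_add]; abel
  | ι_mul x m hx =>
    rw [mul_assoc, contractLeft_ι_mul, hx, contractLeft_ι_mul, map_mul, involute_ι]
    simp only [mul_add, sub_mul, mul_assoc, smul_mul_assoc, mul_smul_comm, neg_mul, smul_neg]
    abel

theorem contractRight_ι_mul (d : Module.Dual R M) (u : M) (x : CliffordAlgebra Q) :
    contractRight (ι Q u * x) d = ι Q u * contractRight x d + d u • involute x := by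
  rw [contractRight_eq, reverse.map_mul, reverse_ι, contractLeft_mul_ι, map_add, reverse.map_mul,
    reverse_ι, map_smul, reverse_involute, reverse_reverse, contractRight_eq]

theorem contractLeft_involute (d : Module.Dual R M) (x : CliffordAlgebra Q) :
    contractLeft d (involute x) = -involute (contractLeft d x) := by
  induction x using CliffordAlgebra.left_induction with
  | algebraMap r => simp [contractLeft_algebraMap]
  | add x y hx hy => rw [map_add, map_add, hx, hy, map_add, map_add]; abel
  | ι_mul x m hx =>
    rw [map_mul, involute_ι, neg_mul, map_neg, contractLeft_ι_mul, hx, contractLeft_ι_mul, map_sub,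
      map_smul, map_mul, involute_ι]
    simp

/-- Contractions from opposite ends do not interfere: in the induction, the terms in which `d'`
meets the new factor `m` agree by the sign in `contractLeft_involute`. -/
theorem contractLeft_contractRight (d d' : Module.Dual R M) (x : CliffordAlgebra Q) :
    contractLeft d (contractRight x d') = contractRight (contractLeft d x) d' := by
  induction x using CliffordAlgebra.left_induction with
  | algebraMap r => simp [contractLeft_algebraMap, contractRight_algebraMap]
  | add x y hx hy => simp only [map_add, LinearMap.add_apply, hx, hy]
  | ι_mul x m hx =>
    simp only [contractRight_ι_mul, map_add, map_sub, map_smul, contractLeft_ι_mul, hx,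
      contractLeft_involute, LinearMap.sub_apply, LinearMap.smul_apply, smul_neg]
    abel

variable {B : LinearMap.BilinForm R M} (h : B.toQuadraticMap = Q' - Q)
  (hB : ∀ u v, B u v = B v u)

include hB in
-- The defining recursion of `changeForm` peels vectors off on the left; for symmetric `B` its
-- mirror image holds on the right. The cross terms in the induction carry the factors `B m v` and
-- `B v m`, which is where symmetry enters.
theorem changeForm_mul_ι (v : M) (x : CliffordAlgebra Q) :
    changeForm h (x * ι Q v) = changeForm h x * ι Q' v - contractRight (changeForm h x) (B v) := by
  induction x using CliffordAlgebra.left_induction with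
  | algebraMap r =>
    rw [← Algebra.smul_def, map_smul, changeForm_ι, changeForm_algebraMap,
      contractRight_algebraMap, sub_zero, Algebra.smul_def]
  | add x y hx hy => simp only [add_mul, map_add, LinearMap.add_apply, hx, hy]; abel
  | ι_mul x m hx =>
    simp only [mul_assoc, changeForm_ι_mul, hx, map_sub, contractLeft_mul_ι, LinearMap.sub_apply,
      contractRight_ι_mul, contractLeft_contractRight, mul_sub, sub_mul, hB v m]
    abel

include hB in
-- Reversal exchanges the left recursion with the right recursion `changeForm_mul_ι`.
theorem changeForm_reverse (x : CliffordAlgebra Q) :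
    changeForm h (reverse x) = reverse (changeForm h x) := by
  induction x using CliffordAlgebra.left_induction with
  | algebraMap r => simp
  | add x y hx hy => simp only [map_add, hx, hy]
  | ι_mul x m hx =>
    rw [reverse.map_mul, reverse_ι, changeForm_mul_ι h hB, hx, changeForm_ι_mul, map_sub,
      reverse.map_mul, reverse_ι, contractRight_eq, reverse_reverse]

theorem changeForm_involute (x : CliffordAlgebra Q) :
    changeForm h (involute x) = involute (changeForm h x) := by
  induction x using CliffordAlgebra.left_induction with
  | algebraMap r => simp
  | add x y hx hy => simp only [map_add, hx, hy]
  | ι_mul x m hx =>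
    rw [map_mul, involute_ι, neg_mul, map_neg, changeForm_ι_mul, hx, changeForm_ι_mul, map_sub,
      map_mul, involute_ι, contractLeft_involute]
    simp only [neg_mul]; abel

end CliffordAlgebra

/-! ### The degree-zero part of the exterior algebra -/

namespace ExteriorAlgebra

variable {R M : Type*} [CommRing R] [AddCommGroup M] [Module R M]

open CliffordAlgebra (involute reverse contractLeft contractRight)

theorem algebraMapInv_ι_mul (m : M) (x : ExteriorAlgebra R M) :
    algebraMapInv (ι R m * x) = 0 := by
  rw [map_mul]; simp [algebraMapInv]

theorem algebraMapInv_mul_ι (m : M) (x : ExteriorAlgebra R M) :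
    algebraMapInv (x * ι R m) = 0 := by
  rw [map_mul]; simp [algebraMapInv]

theorem algebraMapInv_involute (x : ExteriorAlgebra R M) :
    algebraMapInv (involute x) = algebraMapInv x := by
  induction x using CliffordAlgebra.left_induction with
  | algebraMap r => simp
  | add x y hx hy => simp only [map_add, hx, hy]
  | ι_mul x m hx =>
    rw [map_mul, CliffordAlgebra.involute_ι, neg_mul, map_neg]
    exact (congrArg Neg.neg (algebraMapInv_ι_mul m _)).trans
      (neg_zero.trans (algebraMapInv_ι_mul m _).symm)

theorem algebraMapInv_reverse (x : ExteriorAlgebra R M) :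
    algebraMapInv (reverse x) = algebraMapInv x := by
  induction x using CliffordAlgebra.left_induction with
  | algebraMap r => simp
  | add x y hx hy => simp only [map_add, hx, hy]
  | ι_mul x m hx =>
    rw [CliffordAlgebra.reverse.map_mul, CliffordAlgebra.reverse_ι]
    exact (algebraMapInv_mul_ι m _).trans (algebraMapInv_ι_mul m _).symm

/-- The degree-zero part of either contraction sees only the degree-one part of `x`, on which left
and right contraction coincide. In the induction every product with a vector factor is killed,
leaving `d m` times the degree-zero part of `x` on both sides. -/
theorem algebraMapInv_contractRight (d : Module.Dual R M) (x : ExteriorAlgebra R M) :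
    algebraMapInv (contractRight x d) = algebraMapInv (contractLeft d x) := by
  rw [CliffordAlgebra.contractRight_eq, algebraMapInv_reverse]
  induction x using CliffordAlgebra.left_induction with
  | algebraMap r => simp
  | add x y hx hy => simp only [map_add, hx, hy]
  | ι_mul x m hx =>
    rw [CliffordAlgebra.reverse.map_mul, CliffordAlgebra.reverse_ι,
      CliffordAlgebra.contractLeft_mul_ι, CliffordAlgebra.contractLeft_ι_mul, map_add, map_sub,
      map_smul, map_smul, algebraMapInv_involute, algebraMapInv_reverse]
    have h1 := algebraMapInv_mul_ι (R := R) m (contractLeft d (reverse x))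
    have h2 := algebraMapInv_ι_mul (R := R) m (contractLeft d x)
    erw [h1, h2]
    simp

/-- Every basis element with nonempty index set is a wedge product starting with a vector, hence is
killed by `algebraMapInv`; the empty one is `1`. -/
theorem coord_empty_eq_algebraMapInv {I : Type*} [LinearOrder I] (b : Module.Basis I R M)
    (x : ExteriorAlgebra R M) : b.ExteriorAlgebra.coord ∅ x = algebraMapInv x := by
  suffices h : b.ExteriorAlgebra.coord ∅ = (algebraMapInv : ExteriorAlgebra R M →ₐ[R] R).toLinearMap
    from congrArg (fun f : ExteriorAlgebra R M →ₗ[R] R => f x) h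
  refine b.ExteriorAlgebra.ext fun s => ?_
  rw [Module.Basis.coord_apply, Module.Basis.repr_self, Finsupp.single_apply, AlgHom.toLinearMap_apply]
  obtain ⟨n, hn⟩ : ∃ n, s.card = n := ⟨_, rfl⟩
  rw [basis_apply_ofCard b hn]
  cases n with
  | zero =>
    rw [if_pos (Finset.card_eq_zero.mp hn)]
    simp [ιMulti_family]
  | succ n =>
    rw [if_neg (by rintro rfl; simp at hn)]
    exact (algebraMapInv_ι_mul _ _).symm.trans
      (congrArg algebraMapInv (ιMulti_succ_apply _).symm)

end ExteriorAlgebra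

/-! ### The scalar part: invariance under conjugation and the trace property -/

namespace VekuaCauchy

variable {n : ℕ}

theorem Sc_eq_algebraMapInv (a : Cl n) :
    Sc a = ExteriorAlgebra.algebraMapInv (CliffordAlgebra.equivExterior (negForm n) a) := by
  rw [← ExteriorAlgebra.coord_empty_eq_algebraMapInv (EuclideanSpace.basisFun (Fin n) ℝ).toBasis]
  simp only [Sc, blade, Module.Basis.coord_apply, Module.Basis.map_repr, LinearEquiv.trans_apply,
    LinearEquiv.symm_symm]

theorem associated_symm (Q : QuadraticForm ℝ (Vec n)) (u v : Vec n) :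
    QuadraticMap.associated (R := ℝ) Q u v = QuadraticMap.associated (R := ℝ) Q v u :=
  QuadraticMap.associated_isSymm ℝ Q u v

theorem Sc_star (a : Cl n) : Sc (star a) = Sc a := by
  rw [Sc_eq_algebraMapInv, Sc_eq_algebraMapInv, CliffordAlgebra.star_def]
  simp only [CliffordAlgebra.equivExterior, CliffordAlgebra.changeFormEquiv_apply]
  rw [CliffordAlgebra.changeForm_reverse _ (associated_symm _),
    CliffordAlgebra.changeForm_involute]
  exact (ExteriorAlgebra.algebraMapInv_reverse _).trans (ExteriorAlgebra.algebraMapInv_involute _)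

/-- After passage to the exterior algebra, `a v` and `v a` are products with `v`, which have no
degree-zero part, minus the right and left contractions of the image of `a` by the same functional;
these have equal degree-zero parts. -/
theorem Sc_mul_vec (a : Cl n) (v : Vec n) :
    Sc (a * CliffordAlgebra.ι (negForm n) v) = Sc (CliffordAlgebra.ι (negForm n) v * a) := by
  rw [Sc_eq_algebraMapInv, Sc_eq_algebraMapInv]
  simp only [CliffordAlgebra.equivExterior, CliffordAlgebra.changeFormEquiv_apply]
  rw [CliffordAlgebra.changeForm_mul_ι _ (associated_symm _), CliffordAlgebra.changeForm_ι_mul]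
  refine (map_sub (ExteriorAlgebra.algebraMapInv : ExteriorAlgebra ℝ (Vec n) →ₐ[ℝ] ℝ) _ _).trans
    (Eq.trans ?_ (map_sub (ExteriorAlgebra.algebraMapInv : ExteriorAlgebra ℝ (Vec n) →ₐ[ℝ] ℝ)
      _ _).symm)
  exact congrArg₂ (· - ·)
    ((ExteriorAlgebra.algebraMapInv_mul_ι v _).trans (ExteriorAlgebra.algebraMapInv_ι_mul v _).symm)
    (ExteriorAlgebra.algebraMapInv_contractRight _ _)

theorem Sc_add (a b : Cl n) : Sc (a + b) = Sc a + Sc b := map_add _ _ _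

theorem Sc_mul_comm (a b : Cl n) : Sc (a * b) = Sc (b * a) := by
  induction b using CliffordAlgebra.left_induction generalizing a with
  | algebraMap r => rw [Algebra.commutes]
  | add x y hx hy => rw [mul_add, add_mul, Sc_add, Sc_add, hx, hy]
  | ι_mul x m hx => rw [← mul_assoc, hx, ← mul_assoc, Sc_mul_vec, mul_assoc]

/-! ### Continuity of the algebra operations -/

/-- The scalar part as a continuous linear functional. -/
def scL (n : ℕ) : Cl n →L[ℝ] ℝ := LinearMap.toContinuousLinearMap ((blade n).coord ∅)

@[simp] theorem scL_apply (a : Cl n) : scL n a = Sc a := rfl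

/-- The multiplication as a continuous bilinear map. -/
def mulL (n : ℕ) : Cl n →L[ℝ] Cl n →L[ℝ] Cl n :=
  LinearMap.toContinuousLinearMap
    ((LinearMap.toContinuousLinearMap : (Cl n →ₗ[ℝ] Cl n) ≃ₗ[ℝ] (Cl n →L[ℝ] Cl n)).toLinearMap ∘ₗ
      LinearMap.mul ℝ (Cl n))

@[simp] theorem mulL_apply (a b : Cl n) : mulL n a b = a * b := rfl

/-- The conjugation as a continuous linear map. -/
def starL (n : ℕ) : Cl n →L[ℝ] Cl n :=
  LinearMap.toContinuousLinearMap
    { toFun := star, map_add' := star_add, map_smul' := CliffordAlgebra.star_smul }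

@[simp] theorem starL_apply (a : Cl n) : starL n a = star a := rfl

/-- The embedding of vectors as a continuous linear map. -/
def vecL (n : ℕ) : Vec n →L[ℝ] Cl n :=
  LinearMap.toContinuousLinearMap (CliffordAlgebra.ι (negForm n))

@[simp] theorem vecL_apply (x : Vec n) : vecL n x = vec x := rfl

@[simp] theorem star_vec (x : Vec n) : star (vec x) = -vec x := CliffordAlgebra.star_ι x

theorem norm_mul_le' (a b : Cl n) : ‖a * b‖ ≤ ‖mulL n‖ * ‖a‖ * ‖b‖ := (mulL n).le_opNorm₂ a b

theorem norm_star_le (a : Cl n) : ‖star a‖ ≤ ‖starL n‖ * ‖a‖ := (starL n).le_opNorm a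

end VekuaCauchy

end

noncomputable section

/-! ### The area formula for Lipschitz graphs -/

namespace GraphArea

/-- The hypothesis says that `f ∘ g⁻¹` is well defined and `K`-Lipschitz on `g '' s`. Comparing two
parametrizations directly allows a piece of a graph to be measured against a linear model living in
the base space. -/
theorem euclideanHausdorffMeasure_image_le_of_dist_le {α X Y : Type*}
    [MetricSpace X] [MeasurableSpace X] [BorelSpace X]
    [MetricSpace Y] [MeasurableSpace Y] [BorelSpace Y]
    {f : α → X} {g : α → Y} {s : Set α} {K : ℝ≥0} (d : ℕ)
    (h : ∀ p ∈ s, ∀ q ∈ s, dist (f p) (f q) ≤ K * dist (g p) (g q)) :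
    (μHE[d] : Measure X) (f '' s) ≤ (K : ℝ≥0∞) ^ d * (μHE[d] : Measure Y) (g '' s) := by
  rcases s.eq_empty_or_nonempty with rfl | ⟨a₀, ha₀⟩
  · simp
  have : Nonempty α := ⟨a₀⟩
  set G : Y → X := fun y => f (Function.invFunOn g s y)
  have hG : ∀ p ∈ s, G (g p) = f p := by
    intro p hp
    have hm : g p ∈ g '' s := ⟨p, hp, rfl⟩
    have h1 : Function.invFunOn g s (g p) ∈ s := Function.invFunOn_mem hm
    have h2 : g (Function.invFunOn g s (g p)) = g p := Function.invFunOn_eq hm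
    have h3 := h _ h1 _ hp
    rw [h2, dist_self, mul_zero] at h3
    exact dist_le_zero.mp h3
  have hlip : LipschitzOnWith K G (g '' s) := by
    refine LipschitzOnWith.of_dist_le_mul ?_
    rintro _ ⟨p, hp, rfl⟩ _ ⟨q, hq, rfl⟩
    rw [hG p hp, hG q hq]
    exact h p hp q hq
  have himg : f '' s = G '' (g '' s) := by
    rw [image_image]
    exact image_congr fun p hp => (hG p hp).symm
  rw [himg]
  have := hlip.hausdorffMeasure_image_le (d := d) (by positivity)
  simp only [Measure.euclideanHausdorffMeasure_def, Measure.smul_apply, Measure.nnreal_smul_coe_apply]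
  rw [mul_left_comm]
  gcongr
  simpa using this

variable {V F : Type*} [NormedAddCommGroup V] [InnerProductSpace ℝ V] [FiniteDimensional ℝ V]

/-- The area factor `√(1 + |L|²)` of the graph of a linear functional. -/
def areaFactor (L : V →L[ℝ] ℝ) : ℝ := √(1 + ‖L‖ ^ 2)

omit [FiniteDimensional ℝ V] in
theorem areaFactor_sq (L : V →L[ℝ] ℝ) : areaFactor L ^ 2 = 1 + ‖L‖ ^ 2 :=
  Real.sq_sqrt (by positivity)

omit [FiniteDimensional ℝ V] in
theorem one_le_areaFactor (L : V →L[ℝ] ℝ) : 1 ≤ areaFactor L :=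
  Real.one_le_sqrt.mpr (by nlinarith [sq_nonneg ‖L‖])

omit [FiniteDimensional ℝ V] in
theorem areaFactor_pos (L : V →L[ℝ] ℝ) : 0 < areaFactor L :=
  zero_lt_one.trans_le (one_le_areaFactor L)

omit [FiniteDimensional ℝ V] in
theorem continuous_areaFactor : Continuous (areaFactor : (V →L[ℝ] ℝ) → ℝ) := by
  unfold areaFactor; fun_prop

omit [FiniteDimensional ℝ V] in
theorem areaFactor_le_mul {L L' : V →L[ℝ] ℝ} {δ : ℝ} (hδ : 0 ≤ δ) (h : ‖L - L'‖ ≤ δ) :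
    areaFactor L ≤ (1 + δ) * areaFactor L' := by
  have h1 : ‖L‖ ≤ ‖L'‖ + δ := by
    have := norm_add_le L' (L - L')
    rw [add_sub_cancel] at this
    linarith
  have h2 := one_le_areaFactor L'
  have h3 := areaFactor_sq L'
  have h4 := areaFactor_sq L
  have h5 : ‖L'‖ ≤ areaFactor L' := by
    refine abs_le_of_sq_le_sq' ?_ (by linarith) |>.2
    linarith
  have h6 := norm_nonneg L
  have h7 := norm_nonneg L'
  refine abs_le_of_sq_le_sq' ?_ (by positivity) |>.2
  have h8 : ‖L‖ ^ 2 ≤ (‖L'‖ + δ) ^ 2 := by gcongr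
  have h9 : δ * ‖L'‖ ≤ δ * areaFactor L' ^ 2 := by
    gcongr
    nlinarith
  have h10 : δ ^ 2 * 1 ≤ δ ^ 2 * areaFactor L' ^ 2 := by
    gcongr
    nlinarith
  nlinarith

/-- A linear endomorphism of the base which distorts lengths like the graph map of `L`. -/
def graphModel (L : V →L[ℝ] ℝ) : V →ₗ[ℝ] V :=
  LinearMap.transvection L.toLinearMap
    ((1 + areaFactor L)⁻¹ • (InnerProductSpace.toDual ℝ V).symm L)

/-- With `a` dual to `L`, the map `p ↦ p + c L(p) a` has the required lengths if `2c + c²|L|² = 1`;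
the root `c = (1 + √(1 + |L|²))⁻¹` is the coefficient in `graphModel`. Its determinant is then `1 +
c|L|² = √(1 + |L|²)`. -/
theorem norm_graphModel_sq (L : V →L[ℝ] ℝ) (p : V) :
    ‖graphModel L p‖ ^ 2 = ‖p‖ ^ 2 + L p ^ 2 := by
  set a := (InnerProductSpace.toDual ℝ V).symm L with ha
  have h1 : ⟪p, a⟫ = L p := by
    rw [real_inner_comm, ha, InnerProductSpace.toDual_symm_apply]
  have h2 : ‖a‖ = ‖L‖ := LinearIsometryEquiv.norm_map _ _
  have h3 : graphModel L p = p + (L p * (1 + areaFactor L)⁻¹) • a := by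
    simp [graphModel, LinearMap.transvection.apply, smul_smul, ha]
  rw [h3, norm_add_sq_real, inner_smul_right, h1, norm_smul, mul_pow, h2, Real.norm_eq_abs, sq_abs]
  have h4 := areaFactor_sq L
  have h5 := areaFactor_pos L
  have h6 : ‖L‖ ^ 2 = (areaFactor L - 1) * (1 + areaFactor L) := by nlinarith
  rw [h6]
  field_simp
  ring

theorem det_graphModel (L : V →L[ℝ] ℝ) : (graphModel L).det = areaFactor L := by
  rw [graphModel, LinearMap.transvection.det]
  have h1 : L ((InnerProductSpace.toDual ℝ V).symm L) = ‖L‖ ^ 2 := by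
    rw [← InnerProductSpace.toDual_symm_apply, real_inner_self_eq_norm_sq,
      LinearIsometryEquiv.norm_map]
  have h4 := areaFactor_sq L
  have h5 := areaFactor_pos L
  have h6 : ‖L‖ ^ 2 = (areaFactor L - 1) * (1 + areaFactor L) := by nlinarith
  simp only [map_smul, ContinuousLinearMap.coe_coe, h1, smul_eq_mul, h6]
  field_simp
  ring

/-- This is the triangle inequality in the plane: `(x, y)` and `(x, y')` differ by at most `δ x`,
and `δ x ≤ δ Y`. -/
theorem sqrt_perturb {X Y x y y' δ : ℝ} (hY : 0 ≤ Y) (hδ : 0 ≤ δ)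
    (h1 : X ^ 2 = x ^ 2 + y ^ 2) (h2 : Y ^ 2 = x ^ 2 + y' ^ 2) (h : |y - y'| ≤ δ * x) :
    X ≤ (1 + δ) * Y := by
  have hxy : 0 ≤ (x - |y'|) ^ 2 := sq_nonneg _
  have h3 : |y| ≤ |y'| + δ * x := by
    have := abs_add_le y' (y - y')
    rw [add_sub_cancel] at this
    linarith
  have h4 : y ^ 2 ≤ (|y'| + δ * x) ^ 2 := by
    rw [← sq_abs y]
    gcongr
  have h5 := sq_abs y'
  refine abs_le_of_sq_le_sq' ?_ (by positivity) |>.2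
  have h6 : 0 ≤ δ * (x - |y'|) ^ 2 := by positivity
  have h7 : 0 ≤ δ * (x ^ 2 + y' ^ 2) := by positivity
  have h8 : 0 ≤ δ ^ 2 * y' ^ 2 := by positivity
  nlinarith

variable [MeasurableSpace V] [BorelSpace V]
variable [NormedAddCommGroup F] [MeasurableSpace F] [BorelSpace F]
  {φ : V → ℝ} {ψ : V → F}

theorem volume_image_graphModel (L : V →L[ℝ] ℝ) (s : Set V) :
    volume (graphModel L '' s) = ENNReal.ofReal (areaFactor L) * volume s := by
  rw [Measure.addHaar_image_linearMap, det_graphModel, abs_of_pos (areaFactor_pos L)]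

variable (hψ : ∀ p q, ‖ψ p - ψ q‖ ^ 2 = ‖p - q‖ ^ 2 + (φ p - φ q) ^ 2)

include hψ in
-- Where `φ` is `δ`-close to `L`, distances on the graph exceed those in the image of `graphModel L`
-- by a factor of at most `1 + δ`. Hausdorff measure sees this factor to the power of the dimension,
-- and the model image has volume given by its determinant.
theorem measure_image_le_of_approx {L : V →L[ℝ] ℝ} {s : Set V} {δ : ℝ≥0}
    (h : ApproximatesLinearOn φ L s δ) :
    (μHE[Module.finrank ℝ V] : Measure F) (ψ '' s) ≤
      ((1 + δ : ℝ≥0) : ℝ≥0∞) ^ Module.finrank ℝ V * (ENNReal.ofReal (areaFactor L) * volume s) := by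
  rw [← volume_image_graphModel, ← InnerProductSpace.euclideanHausdorffMeasure_eq_volume]
  refine euclideanHausdorffMeasure_image_le_of_dist_le _ fun p hp q hq => ?_
  rw [dist_eq_norm, dist_eq_norm, ← map_sub]
  exact sqrt_perturb (norm_nonneg _) δ.2 (hψ p q) (norm_graphModel_sq L _)
    (h p hp q hq)

include hψ in
theorem le_measure_image_of_approx {L : V →L[ℝ] ℝ} {s : Set V} {δ : ℝ≥0}
    (h : ApproximatesLinearOn φ L s δ) :
    ENNReal.ofReal (areaFactor L) * volume s ≤ ((1 + δ : ℝ≥0) : ℝ≥0∞) ^ Module.finrank ℝ V *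
      (μHE[Module.finrank ℝ V] : Measure F) (ψ '' s) := by
  rw [← volume_image_graphModel, ← InnerProductSpace.euclideanHausdorffMeasure_eq_volume]
  refine euclideanHausdorffMeasure_image_le_of_dist_le _ fun p hp q hq => ?_
  rw [dist_eq_norm, dist_eq_norm, ← map_sub]
  refine sqrt_perturb (norm_nonneg _) δ.2 (norm_graphModel_sq L _) (hψ p q) ?_
  rw [abs_sub_comm]
  exact h p hp q hq

omit [InnerProductSpace ℝ V] [FiniteDimensional ℝ V] [MeasurableSpace V] [BorelSpace V]
  [MeasurableSpace F] [BorelSpace F] in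
include hψ in
theorem lipschitzWith_graph {K : ℝ≥0} (hφ : LipschitzWith K φ) : LipschitzWith (1 + K) ψ := by
  refine LipschitzWith.of_dist_le_mul fun p q => ?_
  rw [dist_eq_norm, dist_eq_norm]
  have := sqrt_perturb (y' := 0) (norm_nonneg (p - q)) K.2 (hψ p q)
    (by ring) (by rw [sub_zero]; exact hφ.norm_sub_le p q)
  simpa using this

omit [InnerProductSpace ℝ V] [FiniteDimensional ℝ V] [MeasurableSpace V] [BorelSpace V]
  [MeasurableSpace F] [BorelSpace F] in
include hψ in
theorem antilipschitzWith_graph : AntilipschitzWith 1 ψ := by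
  refine AntilipschitzWith.of_le_mul_dist fun p q => ?_
  rw [dist_eq_norm, dist_eq_norm, NNReal.coe_one, one_mul]
  refine abs_le_of_sq_le_sq' ?_ (norm_nonneg _) |>.2
  rw [hψ]
  nlinarith [sq_nonneg (φ p - φ q)]

include hψ in
theorem measurableEmbedding_graph {K : ℝ≥0} (hφ : LipschitzWith K φ) : MeasurableEmbedding ψ :=
  ((antilipschitzWith_graph hψ).isClosedEmbedding
    (lipschitzWith_graph hψ hφ).uniformContinuous).measurableEmbedding

include hψ in
theorem measure_image_null {K : ℝ≥0} (hφ : LipschitzWith K φ) {s : Set V} (hs : volume s = 0) :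
    (μHE[Module.finrank ℝ V] : Measure F) (ψ '' s) = 0 := by
  have := euclideanHausdorffMeasure_image_le_of_dist_le (f := ψ) (g := id) (s := s) (K := 1 + K)
    (Module.finrank ℝ V) fun p _ q _ => (lipschitzWith_graph hψ hφ).dist_le_mul p q
  rw [image_id, InnerProductSpace.euclideanHausdorffMeasure_eq_volume, hs, mul_zero] at this
  exact le_antisymm this bot_le

include hψ in
theorem measure_image_lt_top {K : ℝ≥0} (hφ : LipschitzWith K φ) {s : Set V} (hs : volume s < ⊤) :
    (μHE[Module.finrank ℝ V] : Measure F) (ψ '' s) < ⊤ := by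
  have := euclideanHausdorffMeasure_image_le_of_dist_le (f := ψ) (g := id) (s := s) (K := 1 + K)
    (Module.finrank ℝ V) fun p _ q _ => (lipschitzWith_graph hψ hφ).dist_le_mul p q
  rw [image_id, InnerProductSpace.euclideanHausdorffMeasure_eq_volume] at this
  exact this.trans_lt (ENNReal.mul_lt_top (ENNReal.pow_lt_top ENNReal.coe_lt_top) hs)

/-- The area density of a graph. -/
def areaDensity (φ : V → ℝ) (p : V) : ℝ≥0∞ := ENNReal.ofReal (areaFactor (fderiv ℝ φ p))

omit [FiniteDimensional ℝ V] in
theorem measurable_areaFactor_fderiv [CompleteSpace V] [SecondCountableTopology V] (φ : V → ℝ) :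
    Measurable fun p => areaFactor (fderiv ℝ φ p) :=
  continuous_areaFactor.measurable.comp (measurable_fderiv ℝ φ)

theorem measurable_areaDensity (φ : V → ℝ) : Measurable (areaDensity φ) :=
  (measurable_areaFactor_fderiv φ).ennreal_ofReal

/-- A real function approximated by a linear functional up to `δ` on a measurable set has a
derivative within `δ` of this functional at almost every point of the set. -/
theorem ae_norm_fderiv_sub_le {L : V →L[ℝ] ℝ} {s : Set V} {δ : ℝ≥0}
    (h : ApproximatesLinearOn φ L s δ) (hs : MeasurableSet s)
    (hd : ∀ p ∈ s, DifferentiableAt ℝ φ p) :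
    ∀ᵐ p ∂(volume.restrict s), ‖fderiv ℝ φ p - L‖ ≤ δ := by
  rcases subsingleton_or_nontrivial V with hV | hV
  · refine ae_of_all _ fun p => ?_
    have : fderiv ℝ φ p - L = 0 := by
      ext v
      rw [Subsingleton.elim v 0, map_zero, map_zero]
    rw [this, norm_zero]
    exact δ.2
  -- `ApproximatesLinearOn.norm_fderiv_sub_le` concerns self-maps of `V`. Multiplication by a fixed
  -- unit vector makes `φ` into one without changing any norm.
  obtain ⟨v, hv⟩ := exists_norm_eq V zero_le_one
  have h' : ApproximatesLinearOn (fun p => φ p • v) (L.smulRight v) s δ := by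
    intro p hp q hq
    have : φ p • v - φ q • v - L.smulRight v (p - q) = (φ p - φ q - L (p - q)) • v := by
      simp only [ContinuousLinearMap.smulRight_apply, sub_smul]
    rw [this, norm_smul, hv, mul_one]
    exact h p hp q hq
  filter_upwards [h'.norm_fderiv_sub_le volume hs (fun p => (fderiv ℝ φ p).smulRight v)
    fun p hp => ((hd p hp).hasFDerivAt.smul_const v).hasFDerivWithinAt] with p hp
  have h1 : (fderiv ℝ φ p).smulRight v - L.smulRight v = (fderiv ℝ φ p - L).smulRight v := by
    ext w
    simp [sub_smul]
  have h2 : ‖(fderiv ℝ φ p).smulRight v - L.smulRight v‖ ≤ δ := hp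
  rwa [h1, ContinuousLinearMap.norm_smulRight_apply, hv, mul_one] at h2

include hψ in
-- Up to a null set (Rademacher), `A` splits into countably many measurable pieces on which `φ` is
-- `δ`-close to a linear functional. On each piece, `dim V` factors `1 + δ` come from comparing
-- Hausdorff measures, and one more from replacing the area factor of `L` by that of the derivative
-- of `φ`.
theorem comap_bounds {K : ℝ≥0} (hφ : LipschitzWith K φ) {A : Set V} (hA : MeasurableSet A)
    {δ : ℝ≥0} (hδ : δ ≠ 0) :
    ((μHE[Module.finrank ℝ V] : Measure F).comap ψ) A ≤
        ((1 + δ : ℝ≥0) : ℝ≥0∞) ^ (Module.finrank ℝ V + 1) * (volume.withDensity (areaDensity φ)) A ∧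
      (volume.withDensity (areaDensity φ)) A ≤ ((1 + δ : ℝ≥0) : ℝ≥0∞) ^ (Module.finrank ℝ V + 1) *
        ((μHE[Module.finrank ℝ V] : Measure F).comap ψ) A := by
  set d := Module.finrank ℝ V
  set c : ℝ≥0∞ := ((1 + δ : ℝ≥0) : ℝ≥0∞)
  set ν := (μHE[d] : Measure F).comap ψ
  set ρ := (volume : Measure V).withDensity (areaDensity φ)
  have hemb := measurableEmbedding_graph hψ hφ
  have hν : ∀ s, ν s = (μHE[d] : Measure F) (ψ '' s) := fun s => hemb.comap_apply _ s
  set S : Set V := {p | DifferentiableAt ℝ φ p}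
  have hS : MeasurableSet S := measurableSet_of_differentiableAt ℝ φ
  have hSc : volume Sᶜ = 0 := hφ.ae_differentiableAt
  obtain ⟨t, L, t_disj, t_meas, t_cov, t_app, -⟩ :=
    exists_partition_approximatesLinearOn_of_hasFDerivWithinAt φ S (fderiv ℝ φ)
      (fun p hp => (DifferentiableAt.hasFDerivAt hp).hasFDerivWithinAt) (fun _ => δ) fun _ => hδ
  set P : ℕ → Set V := fun k => A ∩ (S ∩ t k)
  have hPm : ∀ k, MeasurableSet (P k) := fun k => hA.inter (hS.inter (t_meas k))
  have hPd : Pairwise (Function.onFun Disjoint P) := fun i j hij =>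
    (t_disj hij).mono (inter_subset_right.trans inter_subset_right)
      (inter_subset_right.trans inter_subset_right)
  have hAeq : A ∩ S = ⋃ k, P k := by
    ext p
    simp only [P, mem_inter_iff, mem_iUnion]
    refine ⟨fun hp => ?_, fun ⟨k, h1, h2, _⟩ => ⟨h1, h2⟩⟩
    obtain ⟨k, hk⟩ := mem_iUnion.mp (t_cov hp.2)
    exact ⟨k, hp.1, hp.2, hk⟩
  have hsplit : ∀ κ : Measure V, κ Sᶜ = 0 → κ A = ∑' k, κ (P k) := by
    intro κ hκ
    rw [← measure_iUnion hPd hPm, ← hAeq, measure_inter_conull hκ]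
  have hνS : ν Sᶜ = 0 := by
    rw [hν]
    exact measure_image_null hψ hφ hSc
  have hρS : ρ Sᶜ = 0 := withDensity_absolutelyContinuous _ _ hSc
  have happ : ∀ k, ApproximatesLinearOn φ (L k) (P k) δ := fun k =>
    (t_app k).mono_set inter_subset_right
  have hae : ∀ k, ∀ᵐ p ∂(volume.restrict (P k)), ‖fderiv ℝ φ p - L k‖ ≤ δ := fun k =>
    ae_norm_fderiv_sub_le (happ k) (hPm k) fun p hp => hp.2.1
  have hofReal : ∀ r : ℝ, ENNReal.ofReal ((1 + δ) * r) = c * ENNReal.ofReal r := by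
    intro r
    rw [ENNReal.ofReal_mul (by positivity)]
    congr 1
    rw [← NNReal.coe_one, ← NNReal.coe_add, ENNReal.ofReal_coe_nnreal]
  have h1 : ∀ k, ENNReal.ofReal (areaFactor (L k)) * volume (P k) ≤ c * ρ (P k) := by
    intro k
    rw [withDensity_apply _ (hPm k), ← setLIntegral_const,
      ← lintegral_const_mul _ (measurable_areaDensity φ)]
    refine lintegral_mono_ae ((hae k).mono fun p hp => ?_)
    rw [areaDensity, ← hofReal]
    refine ENNReal.ofReal_le_ofReal (areaFactor_le_mul δ.2 ?_)
    rwa [norm_sub_rev]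
  have h2 : ∀ k, ρ (P k) ≤ c * (ENNReal.ofReal (areaFactor (L k)) * volume (P k)) := by
    intro k
    rw [withDensity_apply _ (hPm k), ← mul_assoc, ← setLIntegral_const]
    refine lintegral_mono_ae ((hae k).mono fun p hp => ?_)
    rw [areaDensity, ← hofReal]
    exact ENNReal.ofReal_le_ofReal (areaFactor_le_mul δ.2 hp)
  rw [hsplit ν hνS, hsplit ρ hρS, ← ENNReal.tsum_mul_left, ← ENNReal.tsum_mul_left]
  refine ⟨ENNReal.tsum_le_tsum fun k => ?_, ENNReal.tsum_le_tsum fun k => ?_⟩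
  · rw [hν, pow_succ, mul_assoc]
    exact (measure_image_le_of_approx hψ (happ k)).trans (mul_le_mul' le_rfl (h1 k))
  · rw [hν, pow_succ', mul_assoc]
    exact (h2 k).trans (mul_le_mul' le_rfl (le_measure_image_of_approx hψ (happ k)))

include hψ in
/-- **Area formula** for the graph of a Lipschitz function. -/
theorem comap_graph_eq {K : ℝ≥0} (hφ : LipschitzWith K φ) :
    (μHE[Module.finrank ℝ V] : Measure F).comap ψ = volume.withDensity (areaDensity φ) := by
  have hlim : ∀ x : ℝ≥0∞, Tendsto
      (fun δ : ℝ≥0 => ((1 + δ : ℝ≥0) : ℝ≥0∞) ^ (Module.finrank ℝ V + 1) * x) (𝓝[>] 0) (𝓝 x) := by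
    intro x
    have h1 : Tendsto (fun δ : ℝ≥0 => ((1 + δ : ℝ≥0) : ℝ≥0∞) ^ (Module.finrank ℝ V + 1))
        (𝓝[>] 0) (𝓝 1) := by
      have h2 : Continuous fun δ : ℝ≥0 => (1 + δ) ^ (Module.finrank ℝ V + 1) := by fun_prop
      have h3 : Tendsto (fun δ : ℝ≥0 => (((1 + δ) ^ (Module.finrank ℝ V + 1) : ℝ≥0) : ℝ≥0∞))
          (𝓝[>] 0) (𝓝 (((1 + 0) ^ (Module.finrank ℝ V + 1) : ℝ≥0) : ℝ≥0∞)) :=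
        ENNReal.tendsto_coe.mpr ((h2.tendsto 0).mono_left nhdsWithin_le_nhds)
      simpa using h3
    simpa using ENNReal.Tendsto.mul_const (b := x) h1 (Or.inl one_ne_zero)
  ext A hA
  refine le_antisymm (ge_of_tendsto (hlim _) ?_) (ge_of_tendsto (hlim _) ?_)
  · filter_upwards [self_mem_nhdsWithin] with δ hδ
    exact (comap_bounds hψ hφ hA (ne_of_gt hδ)).1
  · filter_upwards [self_mem_nhdsWithin] with δ hδ
    exact (comap_bounds hψ hφ hA (ne_of_gt hδ)).2

include hψ in
theorem restrict_range_graph_eq {K : ℝ≥0} (hφ : LipschitzWith K φ) :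
    (μHE[Module.finrank ℝ V] : Measure F).restrict (range ψ) =
      (volume.withDensity (areaDensity φ)).map ψ := by
  rw [← comap_graph_eq hψ hφ, (measurableEmbedding_graph hψ hφ).map_comap]

include hψ in
/-- Integration over a Lipschitz graph. -/
theorem setIntegral_range_graph {E : Type*} [NormedAddCommGroup E] [NormedSpace ℝ E] {K : ℝ≥0}
    (hφ : LipschitzWith K φ) (f : F → E) :
    ∫ y in range ψ, f y ∂(μHE[Module.finrank ℝ V] : Measure F) =
      ∫ p, areaFactor (fderiv ℝ φ p) • f (ψ p) := by
  rw [restrict_range_graph_eq hψ hφ, (measurableEmbedding_graph hψ hφ).integral_map]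
  unfold areaDensity
  rw [integral_withDensity_eq_integral_toReal_smul
    (measurable_areaFactor_fderiv φ).ennreal_ofReal (ae_of_all _ fun _ => ENNReal.ofReal_lt_top)]
  refine integral_congr_ae (ae_of_all _ fun p => ?_)
  simp only [ENNReal.toReal_ofReal (areaFactor_pos _).le]

end GraphArea

end

noncomputable section

/-! ### Coordinates adapted to a graph -/

/-- An orthogonal splitting of `F` into a hyperplane, parametrized by `V`, and the line spanned by
a unit vector `e`. -/
structure HyperplaneSplitting (V F : Type*) [NormedAddCommGroup V] [InnerProductSpace ℝ V]
    [NormedAddCommGroup F] [InnerProductSpace ℝ F] where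
  incl : V →ₗᵢ[ℝ] F
  proj : F →L[ℝ] V
  e : F
  norm_e : ‖e‖ = 1
  inner_incl : ∀ p, ⟪e, incl p⟫ = 0
  incl_proj : ∀ z, incl (proj z) = z - ⟪e, z⟫ • e

namespace HyperplaneSplitting

variable {V F : Type*} [NormedAddCommGroup V] [InnerProductSpace ℝ V]
    [NormedAddCommGroup F] [InnerProductSpace ℝ F] (H : HyperplaneSplitting V F)

/-- The splitting given by the orthogonal complement of a unit vector. -/
def ofUnit {e : F} (he : ‖e‖ = 1) : HyperplaneSplitting (ℝ ∙ e)ᗮ F where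
  incl := (ℝ ∙ e)ᗮ.subtypeₗᵢ
  proj := (ℝ ∙ e)ᗮ.orthogonalProjectionOnto
  e := e
  norm_e := he
  inner_incl p := Submodule.mem_orthogonal_singleton_iff_inner_right.mp p.2
  incl_proj z := by
    have h1 := (ℝ ∙ e).starProjection_add_starProjection_orthogonal z
    rw [Submodule.starProjection_unit_singleton ℝ he] at h1
    exact (sub_eq_of_eq_add' h1.symm).symm

theorem inner_e_e : ⟪H.e, H.e⟫ = 1 := by rw [real_inner_self_eq_norm_sq, H.norm_e, one_pow]

theorem proj_incl (p : V) : H.proj (H.incl p) = p := by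
  apply H.incl.injective
  rw [H.incl_proj, H.inner_incl, zero_smul, sub_zero]

theorem proj_e : H.proj H.e = 0 := by
  apply H.incl.injective
  rw [H.incl_proj, H.inner_e_e, one_smul, sub_self, map_zero]

theorem norm_incl_add_sq (p : V) (s : ℝ) : ‖H.incl p + s • H.e‖ ^ 2 = ‖p‖ ^ 2 + s ^ 2 := by
  rw [norm_add_sq_real, inner_smul_right, real_inner_comm, H.inner_incl, norm_smul, H.norm_e,
    H.incl.norm_map, Real.norm_eq_abs, mul_one, sq_abs]
  ring

theorem inner_incl_left (p : V) (z : F) : ⟪H.incl p, z⟫ = ⟪p, H.proj z⟫ := by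
  have := H.inner_incl p
  rw [real_inner_comm] at this
  rw [← H.incl.inner_map_map, H.incl_proj, inner_sub_right, inner_smul_right, this, mul_zero,
    sub_zero]

/-- The point `p + φ(p) e` of the graph of `φ`. -/
def graphMap (φ : V → ℝ) (p : V) : F := H.incl p + φ p • H.e

/-- The height of a point over the graph of `φ`. -/
def height (φ : V → ℝ) (z : F) : ℝ := ⟪H.e, z⟫ - φ (H.proj z)

/-- The point at height `s` over the point `p + φ(p) e` of the graph of `φ`. -/
def chart (φ : V → ℝ) (q : V × ℝ) : F := H.incl q.1 + (φ q.1 + q.2) • H.e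

variable {φ : V → ℝ}

theorem norm_graphMap_sub_sq (p q : V) :
    ‖H.graphMap φ p - H.graphMap φ q‖ ^ 2 = ‖p - q‖ ^ 2 + (φ p - φ q) ^ 2 := by
  rw [← H.norm_incl_add_sq, map_sub, graphMap, graphMap]
  congr 2
  module

theorem proj_chart (q : V × ℝ) : H.proj (H.chart φ q) = q.1 := by
  rw [chart, map_add, map_smul, H.proj_incl, H.proj_e, smul_zero, add_zero]

theorem inner_e_chart (q : V × ℝ) : ⟪H.e, H.chart φ q⟫ = φ q.1 + q.2 := by
  rw [chart, inner_add_right, H.inner_incl, inner_smul_right, H.inner_e_e, zero_add, mul_one]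

theorem height_chart (q : V × ℝ) : H.height φ (H.chart φ q) = q.2 := by
  rw [height, H.inner_e_chart, H.proj_chart, add_sub_cancel_left]

theorem chart_proj_height (z : F) : H.chart φ (H.proj z, H.height φ z) = z := by
  rw [chart, H.incl_proj, height]
  module

theorem chart_zero (p : V) : H.chart φ (p, 0) = H.graphMap φ p := by
  rw [chart, graphMap, add_zero]

theorem height_graphMap (p : V) : H.height φ (H.graphMap φ p) = 0 := by
  rw [← H.chart_zero, H.height_chart]

theorem proj_graphMap (p : V) : H.proj (H.graphMap φ p) = p := by
  rw [← H.chart_zero, H.proj_chart]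

theorem range_graphMap : range (H.graphMap φ) = {z | H.height φ z = 0} := by
  ext z
  refine ⟨?_, fun hz => ⟨H.proj z, ?_⟩⟩
  · rintro ⟨p, rfl⟩
    exact H.height_graphMap p
  · rw [← H.chart_zero, ← show H.height φ z = 0 from hz, H.chart_proj_height]

theorem height_add_smul (z : F) (s : ℝ) : H.height φ (z + s • H.e) = H.height φ z + s := by
  rw [height, height, map_add, map_smul, H.proj_e, smul_zero, add_zero, inner_add_right,
    inner_smul_right, H.inner_e_e]
  ring

theorem norm_proj_le (z : F) : ‖H.proj z‖ ≤ ‖z‖ := by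
  have h := H.norm_incl_add_sq (H.proj z) ⟪H.e, z⟫
  rw [H.incl_proj, sub_add_cancel] at h
  refine abs_le_of_sq_le_sq' ?_ (norm_nonneg _) |>.2
  rw [h]
  nlinarith [sq_nonneg ⟪H.e, z⟫]

theorem lipschitzWith_height {K : ℝ≥0} (hφ : LipschitzWith K φ) :
    LipschitzWith (1 + K) (H.height φ) := by
  refine LipschitzWith.of_dist_le_mul fun z w => ?_
  have h1 : |⟪H.e, z - w⟫| ≤ ‖z - w‖ := by
    have := abs_real_inner_le_norm H.e (z - w)
    rwa [H.norm_e, one_mul] at this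
  have h2 : |φ (H.proj z) - φ (H.proj w)| ≤ K * ‖z - w‖ := by
    refine (hφ.norm_sub_le _ _).trans ?_
    rw [← map_sub]
    gcongr
    exact H.norm_proj_le _
  rw [Real.dist_eq, dist_eq_norm]
  have h3 : H.height φ z - H.height φ w
      = ⟪H.e, z - w⟫ - (φ (H.proj z) - φ (H.proj w)) := by
    rw [height, height, inner_sub_right]
    ring
  rw [h3]
  refine (abs_sub _ _).trans ?_
  push_cast
  linarith

theorem continuous_height (hφ : Continuous φ) : Continuous (H.height φ) := by
  unfold height
  exact (continuous_const.inner continuous_id).sub (hφ.comp H.proj.continuous)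

theorem continuous_chart (hφ : Continuous φ) : Continuous (H.chart φ) := by
  unfold chart
  exact (H.incl.continuous.comp continuous_fst).add
    (((hφ.comp continuous_fst).add continuous_snd).smul continuous_const)

/-- The splitting as a linear isometry. -/
def isometryEquiv : WithLp 2 (V × ℝ) ≃ₗᵢ[ℝ] F where
  toFun x := H.incl x.fst + x.snd • H.e
  map_add' x y := by simp only [WithLp.add_fst, WithLp.add_snd, map_add]; module
  map_smul' c x := by
    simp only [WithLp.smul_fst, WithLp.smul_snd, map_smul, RingHom.id_apply, smul_eq_mul]; module
  invFun z := WithLp.toLp 2 (H.proj z, ⟪H.e, z⟫)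
  left_inv x := by
    have h1 := H.proj_chart (φ := 0) (x.fst, x.snd)
    have h2 := H.inner_e_chart (φ := 0) (x.fst, x.snd)
    simp only [chart, Pi.zero_apply, zero_add] at h1 h2
    simp only [h1, h2]
    rfl
  right_inv z := by
    change H.incl (H.proj z) + ⟪H.e, z⟫ • H.e = z
    rw [H.incl_proj, sub_add_cancel]
  norm_map' x := by
    rw [WithLp.prod_norm_eq_of_L2, Real.norm_eq_abs, sq_abs, ← H.norm_incl_add_sq, Real.sqrt_sq
      (norm_nonneg _)]
    rfl

variable [FiniteDimensional ℝ V] [MeasurableSpace V] [BorelSpace V]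
  [FiniteDimensional ℝ F] [MeasurableSpace F] [BorelSpace F]

/-- The chart is the shear `(p, s) ↦ (p, φ p + s)`, a translation on each fibre, followed by a
linear isometry. -/
theorem measurePreserving_chart (hφ : Continuous φ) :
    MeasurePreserving (H.chart φ) (volume.prod volume) volume := by
  have h1 : MeasurePreserving (fun q : V × ℝ => (q.1, φ q.1 + q.2)) (volume.prod volume)
      (volume.prod volume) :=
    (MeasurePreserving.id volume).skew_product (g := fun p s => φ p + s)
      (by fun_prop) (ae_of_all _ fun p => map_add_left_eq_self _ _)
  have h2 : MeasurePreserving (fun q : V × ℝ => H.isometryEquiv (WithLp.toLp 2 q))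
      (volume.prod volume) volume :=
    H.isometryEquiv.measurePreserving.comp (WithLp.volume_preserving_toLp V ℝ)
  exact h2.comp h1

omit [FiniteDimensional ℝ V] [FiniteDimensional ℝ F] in
theorem measurableEmbedding_chart (hφ : Continuous φ) : MeasurableEmbedding (H.chart φ) := by
  have : Topology.IsClosedEmbedding (H.chart φ) := by
    let T : V × ℝ ≃ₜ F :=
      { toFun := H.chart φ
        invFun := fun z => (H.proj z, H.height φ z)
        left_inv := fun q => by simp only [H.proj_chart, H.height_chart]
        right_inv := fun z => H.chart_proj_height z
        continuous_toFun := H.continuous_chart hφ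
        continuous_invFun := H.proj.continuous.prodMk (H.continuous_height hφ) }
    exact T.isClosedEmbedding
  exact this.measurableEmbedding

/-- Fubini in the coordinates adapted to a graph. -/
theorem integral_eq_integral_chart {E : Type*} [NormedAddCommGroup E] [NormedSpace ℝ E]
    (hφ : Continuous φ) (f : F → E) :
    ∫ z, f z = ∫ q, f (H.chart φ q) ∂((volume : Measure V).prod (volume : Measure ℝ)) :=
  ((H.measurePreserving_chart hφ).integral_comp (H.measurableEmbedding_chart hφ) f).symm

end HyperplaneSplitting
end

noncomputable section

/-! ### Normals of graphs -/

namespace HyperplaneSplitting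

open GraphArea

section Normal

variable {V F : Type*} [NormedAddCommGroup V] [InnerProductSpace ℝ V] [FiniteDimensional ℝ V]
    [NormedAddCommGroup F] [InnerProductSpace ℝ F] (H : HyperplaneSplitting V F) {φ : V → ℝ}

/-- The normal `∇φ(p) - e` (not of unit length) of the graph of `φ` pointing downwards. -/
def graphNormal (φ : V → ℝ) (p : V) : F := H.incl (gradient φ p) - H.e

theorem inner_graphNormal (p : V) (v : F) :
    ⟪v, H.graphNormal φ p⟫ = fderiv ℝ φ p (H.proj v) - ⟪H.e, v⟫ := by
  rw [real_inner_comm, graphNormal, inner_sub_left, H.inner_incl_left, gradient,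
    InnerProductSpace.toDual_symm_apply]

theorem norm_graphNormal (p : V) : ‖H.graphNormal φ p‖ = areaFactor (fderiv ℝ φ p) := by
  have h := H.norm_incl_add_sq (gradient φ p) (-1)
  have h1 : ‖gradient φ p‖ = ‖fderiv ℝ φ p‖ := LinearIsometryEquiv.norm_map _ _
  have h2 : H.graphNormal φ p = H.incl (gradient φ p) + (-1 : ℝ) • H.e := by
    rw [graphNormal]; module
  rw [areaFactor, h2, ← Real.sqrt_sq (norm_nonneg _), h, h1]
  congr 1
  ring

theorem measurable_graphNormal [MeasurableSpace V] [BorelSpace V] [MeasurableSpace F]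
    [BorelSpace F] (φ : V → ℝ) : Measurable (H.graphNormal φ) := by
  have h1 : Measurable (gradient φ) :=
    (InnerProductSpace.toDual ℝ V).symm.continuous.measurable.comp (measurable_fderiv ℝ φ)
  have h2 : Continuous fun v : V => H.incl v - H.e := H.incl.continuous.sub continuous_const
  exact h2.measurable.comp h1

theorem norm_graphNormal_le {K : ℝ≥0} (hφ : LipschitzWith K φ) (p : V) :
    ‖H.graphNormal φ p‖ ≤ K + 1 := by
  rw [graphNormal]
  refine (norm_sub_le _ _).trans ?_
  rw [H.norm_e, H.incl.norm_map]
  gcongr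
  exact (LinearIsometryEquiv.norm_map _ _).le.trans (norm_fderiv_le_of_lipschitz ℝ hφ)

omit [FiniteDimensional ℝ V] in
theorem hasFDerivAt_height {z : F} (h : DifferentiableAt ℝ φ (H.proj z)) :
    HasFDerivAt (H.height φ) (innerSL ℝ H.e - (fderiv ℝ φ (H.proj z)).comp H.proj) z := by
  have h1 : HasFDerivAt (fun z : F => ⟪H.e, z⟫) (innerSL ℝ H.e) z :=
    (innerSL ℝ H.e).hasFDerivAt
  exact h1.sub (h.hasFDerivAt.comp z H.proj.hasFDerivAt)

theorem fderiv_height_apply {z : F} (h : DifferentiableAt ℝ φ (H.proj z)) (v : F) :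
    fderiv ℝ (H.height φ) z v = -⟪v, H.graphNormal φ (H.proj z)⟫ := by
  rw [(H.hasFDerivAt_height h).fderiv, H.inner_graphNormal]
  simp

end Normal

end HyperplaneSplitting

namespace VekuaCauchy

open GraphArea

variable {n : ℕ} {Ω : Set (Vec n)}

/-- Move from `y` along `u = ν' - ν`, which satisfies `⟪u, ν'⟫ = |u|²/2 = -⟪u, ν⟫`. A nearby point
on this ray cannot lie in `Ω` because of `ν'`, nor outside because of `ν`; the tolerance `|u|/4` is
half of the first-order term. -/
theorem IsOutwardNormal.unique {y ν ν' : Vec n} (h : IsOutwardNormal Ω y ν)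
    (h' : IsOutwardNormal Ω y ν') : ν = ν' := by
  by_contra hne
  set u := ν' - ν with hu
  have hu0 : 0 < ‖u‖ := norm_pos_iff.mpr (sub_ne_zero.mpr (Ne.symm hne))
  have h1 : ‖u‖ ^ 2 = 2 * (1 - ⟪ν, ν'⟫) := by
    rw [hu, norm_sub_sq_real, h.1, h'.1, real_inner_comm]; ring
  have h2 : ⟪u, ν⟫ = -(‖u‖ ^ 2 / 2) := by
    rw [hu, inner_sub_left, real_inner_self_eq_norm_sq, h.1, real_inner_comm]; linarith
  have h3 : ⟪u, ν'⟫ = ‖u‖ ^ 2 / 2 := by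
    rw [hu, inner_sub_left, real_inner_self_eq_norm_sq, h'.1]; linarith
  have hε : 0 < ‖u‖ / 4 := by positivity
  have hline : Tendsto (fun s : ℝ => y + s • u) (𝓝[>] 0) (𝓝 y) := by
    have : Continuous fun s : ℝ => y + s • u := by fun_prop
    have := this.tendsto 0
    rw [zero_smul, add_zero] at this
    exact this.mono_left nhdsWithin_le_nhds
  obtain ⟨s, ⟨hs1, hs2⟩, hs0⟩ := ((hline.eventually ((h.2 _ hε).and (h'.2 _ hε))).and
    self_mem_nhdsWithin).exists
  have hs0 : 0 < s := hs0
  simp only [add_sub_cancel_left, inner_smul_left, norm_smul, Real.norm_eq_abs, abs_of_pos hs0,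
    h2, h3, RCLike.conj_to_real] at hs1 hs2
  have hpos : 0 < s * ‖u‖ ^ 2 := by positivity
  by_cases hz : y + s • u ∈ Ω
  · nlinarith [hs2.1 hz]
  · nlinarith [hs1.2 hz]

theorem IsOutwardNormal.outwardNormal_eq {y ν : Vec n} (h : IsOutwardNormal Ω y ν) :
    outwardNormal Ω y = ν := by
  have hex : ∃ ν, IsOutwardNormal Ω y ν := ⟨ν, h⟩
  rw [outwardNormal, dif_pos hex]
  exact hex.choose_spec.unique h

theorem norm_outwardNormal_le (y : Vec n) : ‖outwardNormal Ω y‖ ≤ 1 := by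
  rw [outwardNormal]
  split_ifs with h
  · exact h.choose_spec.1.le
  · simp

variable {V : Type*} [NormedAddCommGroup V] [InnerProductSpace ℝ V] [FiniteDimensional ℝ V]
  (H : HyperplaneSplitting V (Vec n)) {φ : V → ℝ}

/-- The gradient of the height at the graph point is minus `graphNormal`, so the sign of the height,
which decides membership in `Ω`, is to first order the sign of `-⟪z - y, graphNormal⟫`. Normalizing
divides by an area factor `≥ 1`, which only improves the error. -/
theorem isOutwardNormal_graph {p : V} (hd : DifferentiableAt ℝ φ p)
    (hΩ : ∀ᶠ z in 𝓝 (H.graphMap φ p), (z ∈ Ω ↔ 0 < H.height φ z)) :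
    IsOutwardNormal Ω (H.graphMap φ p)
      ((areaFactor (fderiv ℝ φ p))⁻¹ • H.graphNormal φ p) := by
  set J := areaFactor (fderiv ℝ φ p) with hJ
  have hJ1 : 1 ≤ J := one_le_areaFactor _
  have hJ0 : 0 < J := areaFactor_pos _
  refine ⟨?_, fun ε hε => ?_⟩
  · rw [norm_smul, norm_inv, Real.norm_eq_abs, abs_of_pos hJ0, H.norm_graphNormal,
      inv_mul_cancel₀ hJ0.ne']
  have hd' : DifferentiableAt ℝ φ (H.proj (H.graphMap φ p)) := by rwa [H.proj_graphMap]
  have hlo := (H.hasFDerivAt_height hd').isLittleO.def hε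
  filter_upwards [hΩ, hlo] with z hz hlo
  set v := z - H.graphMap φ p with hv
  have h1 : (innerSL ℝ H.e - (fderiv ℝ φ (H.proj (H.graphMap φ p))).comp H.proj) v
      = -⟪v, H.graphNormal φ p⟫ := by
    rw [H.inner_graphNormal, H.proj_graphMap]
    simp
  rw [H.height_graphMap, h1, sub_zero, sub_neg_eq_add, Real.norm_eq_abs, abs_le] at hlo
  rw [inner_smul_right]
  have h2 : 0 ≤ ε * ‖v‖ := by positivity
  have h3 : ε * ‖v‖ ≤ J * (ε * ‖v‖) := by nlinarith
  constructor
  · intro hzΩ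
    rw [inv_mul_le_iff₀ hJ0]
    linarith [hz.mp hzΩ, hlo.2]
  · intro hzΩ
    rw [le_inv_mul_iff₀ hJ0]
    have := not_lt.mp (fun h => hzΩ (hz.mpr h))
    linarith [hlo.1]

variable {y₀ : Vec n} {r : ℝ}
  (hΩ : ∀ z ∈ Metric.ball y₀ r, (z ∈ Ω ↔ 0 < H.height φ z))

include hΩ in
theorem outwardNormal_graph {p : V} (hd : DifferentiableAt ℝ φ p)
    (hp : H.graphMap φ p ∈ Metric.ball y₀ r) :
    outwardNormal Ω (H.graphMap φ p) =
      (areaFactor (fderiv ℝ φ p))⁻¹ • H.graphNormal φ p :=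
  (isOutwardNormal_graph H hd
    (eventually_of_mem (Metric.isOpen_ball.mem_nhds hp) hΩ)).outwardNormal_eq

omit [FiniteDimensional ℝ V] in
include hΩ in
-- A point of nonnegative height is a limit of points of `Ω` obtained by moving up along `e`; a
-- point of negative height has a neighbourhood missing `Ω`.
theorem mem_closure_iff_height (hφ : Continuous φ) {z : Vec n} (hz : z ∈ Metric.ball y₀ r) :
    z ∈ closure Ω ↔ 0 ≤ H.height φ z := by
  have hc := H.continuous_height hφ
  have hball := Metric.isOpen_ball.mem_nhds hz
  constructor
  · intro h
    by_contra! hneg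
    obtain ⟨w, ⟨hw1, hw2⟩, hw3⟩ := mem_closure_iff_nhds.mp h _
      (Filter.inter_mem hball ((isOpen_lt hc continuous_const).mem_nhds hneg))
    exact absurd ((hΩ w hw1).mp hw3) (not_lt.mpr (le_of_lt hw2))
  · intro h
    have hline : Tendsto (fun s : ℝ => z + s • H.e) (𝓝[>] 0) (𝓝 z) := by
      have : Continuous fun s : ℝ => z + s • H.e := by fun_prop
      have := this.tendsto 0
      rw [zero_smul, add_zero] at this
      exact this.mono_left nhdsWithin_le_nhds
    refine mem_closure_of_tendsto hline ?_
    filter_upwards [hline.eventually hball, self_mem_nhdsWithin] with s hs hs0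
    rw [hΩ _ hs, H.height_add_smul]
    exact add_pos_of_nonneg_of_pos h hs0

omit [FiniteDimensional ℝ V] in
include hΩ in
theorem frontier_inter_ball (hopen : IsOpen Ω) (hφ : Continuous φ) :
    frontier Ω ∩ Metric.ball y₀ r = range (H.graphMap φ) ∩ Metric.ball y₀ r := by
  ext z
  refine and_congr_left fun hz => ?_
  rw [hopen.frontier_eq, Set.mem_sdiff, mem_closure_iff_height H hΩ hφ hz, hΩ z hz, H.range_graphMap,
    mem_ofPred_eq, not_lt]
  exact ⟨fun h => le_antisymm h.2 h.1, fun h => ⟨h.ge, h.le⟩⟩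

variable [MeasurableSpace V] [BorelSpace V] {K : ℝ≥0} (hφ : LipschitzWith K φ)
  (hV : Module.finrank ℝ V = n - 1)

omit [FiniteDimensional ℝ V] [MeasurableSpace V] [BorelSpace V] in
include hΩ hφ hV in
theorem surfaceMeasure_restrict_ball (hopen : IsOpen Ω) :
    (surfaceMeasure Ω).restrict (Metric.ball y₀ r) =
      ((μHE[Module.finrank ℝ V] : Measure (Vec n)).restrict (range (H.graphMap φ))).restrict
        (Metric.ball y₀ r) := by
  rw [surfaceMeasure, Measure.restrict_restrict measurableSet_ball,
    Measure.restrict_restrict measurableSet_ball, inter_comm, frontier_inter_ball H hΩ hopen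
    hφ.continuous, inter_comm, hV]

include hΩ hφ hV in
theorem integral_surfaceMeasure_graph {E : Type*} [NormedAddCommGroup E] [NormedSpace ℝ E]
    (hopen : IsOpen Ω) {f : Vec n → E} (hf : ∀ z ∉ Metric.ball y₀ r, f z = 0) :
    ∫ y, f y ∂(surfaceMeasure Ω) =
      ∫ p, areaFactor (fderiv ℝ φ p) • f (H.graphMap φ p) := by
  rw [← setIntegral_eq_integral_of_forall_compl_eq_zero hf,
    surfaceMeasure_restrict_ball H hΩ hφ hV hopen,
    setIntegral_eq_integral_of_forall_compl_eq_zero hf,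
    setIntegral_range_graph H.norm_graphMap_sub_sq hφ]

include hΩ hφ hV in
-- The area factor of the surface measure cancels the normalization of the normal, leaving the
-- unnormalized `graphNormal`.
theorem flux_graph {E : Type*} [NormedAddCommGroup E] [NormedSpace ℝ E]
    (hopen : IsOpen Ω) {X : Vec n → Vec n →L[ℝ] E} (hX : ∀ z ∉ Metric.ball y₀ r, X z = 0) :
    ∫ y, X y (outwardNormal Ω y) ∂(surfaceMeasure Ω) =
      ∫ p, X (H.graphMap φ p) (H.graphNormal φ p) := by
  rw [integral_surfaceMeasure_graph H hΩ hφ hV hopen fun z hz => by rw [hX z hz]; rfl]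
  refine integral_congr_ae ?_
  filter_upwards [hφ.ae_differentiableAt] with p hp
  by_cases hb : H.graphMap φ p ∈ Metric.ball y₀ r
  · rw [outwardNormal_graph H hΩ hp hb, map_smul, smul_inv_smul₀ (areaFactor_pos _).ne']
  · simp [hX _ hb]

include hΩ hφ hV in
theorem surfaceMeasure_ball_lt_top (hopen : IsOpen Ω) :
    surfaceMeasure Ω (Metric.ball y₀ r) < ⊤ := by
  rw [← Measure.restrict_apply_self, surfaceMeasure_restrict_ball H hΩ hφ hV hopen,
    Measure.restrict_apply_self, Measure.restrict_apply measurableSet_ball]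
  have hsub : Metric.ball y₀ r ∩ range (H.graphMap φ) ⊆
      H.graphMap φ '' (H.proj '' Metric.ball y₀ r) := by
    rintro _ ⟨hz, p, rfl⟩
    exact ⟨p, ⟨_, hz, H.proj_graphMap p⟩, rfl⟩
  refine (measure_mono hsub).trans_lt (measure_image_lt_top H.norm_graphMap_sub_sq hφ ?_)
  exact (H.proj.lipschitz.isBounded_image Metric.isBounded_ball).measure_lt_top

include hΩ hφ hV in
-- On the graph the normal agrees almost everywhere with an explicit measurable function of the
-- projection. The exceptional set is null for the surface measure by Rademacher's theorem and the
-- area formula.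
theorem aestronglyMeasurable_outwardNormal_ball (hopen : IsOpen Ω) :
    AEStronglyMeasurable (outwardNormal Ω) ((surfaceMeasure Ω).restrict (Metric.ball y₀ r)) := by
  have hm : Measurable fun y : Vec n => (areaFactor (fderiv ℝ φ (H.proj y)))⁻¹ •
      H.graphNormal φ (H.proj y) :=
    ((measurable_areaFactor_fderiv φ).inv.smul (H.measurable_graphNormal φ)).comp
      H.proj.continuous.measurable
  refine hm.aestronglyMeasurable.congr ?_
  rw [surfaceMeasure_restrict_ball H hΩ hφ hV hopen]
  have hnull : ∀ᵐ y ∂((μHE[Module.finrank ℝ V] : Measure (Vec n)).restrict (range (H.graphMap φ))),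
      y ∈ range (H.graphMap φ) ∧ DifferentiableAt ℝ φ (H.proj y) := by
    refine (ae_restrict_mem (measurableEmbedding_graph H.norm_graphMap_sub_sq
      hφ).measurableSet_range).and ?_
    rw [restrict_range_graph_eq H.norm_graphMap_sub_sq hφ,
      (measurableEmbedding_graph H.norm_graphMap_sub_sq hφ).ae_map_iff]
    simp only [H.proj_graphMap]
    exact (withDensity_absolutelyContinuous _ _).ae_le hφ.ae_differentiableAt
  filter_upwards [ae_restrict_of_ae hnull, ae_restrict_mem measurableSet_ball] with y hy hyb
  obtain ⟨⟨p, rfl⟩, hd⟩ := hy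
  rw [H.proj_graphMap] at hd ⊢
  exact (outwardNormal_graph H hΩ hd hyb).symm

/-! ### The surface measure of a bounded Lipschitz domain -/

/-- A graph chart of a Lipschitz domain. -/
theorem HasLipschitzBoundary.exists_chart (hlip : HasLipschitzBoundary Ω) {y₀ : Vec n}
    (hy : y₀ ∈ frontier Ω) :
    ∃ (e : Vec n) (he : ‖e‖ = 1) (φ : (ℝ ∙ e)ᗮ → ℝ) (K : ℝ≥0) (r : ℝ), 0 < r ∧
      Module.finrank ℝ (ℝ ∙ e)ᗮ = n - 1 ∧ LipschitzWith K φ ∧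
      ∀ z ∈ Metric.ball y₀ r, (z ∈ Ω ↔ 0 < (HyperplaneSplitting.ofUnit he).height φ z) := by
  obtain ⟨e, φ, K, he, hφ, hz⟩ := hlip y₀ hy
  obtain ⟨r, hr, hz⟩ := Metric.eventually_nhds_iff_ball.mp hz
  refine ⟨e, he, φ, K, r, hr, ?_, hφ, fun z hzr => (hz z hzr).trans sub_pos.symm⟩
  have h1 := (ℝ ∙ e).finrank_add_finrank_orthogonal
  rw [finrank_span_singleton (by rintro rfl; simp at he), finrank_euclideanSpace,
    Fintype.card_fin] at h1
  omega

theorem isFiniteMeasure_surfaceMeasure (hopen : IsOpen Ω) (hbdd : Bornology.IsBounded Ω)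
    (hlip : HasLipschitzBoundary Ω) : IsFiniteMeasure (surfaceMeasure Ω) := by
  have hcomp : IsCompact (frontier Ω) :=
    hbdd.isCompact_closure.of_isClosed_subset isClosed_frontier frontier_subset_closure
  have hfin : surfaceMeasure Ω (frontier Ω) < ⊤ := by
    refine hcomp.measure_lt_top_of_nhdsWithin fun y hy => ?_
    obtain ⟨e, he, φ, K, r, hr, hV, hφ, hz⟩ := hlip.exists_chart hy
    exact ⟨_, mem_nhdsWithin_of_mem_nhds (Metric.ball_mem_nhds y hr),
      surfaceMeasure_ball_lt_top _ hz hφ hV hopen⟩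
  refine ⟨?_⟩
  rwa [surfaceMeasure, Measure.restrict_apply_univ, ← Measure.restrict_apply_self]

theorem aestronglyMeasurable_outwardNormal (hopen : IsOpen Ω) (hbdd : Bornology.IsBounded Ω)
    (hlip : HasLipschitzBoundary Ω) :
    AEStronglyMeasurable (outwardNormal Ω) (surfaceMeasure Ω) := by
  have hcomp : IsCompact (frontier Ω) :=
    hbdd.isCompact_closure.of_isClosed_subset isClosed_frontier frontier_subset_closure
  have hex : ∀ y ∈ frontier Ω, ∃ r : ℝ, 0 < r ∧ AEStronglyMeasurable (outwardNormal Ω)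
      ((surfaceMeasure Ω).restrict (Metric.ball y r)) := by
    intro y hy
    obtain ⟨e, he, φ, K, r, hr, hV, hφ, hz⟩ := hlip.exists_chart hy
    exact ⟨r, hr, aestronglyMeasurable_outwardNormal_ball _ hz hφ hV hopen⟩
  choose! r hr hm using hex
  obtain ⟨t, ht, hcov⟩ := hcomp.elim_nhds_subcover (fun y => Metric.ball y (r y))
    fun y hy => Metric.ball_mem_nhds y (hr y hy)
  have h1 : surfaceMeasure Ω = (surfaceMeasure Ω).restrict (⋃ y : t, Metric.ball (y : Vec n) (r y)) := by
    refine (Measure.restrict_eq_self_of_ae_mem ?_).symm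
    filter_upwards [ae_restrict_mem (μ := (μHE[n - 1] : Measure (Vec n)))
      isClosed_frontier.measurableSet] with y hy
    have := hcov hy
    simpa using this
  rw [h1, aestronglyMeasurable_iUnion_iff]
  exact fun y => hm y (ht y y.2)

end VekuaCauchy
end

noncomputable section

/-! ### Mollification -/

namespace Mollify

open ContinuousLinearMap (lsmul)
open scoped Convolution

variable {G E : Type*} [NormedAddCommGroup G] [InnerProductSpace ℝ G] [FiniteDimensional ℝ G]
  [MeasurableSpace G] [BorelSpace G] [NormedAddCommGroup E] [NormedSpace ℝ E]

/-- A sequence of bump functions shrinking to the origin. -/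
def bump (G : Type*) [NormedAddCommGroup G] (k : ℕ) : ContDiffBump (0 : G) where
  rIn := 1 / (2 * (k + 1))
  rOut := 1 / (k + 1)
  rIn_pos := by positivity
  rIn_lt_rOut := by
    apply one_div_lt_one_div_of_lt <;> linarith [show (0 : ℝ) ≤ k by positivity]

omit [InnerProductSpace ℝ G] [FiniteDimensional ℝ G] [MeasurableSpace G] [BorelSpace G] in
theorem tendsto_bump_rOut : Tendsto (fun k => (bump G k).rOut) atTop (𝓝 0) :=
  tendsto_one_div_add_atTop_nhds_zero_nat

/-- The kernel of the `k`-th mollifier. -/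
def kernel (k : ℕ) : G → ℝ := (bump G k).normed volume

/-- The `k`-th mollification of `f`. -/
def moll (k : ℕ) (f : G → E) : G → E := kernel k ⋆[lsmul ℝ ℝ, volume] f

theorem moll_apply (k : ℕ) (f : G → E) (x : G) :
    moll k f x = ∫ y, kernel k y • f (x - y) := rfl

theorem moll_eq_swap (k : ℕ) (f : G → E) (x : G) :
    moll k f x = ∫ y, kernel k (x - y) • f y := convolution_eq_swap _

theorem contDiff_kernel (k : ℕ) : ContDiff ℝ ∞ (kernel k : G → ℝ) := (bump G k).contDiff_normed

theorem kernel_nonneg (k : ℕ) (y : G) : 0 ≤ kernel k y := (bump G k).nonneg_normed y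

theorem hasCompactSupport_kernel (k : ℕ) : HasCompactSupport (kernel k : G → ℝ) :=
  (bump G k).hasCompactSupport_normed

theorem integral_kernel (k : ℕ) : ∫ y : G, kernel k y = 1 := (bump G k).integral_normed

theorem tsupport_kernel (k : ℕ) : tsupport (kernel k : G → ℝ) = Metric.closedBall 0 (bump G k).rOut :=
  (bump G k).tsupport_normed_eq

theorem kernel_eq_zero {k : ℕ} {y : G} (hy : (bump G k).rOut < ‖y‖) : kernel k y = 0 := by
  refine image_eq_zero_of_notMem_tsupport ?_
  rw [tsupport_kernel, mem_closedBall_zero_iff, not_le]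
  exact hy

theorem integrable_kernel (k : ℕ) : Integrable (kernel k : G → ℝ) :=
  (contDiff_kernel k).continuous.integrable_of_hasCompactSupport (hasCompactSupport_kernel k)

/-- A mollification is an average of `f` over the ball of radius `rOut` about `x`, so a bound there
is inherited. -/
theorem norm_moll_le {k : ℕ} {f : G → E} {x : G} {C : ℝ}
    (hf : ∀ᵐ y, ‖y - x‖ ≤ (bump G k).rOut → ‖f y‖ ≤ C) : ‖moll k f x‖ ≤ C := by
  rw [moll_apply]
  have h1 : ∀ᵐ y, ‖kernel k y • f (x - y)‖ ≤ kernel k y * C := by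
    filter_upwards [(quasiMeasurePreserving_sub_left volume x).ae hf] with y hf
    rw [norm_smul, Real.norm_of_nonneg (kernel_nonneg k y)]
    by_cases hy : ‖y‖ ≤ (bump G k).rOut
    · exact mul_le_mul_of_nonneg_left (hf (by simpa using hy)) (kernel_nonneg k y)
    · rw [kernel_eq_zero (not_le.mp hy), zero_mul, zero_mul]
  refine (norm_integral_le_of_norm_le ((integrable_kernel k).mul_const C) h1).trans ?_
  rw [integral_mul_const, integral_kernel, one_mul]

theorem contDiff_moll [CompleteSpace E] (k : ℕ) {f : G → E} (hf : LocallyIntegrable f) :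
    ContDiff ℝ ∞ (moll k f) :=
  (hasCompactSupport_kernel k).contDiff_convolution_left _ (contDiff_kernel k) hf

theorem tendsto_moll [CompleteSpace E] {f : G → E} {x : G} (hc : ContinuousAt f x)
    (hf : AEStronglyMeasurable f volume) :
    Tendsto (fun k => moll k f x) atTop (𝓝 (f x)) :=
  ContDiffBump.convolution_tendsto_right (φ := bump G) (g := fun _ => f) (k := fun _ => x)
    tendsto_bump_rOut (Eventually.of_forall fun _ => hf)
    (hc.tendsto.comp tendsto_snd) tendsto_const_nhds

/-- Lebesgue differentiation requires kernels whose outer and inner radii have bounded ratio; for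
`bump` this ratio is `2`. -/
theorem ae_tendsto_moll [CompleteSpace E] {f : G → E} (hf : LocallyIntegrable f) :
    ∀ᵐ x, Tendsto (fun k => moll k f x) atTop (𝓝 (f x)) := by
  refine ContDiffBump.ae_convolution_tendsto_right_of_locallyIntegrable (φ := bump G) (K := 2)
    tendsto_bump_rOut (Eventually.of_forall fun k => ?_) hf
  change (1 : ℝ) / (k + 1) ≤ 2 * (1 / (2 * (k + 1)))
  have : (0 : ℝ) < k + 1 := by positivity
  field_simp
  exact le_refl _

/-- The derivative is put on the Lipschitz function rather than on the kernel, so that derivatives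
of mollifications keep the Lipschitz bound and converge almost everywhere. Differentiation under the
integral is dominated by `K` times the kernel. -/
theorem fderiv_moll {f : G → ℝ} {K : ℝ≥0} (hf : LipschitzWith K f) (k : ℕ) (x : G) :
    fderiv ℝ (moll k f) x = moll k (fderiv ℝ f) x := by
  have hk := (contDiff_kernel (G := G) k).continuous
  have h := hasFDerivAt_integral_of_dominated_loc_of_lip (𝕜 := ℝ) (μ := (volume : Measure G))
    (F := fun x y => kernel k y • f (x - y)) (F' := fun y => kernel k y • fderiv ℝ f (x - y))
    (x₀ := x) (s := univ) (bound := fun y => kernel k y * K) univ_mem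
    (Eventually.of_forall fun z => ?_) ?_ ?_ ?_ ?_ ?_
  · exact h.2.fderiv
  · exact (hk.smul (hf.continuous.comp (continuous_const.sub continuous_id))).aestronglyMeasurable
  · exact (hk.smul (hf.continuous.comp
      (continuous_const.sub continuous_id))).integrable_of_hasCompactSupport
        (hasCompactSupport_kernel k).smul_right
  · exact hk.aestronglyMeasurable.smul ((measurable_fderiv ℝ f).comp
      (measurable_const.sub measurable_id)).aestronglyMeasurable
  · refine ae_of_all _ fun y => LipschitzWith.lipschitzOnWith (LipschitzWith.of_dist_le_mul ?_)
    intro a b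
    have h0 : (0 : ℝ) ≤ kernel k y * K := mul_nonneg (kernel_nonneg k y) K.2
    rw [dist_eq_norm, ← smul_sub, norm_smul, Real.norm_of_nonneg (kernel_nonneg k y),
      Real.coe_nnabs, abs_of_nonneg h0, mul_assoc]
    refine mul_le_mul_of_nonneg_left ?_ (kernel_nonneg k y)
    have := hf.dist_le_mul (a - y) (b - y)
    rwa [dist_sub_right, dist_eq_norm (f _)] at this
  · exact (integrable_kernel k).mul_const _
  · have h1 : ∀ᵐ y, DifferentiableAt ℝ f (x - y) :=
      (quasiMeasurePreserving_sub_left volume x).ae hf.ae_differentiableAt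
    filter_upwards [h1] with y hy
    have h2 : HasFDerivAt (fun z => f (z - y)) (fderiv ℝ f (x - y)) x :=
      (hasFDerivAt_comp_sub y).mpr hy.hasFDerivAt
    exact h2.const_smul (kernel k y)

theorem tsupport_moll_subset {f : G → E} {C U : Set G} (hC : IsCompact C) (hU : IsOpen U)
    (hCU : C ⊆ U) (hf : ∀ y ∉ C, f y = 0) :
    ∀ᶠ k in atTop, HasCompactSupport (moll k f) ∧ tsupport (moll k f) ⊆ U := by
  obtain ⟨δ, hδ, hsub⟩ := hC.exists_cthickening_subset_open hU hCU
  filter_upwards [(tendsto_bump_rOut (G := G)).eventually (gt_mem_nhds hδ)] with k hk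
  have h1 : tsupport (moll k f) ⊆ Metric.cthickening δ C := by
    refine closure_minimal (fun x hx => ?_) Metric.isClosed_cthickening
    by_contra hxC
    refine hx (norm_le_zero_iff.mp (norm_moll_le (ae_of_all _ fun y hy => ?_)))
    rw [norm_le_zero_iff]
    refine hf y fun hyC => hxC ?_
    refine Metric.mem_cthickening_of_dist_le x y δ C hyC ?_
    rw [dist_comm, dist_eq_norm]
    exact hy.trans hk.le
  exact ⟨hC.cthickening.of_isClosed_subset (isClosed_tsupport _) h1, h1.trans hsub⟩

/-- An identity in the sense of distributions persists for compactly supported Lipschitz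
test functions. -/
theorem integral_lipschitz_test [CompleteSpace E] {Ω : Set G} (hΩ : IsOpen Ω) {A : G → G →L[ℝ] E}
    {b : G → E} {x : G} {c : E} (hA : IntegrableOn A Ω) (hb : IntegrableOn b Ω)
    (h : ∀ φ : G → ℝ, ContDiff ℝ ∞ φ → HasCompactSupport φ → tsupport φ ⊆ Ω →
      ∫ y in Ω, (A y (gradient φ y) + φ y • b y) = φ x • c)
    {φ : G → ℝ} {K : ℝ≥0} (hφ : LipschitzWith K φ) (hc : HasCompactSupport φ)
    (hs : tsupport φ ⊆ Ω) :
    ∫ y in Ω, (A y (gradient φ y) + φ y • b y) = φ x • c := by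
  obtain ⟨M, hM⟩ := hc.exists_bound_of_continuous hφ.continuous
  have hloc : LocallyIntegrable (fderiv ℝ φ) := by
    have h1 : LocallyIntegrable (fun _ : G => (K : ℝ)) := locallyIntegrable_const _
    refine h1.mono (measurable_fderiv ℝ φ).aestronglyMeasurable (ae_of_all _ fun y => ?_)
    refine le_trans ?_ (le_abs_self _)
    exact norm_fderiv_le_of_lipschitz ℝ hφ
  have h1 : Tendsto (fun k => ∫ y in Ω, (A y (gradient (moll k φ) y) + moll k φ y • b y)) atTop
      (𝓝 (∫ y in Ω, (A y (gradient φ y) + φ y • b y))) := by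
    -- Mollification increases neither the Lipschitz constant `K` nor the supremum bound `M` of the
    -- test function, so the majorant does not depend on `k`.
    refine tendsto_integral_of_dominated_convergence (fun y => ‖A y‖ * K + M * ‖b y‖)
      (fun k => ?_) ((hA.norm.mul_const _).add (hb.norm.const_mul _)) (fun k => ?_) ?_
    · have h2 : Measurable (gradient (moll k φ)) :=
        (InnerProductSpace.toDual ℝ G).symm.continuous.measurable.comp (measurable_fderiv ℝ _)
      have h3 : Continuous (moll k φ) :=
        (contDiff_moll k hφ.continuous.locallyIntegrable).continuous
      exact (ContinuousLinearMap.aestronglyMeasurable_comp₂ (ContinuousLinearMap.id ℝ (G →L[ℝ] E))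
        hA.aestronglyMeasurable h2.aestronglyMeasurable).add
        (h3.aestronglyMeasurable.smul hb.aestronglyMeasurable)
    · refine ae_of_all _ fun y => (norm_add_le _ _).trans (add_le_add ?_ ?_)
      · refine ((A y).le_opNorm _).trans (mul_le_mul_of_nonneg_left ?_ (norm_nonneg _))
        refine (LinearIsometryEquiv.norm_map _ _).le.trans ?_
        rw [fderiv_moll hφ]
        exact norm_moll_le (ae_of_all _ fun z _ => norm_fderiv_le_of_lipschitz ℝ hφ)
      · rw [norm_smul]
        exact mul_le_mul_of_nonneg_right (norm_moll_le (ae_of_all _ fun z _ => hM z)) (norm_nonneg _)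
    · filter_upwards [ae_restrict_of_ae (ae_tendsto_moll hloc)] with y hy
      refine Tendsto.add ?_ ?_
      · refine ((A y).continuous.tendsto _).comp
          (((InnerProductSpace.toDual ℝ G).symm.continuous.tendsto _).comp ?_)
        simpa only [fderiv_moll hφ] using hy
      · exact (tendsto_moll hφ.continuous.continuousAt
          hφ.continuous.aestronglyMeasurable).smul_const _
  have h2 : Tendsto (fun k => moll k φ x • c) atTop (𝓝 (φ x • c)) :=
    (tendsto_moll hφ.continuous.continuousAt hφ.continuous.aestronglyMeasurable).smul_const _
  refine tendsto_nhds_unique h1 (h2.congr' ?_)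
  filter_upwards [tsupport_moll_subset hc.isCompact hΩ hs
    fun y hy => image_eq_zero_of_notMem_tsupport hy] with k hk
  exact (h _ (contDiff_moll k hφ.continuous.locallyIntegrable) hk.1 hk.2).symm

end Mollify

end

noncomputable section

/-! ### The divergence theorem near a boundary point -/

namespace VekuaCauchy

/-- A smooth transition from `0` to `1` on the interval `[1, 2]`. -/
def ramp (s : ℝ) : ℝ := Real.smoothTransition (s - 1)

theorem contDiff_ramp : ContDiff ℝ ∞ ramp :=
  Real.smoothTransition.contDiff.comp (contDiff_id.sub contDiff_const)

theorem ramp_of_le {s : ℝ} (hs : s ≤ 1) : ramp s = 0 :=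
  Real.smoothTransition.zero_of_nonpos (by linarith)

theorem ramp_of_ge {s : ℝ} (hs : 2 ≤ s) : ramp s = 1 :=
  Real.smoothTransition.one_of_one_le (by linarith)

theorem abs_ramp_le (s : ℝ) : |ramp s| ≤ 1 :=
  abs_le.mpr ⟨by linarith [show 0 ≤ ramp s from Real.smoothTransition.nonneg (s - 1)],
    Real.smoothTransition.le_one _⟩

theorem continuous_deriv_ramp : Continuous (deriv ramp) :=
  contDiff_ramp.continuous_deriv (by simp)

theorem hasDerivAt_ramp (s : ℝ) : HasDerivAt ramp (deriv ramp s) s :=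
  (contDiff_ramp.differentiable (by simp) s).hasDerivAt

theorem deriv_ramp_of_lt {s : ℝ} (hs : s < 1) : deriv ramp s = 0 := by
  have h : ramp =ᶠ[𝓝 s] fun _ => 0 := by
    filter_upwards [gt_mem_nhds hs] with y hy using ramp_of_le (le_of_lt hy)
  rw [h.deriv_eq, deriv_const]

theorem deriv_ramp_of_gt {s : ℝ} (hs : 2 < s) : deriv ramp s = 0 := by
  have h : ramp =ᶠ[𝓝 s] fun _ => 1 := by
    filter_upwards [lt_mem_nhds hs] with y hy using ramp_of_ge (le_of_lt hy)
  rw [h.deriv_eq, deriv_const]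

theorem hasCompactSupport_deriv_ramp : HasCompactSupport (deriv ramp) := by
  refine HasCompactSupport.of_support_subset_isCompact (isCompact_Icc (a := 1) (b := 2)) ?_
  intro s hs
  by_contra h
  rw [Set.mem_Icc, not_and_or, not_le, not_le] at h
  exact hs (h.elim deriv_ramp_of_lt deriv_ramp_of_gt)

theorem integrable_deriv_ramp : Integrable (deriv ramp) :=
  continuous_deriv_ramp.integrable_of_hasCompactSupport hasCompactSupport_deriv_ramp

theorem integral_deriv_ramp : ∫ s, deriv ramp s = 1 := by
  have h0 : Tendsto ramp atBot (𝓝 0) := by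
    refine tendsto_const_nhds.congr' ?_
    filter_upwards [eventually_le_atBot (1 : ℝ)] with s hs using (ramp_of_le hs).symm
  have h1 : Tendsto ramp atTop (𝓝 1) := by
    refine tendsto_const_nhds.congr' ?_
    filter_upwards [eventually_ge_atTop (2 : ℝ)] with s hs using (ramp_of_ge hs).symm
  rw [integral_of_hasDerivAt_of_tendsto hasDerivAt_ramp integrable_deriv_ramp h0 h1, sub_zero]

theorem exists_lipschitzWith_ramp : ∃ C, LipschitzWith C ramp := by
  obtain ⟨C, hC⟩ := hasCompactSupport_deriv_ramp.exists_bound_of_continuous continuous_deriv_ramp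
  refine ⟨C.toNNReal, lipschitzWith_of_nnnorm_deriv_le (contDiff_ramp.differentiable (by simp))
    fun s => ?_⟩
  rw [← NNReal.coe_le_coe, coe_nnnorm]
  exact (hC s).trans (Real.le_coe_toNNReal C)

theorem exists_lipschitzWith_mul {G : Type*} [PseudoMetricSpace G] {f g : G → ℝ} {K L : ℝ≥0}
    {M N : ℝ} (hf : LipschitzWith K f) (hg : LipschitzWith L g) (hfM : ∀ x, |f x| ≤ M)
    (hgN : ∀ x, |g x| ≤ N) : ∃ C, LipschitzWith C fun x => f x * g x := by
  refine ⟨(M * L + N * K).toNNReal, LipschitzWith.of_dist_le_mul fun x y => ?_⟩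
  have h1 := hf.dist_le_mul x y
  have h2 := hg.dist_le_mul x y
  rw [Real.dist_eq] at h1 h2 ⊢
  have h3 : f x * g x - f y * g y = f x * (g x - g y) + g y * (f x - f y) := by ring
  rw [h3]
  refine (abs_add_le _ _).trans ?_
  rw [abs_mul, abs_mul]
  have hd : (0 : ℝ) ≤ dist x y := dist_nonneg
  have hM : 0 ≤ M := (abs_nonneg _).trans (hfM x)
  have hN : 0 ≤ N := (abs_nonneg _).trans (hgN x)
  calc |f x| * |g x - g y| + |g y| * |f x - f y|
      ≤ M * (L * dist x y) + N * (K * dist x y) := by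
        gcongr
        · exact hfM x
        · exact hgN y
    _ = (M * L + N * K) * dist x y := by ring
    _ ≤ _ := mul_le_mul_of_nonneg_right (Real.le_coe_toNNReal _) hd

/-- This is the substitution `s ↦ t s` in the second variable, which rescales a layer of thickness
of order `t` to a fixed one. -/
theorem integral_prod_mul_left {V E : Type*} [MeasurableSpace V] (μ : Measure V) [SFinite μ]
    [NormedAddCommGroup E] [NormedSpace ℝ E] {t : ℝ} (ht : 0 < t) (f : V × ℝ → E) :
    ∫ q, f (q.1, t * q.2) ∂(μ.prod volume) = t⁻¹ • ∫ q, f q ∂(μ.prod volume) := by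
  have h1 : MeasurePreserving (fun s : ℝ => t * s) volume (ENNReal.ofReal |t⁻¹| • volume) :=
    ⟨measurable_const_mul t, Real.map_volume_mul_left ht.ne'⟩
  have h2 := (MeasurePreserving.id μ).prod h1
  have h3 : MeasurableEmbedding (Prod.map id (fun s : ℝ => t * s) : V × ℝ → V × ℝ) :=
    MeasurableEmbedding.id.prodMap (measurableEmbedding_mulLeft₀ ht.ne')
  have h4 := h2.integral_comp h3 f
  rw [Measure.prod_smul_right, integral_smul_measure, ENNReal.toReal_ofReal (abs_nonneg _),
    abs_of_pos (inv_pos.mpr ht)] at h4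
  exact h4

open GraphArea HyperplaneSplitting

variable {n : ℕ} {Ω : Set (Vec n)}
variable {V : Type*} [NormedAddCommGroup V] [InnerProductSpace ℝ V] [FiniteDimensional ℝ V]
  [MeasurableSpace V] [BorelSpace V]
  (H : HyperplaneSplitting V (Vec n)) {φ : V → ℝ}

/-- By Fubini in the chart, the cylinder over a null set of the base is null. -/
theorem ae_comp_proj (hφ : Continuous φ) {p : V → Prop}
    (h : ∀ᵐ v, p v) : ∀ᵐ z : Vec n, p (H.proj z) := by
  rw [← (H.measurePreserving_chart hφ).map_eq, (H.measurableEmbedding_chart hφ).ae_map_iff]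
  simp only [H.proj_chart]
  exact Measure.quasiMeasurePreserving_fst.ae h

end VekuaCauchy
end

noncomputable section

namespace VekuaCauchy

open GraphArea HyperplaneSplitting

/-! ### Flux through thin layers above a graph -/

section Flux

variable {n : ℕ} {Ω : Set (Vec n)}
variable {V : Type*} [NormedAddCommGroup V] [InnerProductSpace ℝ V] [FiniteDimensional ℝ V]
  [MeasurableSpace V] [BorelSpace V]
  (H : HyperplaneSplitting V (Vec n)) {φ : V → ℝ} {K : ℝ≥0} (hφ : LipschitzWith K φ)
  {y₀ : Vec n} {r : ℝ} (hΩ : ∀ z ∈ Metric.ball y₀ r, (z ∈ Ω ↔ 0 < H.height φ z))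
  {E : Type*} [NormedAddCommGroup E] [NormedSpace ℝ E] {A : Vec n → Vec n →L[ℝ] E}
  (hA : ContinuousOn A (closure Ω ∩ Metric.ball y₀ r)) {u : Vec n → ℝ}
  (hu : Continuous u) (huc : HasCompactSupport u) (hus : tsupport u ⊆ Metric.ball y₀ r)

/-- The flux of the field `u A` through a thin layer above the graph of `φ`. -/
def layerIntegrand (A : Vec n → Vec n →L[ℝ] E) (u : Vec n → ℝ) (φ : V → ℝ) (t : ℝ)
    (z : Vec n) : E :=
  (t⁻¹ * deriv ramp (t⁻¹ * H.height φ z) * u z) • A z (H.graphNormal φ (H.proj z))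

omit [MeasurableSpace V] [BorelSpace V] in
include hΩ hus in
-- Inside the chart ball, points outside `Ω` have nonpositive height, where the ramp is constant;
-- outside the ball `u` vanishes.
theorem layerIntegrand_eq_zero {t : ℝ} (ht : 0 < t) {z : Vec n} (hz : z ∉ Ω) :
    layerIntegrand H A u φ t z = 0 := by
  rw [layerIntegrand]
  by_cases hb : z ∈ tsupport u
  · have h1 : H.height φ z ≤ 0 := not_lt.mp fun h => hz ((hΩ z (hus hb)).mpr h)
    rw [deriv_ramp_of_lt, mul_zero, zero_mul, zero_smul]
    exact (mul_nonpos_of_nonneg_of_nonpos (inv_nonneg.mpr ht.le) h1).trans_lt one_pos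
  · rw [image_eq_zero_of_notMem_tsupport hb, mul_zero, zero_smul]

include hφ hΩ hA hu hus in
theorem aestronglyMeasurable_layerIntegrand (hopen : IsOpen Ω) {t : ℝ} (ht : 0 < t) :
    AEStronglyMeasurable (layerIntegrand H A u φ t) volume := by
  -- Nothing is known about `A` away from `closure Ω ∩ ball`, so measurability is checked only where
  -- the integrand can be nonzero.
  have hind : layerIntegrand H A u φ t = (Ω ∩ Metric.ball y₀ r).indicator
      (layerIntegrand H A u φ t) := by
    refine (indicator_eq_self.mpr ?_).symm
    intro z hz
    refine ⟨?_, ?_⟩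
    · by_contra h
      exact hz (layerIntegrand_eq_zero H hΩ hus ht h)
    · refine hus (by_contra fun h => hz ?_)
      rw [layerIntegrand, image_eq_zero_of_notMem_tsupport h, mul_zero, zero_smul]
  rw [hind, aestronglyMeasurable_indicator_iff
    (hopen.inter Metric.isOpen_ball).measurableSet]
  have h1 : AEStronglyMeasurable A (volume.restrict (Ω ∩ Metric.ball y₀ r)) :=
    (hA.mono (inter_subset_inter_left _ subset_closure)).aestronglyMeasurable
      (hopen.inter Metric.isOpen_ball).measurableSet
  have h2 : Continuous fun z => t⁻¹ * deriv ramp (t⁻¹ * H.height φ z) * u z :=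
    (continuous_const.mul (continuous_deriv_ramp.comp
      (continuous_const.mul (H.continuous_height hφ.continuous)))).mul hu
  have h3 : Measurable fun z => H.graphNormal φ (H.proj z) :=
    (H.measurable_graphNormal φ).comp H.proj.continuous.measurable
  exact h2.aestronglyMeasurable.smul (ContinuousLinearMap.aestronglyMeasurable_comp₂
    (ContinuousLinearMap.id ℝ (Vec n →L[ℝ] E)) h1 h3.aestronglyMeasurable)

include hφ hΩ hA hu huc hus in
/-- The flux through a thin layer above the graph tends to the flux through the graph. -/
theorem tendsto_integral_layerIntegrand (hopen : IsOpen Ω) :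
    Tendsto (fun t : ℝ => ∫ z, layerIntegrand H A u φ t z) (𝓝[>] 0)
      (𝓝 (∫ p, u (H.graphMap φ p) • A (H.graphMap φ p) (H.graphNormal φ p))) := by
  have hchart := H.continuous_chart hφ.continuous
  obtain ⟨M, hM0, hM⟩ : ∃ M, 0 ≤ M ∧ ∀ z ∈ tsupport u ∩ closure Ω, ‖u z • A z‖ ≤ M := by
    obtain ⟨M, hM⟩ := (huc.isCompact.inter_right isClosed_closure).exists_bound_of_continuousOn
      (hu.continuousOn.smul (hA.mono fun z hz => ⟨hz.2, hus hz.1⟩))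
    exact ⟨max M 0, le_max_right _ _, fun z hz => (hM z hz).trans (le_max_left _ _)⟩
  -- This is the layer integrand in chart coordinates with the height rescaled to `t * q.2`; the
  -- Jacobian `t` absorbs the factor `t⁻¹`. In this form `t = 0` makes sense.
  set G : ℝ → V × ℝ → E := fun t q => deriv ramp q.2 •
    (u (H.chart φ (q.1, t * q.2)) • A (H.chart φ (q.1, t * q.2)) (H.graphNormal φ q.1)) with hG
  have hkey : ∀ t, 0 < t → ∀ q : V × ℝ,
      G t q = t • layerIntegrand H A u φ t (H.chart φ (q.1, t * q.2)) := by
    intro t ht q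
    simp only [hG, layerIntegrand, H.proj_chart, H.height_chart, inv_mul_cancel_left₀ ht.ne',
      smul_smul]
    congr 1
    field_simp
  have hint : ∀ t, 0 < t → ∫ z, layerIntegrand H A u φ t z =
      ∫ q, G t q ∂((volume : Measure V).prod volume) := by
    intro t ht
    rw [H.integral_eq_integral_chart hφ.continuous]
    simp_rw [hkey t ht]
    rw [integral_smul, integral_prod_mul_left volume ht
      (fun q => layerIntegrand H A u φ t (H.chart φ q)), smul_inv_smul₀ ht.ne']
  -- At `t = 0` the integrand is a product of a function of `q.2` and a function of `q.1`, and the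
  -- derivative of the ramp has integral one.
  have hlim0 : ∫ p, u (H.graphMap φ p) • A (H.graphMap φ p) (H.graphNormal φ p) =
      ∫ q, G 0 q ∂((volume : Measure V).prod volume) := by
    rw [← integral_prod_swap]
    simp only [hG, zero_mul, H.chart_zero, Prod.fst_swap, Prod.snd_swap]
    rw [integral_prod_smul (deriv ramp)
      (fun p => u (H.graphMap φ p) • A (H.graphMap φ p) (H.graphNormal φ p)),
      integral_deriv_ramp, one_smul]
  rw [hlim0]
  refine Tendsto.congr' (f₁ := fun t => ∫ q, G t q ∂((volume : Measure V).prod volume)) ?_ ?_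
  · filter_upwards [self_mem_nhdsWithin] with t ht using (hint t ht).symm
  set C : Set V := H.proj '' tsupport u with hC
  have hCc : IsCompact C := huc.isCompact.image H.proj.continuous
  refine tendsto_integral_filter_of_dominated_convergence
    (fun q => C.indicator (fun _ => M * (K + 1)) q.1 * ‖deriv ramp q.2‖) ?_ ?_ ?_ ?_
  · filter_upwards [self_mem_nhdsWithin] with t ht
    rw [show G t = fun q => t • layerIntegrand H A u φ t (H.chart φ (q.1, t * q.2)) from
      funext (hkey t ht)]
    refine AEStronglyMeasurable.const_smul ?_ t
    have h1 : MeasurePreserving (fun s : ℝ => t * s) volume (ENNReal.ofReal |t⁻¹| • volume) :=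
      ⟨measurable_const_mul t, Real.map_volume_mul_left (ne_of_gt ht)⟩
    have h2 := ((MeasurePreserving.id (volume : Measure V)).prod h1).quasiMeasurePreserving
    rw [Measure.prod_smul_right] at h2
    have h3 : Measure.QuasiMeasurePreserving (Prod.map id fun s : ℝ => t * s)
        ((volume : Measure V).prod volume) ((volume : Measure V).prod volume) :=
      h2.mono_right Measure.smul_absolutelyContinuous
    exact ((aestronglyMeasurable_layerIntegrand H hφ hΩ hA hu hus hopen
      ht).comp_quasiMeasurePreserving
        (H.measurePreserving_chart hφ.continuous).quasiMeasurePreserving).comp_quasiMeasurePreserving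
          h3
  · filter_upwards [self_mem_nhdsWithin] with t ht
    have ht : 0 < t := ht
    refine ae_of_all _ fun q => ?_
    -- The derivative of the ramp vanishes for `q.2 < 1`, so only points of height at least `t`
    -- contribute. Within the support of `u` these lie in `Ω`, where `u A` is bounded.
    by_cases hq : q.2 < 1
    · simp only [hG, deriv_ramp_of_lt hq, zero_smul, norm_zero, mul_zero, le_refl]
    by_cases hz : H.chart φ (q.1, t * q.2) ∈ tsupport u
    · have h1 : H.chart φ (q.1, t * q.2) ∈ Ω := by
        rw [hΩ _ (hus hz), H.height_chart]
        exact mul_pos ht (one_pos.trans_le (not_lt.mp hq))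
      have h2 : q.1 ∈ C := ⟨_, hz, H.proj_chart _⟩
      rw [indicator_of_mem h2, hG]
      simp only
      rw [norm_smul, mul_comm]
      refine mul_le_mul_of_nonneg_right ?_ (norm_nonneg _)
      have h3 := hM _ ⟨hz, subset_closure h1⟩
      change ‖(u (H.chart φ (q.1, t * q.2)) • A (H.chart φ (q.1, t * q.2))) _‖ ≤ _
      exact ((ContinuousLinearMap.le_opNorm _ _).trans (mul_le_mul h3 (H.norm_graphNormal_le hφ _)
        (norm_nonneg _) ((norm_nonneg _).trans h3)))
    · simp only [hG, image_eq_zero_of_notMem_tsupport hz, zero_smul, smul_zero, norm_zero]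
      exact mul_nonneg (indicator_nonneg (fun _ _ => mul_nonneg hM0 (by positivity)) _)
        (norm_nonneg _)
  · exact ((integrable_indicator_iff hCc.measurableSet).mpr
      (integrableOn_const hCc.measure_lt_top.ne)).mul_prod integrable_deriv_ramp.norm
  · refine ae_of_all _ fun q => ?_
    by_cases hq : q.2 < 1
    · simp only [hG, deriv_ramp_of_lt hq, zero_smul]
      exact tendsto_const_nhds
    refine Tendsto.const_smul ?_ _
    have hline : Tendsto (fun t : ℝ => H.chart φ (q.1, t * q.2)) (𝓝[>] 0)
        (𝓝 (H.chart φ (q.1, 0 * q.2))) := by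
      have : Continuous fun t : ℝ => H.chart φ (q.1, t * q.2) := hchart.comp (by fun_prop)
      exact (this.tendsto 0).mono_left nhdsWithin_le_nhds
    by_cases hb : H.chart φ (q.1, 0 * q.2) ∈ tsupport u
    · have hball := hus hb
      have hmem : H.chart φ (q.1, 0 * q.2) ∈ closure Ω ∩ Metric.ball y₀ r := by
        refine ⟨?_, hball⟩
        rw [mem_closure_iff_height H hΩ hφ.continuous hball, H.height_chart, zero_mul]
      -- The graph is approached from inside `Ω`, so continuity of `A` relative to the closure
      -- suffices.
      have hw : Tendsto (fun t : ℝ => H.chart φ (q.1, t * q.2)) (𝓝[>] 0)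
          (𝓝[closure Ω ∩ Metric.ball y₀ r] (H.chart φ (q.1, 0 * q.2))) := by
        refine tendsto_nhdsWithin_iff.mpr ⟨hline, ?_⟩
        filter_upwards [hline.eventually (Metric.isOpen_ball.mem_nhds hball),
          self_mem_nhdsWithin] with t h1 h2
        refine ⟨subset_closure ((hΩ _ h1).mpr ?_), h1⟩
        rw [H.height_chart]
        exact mul_pos h2 (one_pos.trans_le (not_lt.mp hq))
      refine ((hu.tendsto _).comp hline).smul ?_
      exact ((ContinuousLinearMap.apply ℝ E (H.graphNormal φ q.1)).continuous.tendsto _).comp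
        (Tendsto.comp (hA _ hmem) hw)
    · rw [image_eq_zero_of_notMem_tsupport hb, zero_smul]
      refine tendsto_const_nhds.congr' ?_
      filter_upwards [hline.eventually ((isClosed_tsupport u).isOpen_compl.mem_nhds hb)] with t ht
      rw [image_eq_zero_of_notMem_tsupport ht, zero_smul]


/-- The distributional identity `-div A + b = c δ_x` on `Ω`, tested against smooth functions. -/
def HasDistribDiv (Ω : Set (Vec n)) (A : Vec n → Vec n →L[ℝ] E) (b : Vec n → E) (x : Vec n)
    (c : E) : Prop :=
  ∀ u : Vec n → ℝ, IsTestFunction Ω u → ∫ y in Ω, (A y (gradient u y) + u y • b y) = u x • c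

variable {b : Vec n → E} {x : Vec n} {c : E}

theorem HasDistribDiv.lipschitz [CompleteSpace E] (hd : HasDistribDiv Ω A b x c) (hopen : IsOpen Ω)
    (hAi : IntegrableOn A Ω) (hbi : IntegrableOn b Ω) {u : Vec n → ℝ} {L : ℝ≥0}
    (hu : LipschitzWith L u) (huc : HasCompactSupport u) (hus : tsupport u ⊆ Ω) :
    ∫ y in Ω, (A y (gradient u y) + u y • b y) = u x • c :=
  Mollify.integral_lipschitz_test hopen hAi hbi (fun v h1 h2 h3 => hd v ⟨h1, h2, h3⟩) hu huc hus

omit [FiniteDimensional ℝ V] [MeasurableSpace V] [BorelSpace V] in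
include hφ in
theorem exists_lipschitzWith_layer {L : ℝ≥0} (huL : LipschitzWith L u) (huc : HasCompactSupport u)
    (t : ℝ) : ∃ C, LipschitzWith C fun z => ramp (t * H.height φ z) * u z := by
  obtain ⟨R, hR⟩ := exists_lipschitzWith_ramp
  obtain ⟨N, hN⟩ := huc.exists_bound_of_continuous huL.continuous
  have h1 : LipschitzWith ‖t‖₊ (fun s : ℝ => t * s) := by
    simpa using lipschitzWith_smul t (β := ℝ)
  exact exists_lipschitzWith_mul (hR.comp (h1.comp (H.lipschitzWith_height hφ))) huL
    (fun z => abs_ramp_le _) hN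

include hφ in
-- The height has gradient `-graphNormal` wherever `φ` is differentiable at the projection, hence
-- almost everywhere; the rest is the product rule.
theorem gradient_layer (hud : Differentiable ℝ u) (t : ℝ) :
    ∀ᵐ z : Vec n, gradient (fun z => ramp (t * H.height φ z) * u z) z =
      ramp (t * H.height φ z) • gradient u z -
        (t * deriv ramp (t * H.height φ z) * u z) • H.graphNormal φ (H.proj z) := by
  filter_upwards [ae_comp_proj H hφ.continuous hφ.ae_differentiableAt] with z hz
  have h1 : HasFDerivAt (H.height φ) (fderiv ℝ (H.height φ) z) z :=
    (H.hasFDerivAt_height hz).differentiableAt.hasFDerivAt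
  have h2 : HasFDerivAt (fun z => ramp (t * H.height φ z))
      (deriv ramp (t * H.height φ z) • t • fderiv ℝ (H.height φ) z) z :=
    (hasDerivAt_ramp _).comp_hasFDerivAt z (h1.const_mul t)
  have h3 : HasFDerivAt (fun z => ramp (t * H.height φ z) * u z) _ z :=
    h2.mul (hud z).hasFDerivAt
  refine ext_inner_right ℝ fun v => ?_
  rw [gradient, InnerProductSpace.toDual_symm_apply, h3.fderiv, inner_sub_left, inner_smul_left,
    inner_smul_left, gradient, InnerProductSpace.toDual_symm_apply, real_inner_comm]
  change ramp (t * H.height φ z) * fderiv ℝ u z v +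
    u z * (deriv ramp (t * H.height φ z) * (t * fderiv ℝ (H.height φ) z v)) = _
  rw [H.fderiv_height_apply hz]
  simp only [RCLike.conj_to_real]
  ring

include hφ hΩ hA in
/-- The divergence theorem for test functions supported in a graph chart. -/
theorem divergence_theorem_graph [CompleteSpace E] (hopen : IsOpen Ω)
    (hV : Module.finrank ℝ V = n - 1) (hAi : IntegrableOn A Ω) (hbi : IntegrableOn b Ω)
    (hd : HasDistribDiv Ω A b x c) (hx : x ∉ Metric.ball y₀ r)
    (hu1 : ContDiff ℝ 1 u) (huc : HasCompactSupport u) (hus : tsupport u ⊆ Metric.ball y₀ r) :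
    ∫ y, u y • A y (outwardNormal Ω y) ∂(surfaceMeasure Ω) =
      ∫ y in Ω, (A y (gradient u y) + u y • b y) := by
  have hu := hu1.continuous
  have hud : Differentiable ℝ u := hu1.differentiable (by simp)
  obtain ⟨L, huL⟩ : ∃ L, LipschitzWith L u :=
    hu1.lipschitzWith_of_hasCompactSupport huc (by simp)
  have hgrad : Measurable (gradient u) :=
    (InnerProductSpace.toDual ℝ (Vec n)).symm.continuous.measurable.comp (measurable_fderiv ℝ u)
  have hgradL : ∀ z, ‖gradient u z‖ ≤ L := fun z =>
    (LinearIsometryEquiv.norm_map _ _).le.trans (norm_fderiv_le_of_lipschitz ℝ huL)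
  obtain ⟨N, hN⟩ := huc.exists_bound_of_continuous hu
  have hF : IntegrableOn (fun y => A y (gradient u y) + u y • b y) Ω := by
    refine Integrable.add ?_ ?_
    · refine (hAi.norm.mul_const (L : ℝ)).mono' (ContinuousLinearMap.aestronglyMeasurable_comp₂
        (ContinuousLinearMap.id ℝ (Vec n →L[ℝ] E)) hAi.aestronglyMeasurable
          hgrad.aestronglyMeasurable) (ae_of_all _ fun z => ?_)
      exact ((A z).le_opNorm _).trans (mul_le_mul_of_nonneg_left (hgradL z) (norm_nonneg _))
    · exact hbi.bdd_smul N hu.aestronglyMeasurable (ae_of_all _ hN)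
  -- The distributional identity is tested with `u` times the ramp of `h / t`, which is only
  -- Lipschitz but compactly supported in `Ω`. Its gradient splits into the ramp times the gradient
  -- of `u` and the layer term; the point mass drops out since `u x = 0`.
  have hmain : ∀ t : ℝ, 0 < t →
      ∫ y in Ω, ramp (t⁻¹ * H.height φ y) • (A y (gradient u y) + u y • b y) =
        ∫ z, layerIntegrand H A u φ t z := by
    intro t ht
    obtain ⟨C, hC⟩ := exists_lipschitzWith_layer H hφ huL huc t⁻¹
    have hcs : HasCompactSupport fun z => ramp (t⁻¹ * H.height φ z) * u z := huc.mul_left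
    have hts : tsupport (fun z => ramp (t⁻¹ * H.height φ z) * u z) ⊆ Ω := by
      have h1 : tsupport (fun z => ramp (t⁻¹ * H.height φ z) * u z) ⊆
          tsupport u ∩ {z | 1 ≤ t⁻¹ * H.height φ z} := by
        refine closure_minimal (fun z hz => ⟨subset_tsupport _ (right_ne_zero_of_mul hz), ?_⟩)
          ((isClosed_tsupport u).inter (isClosed_le continuous_const
            (continuous_const.mul (H.continuous_height hφ.continuous))))
        by_contra h
        exact left_ne_zero_of_mul hz (ramp_of_le (not_le.mp h).le)
      intro z hz
      obtain ⟨h2, h3⟩ := h1 hz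
      refine (hΩ z (hus h2)).mpr ?_
      exact pos_of_mul_pos_right (one_pos.trans_le h3) (inv_nonneg.mpr ht.le)
    have h4 := hd.lipschitz hopen hAi hbi hC hcs hts
    have hux : u x = 0 := image_eq_zero_of_notMem_tsupport fun h => hx (hus h)
    rw [hux, mul_zero, zero_smul] at h4
    have h5 : ∫ z, layerIntegrand H A u φ t z = ∫ z in Ω, layerIntegrand H A u φ t z :=
      (setIntegral_eq_integral_of_forall_compl_eq_zero
        fun z hz => layerIntegrand_eq_zero H hΩ hus ht hz).symm
    have h6 : ∀ᵐ z ∂(volume.restrict Ω),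
        A z (gradient (fun z => ramp (t⁻¹ * H.height φ z) * u z) z) +
          (ramp (t⁻¹ * H.height φ z) * u z) • b z =
        ramp (t⁻¹ * H.height φ z) • (A z (gradient u z) + u z • b z) -
          layerIntegrand H A u φ t z := by
      filter_upwards [ae_restrict_of_ae (gradient_layer H hφ hud t⁻¹)] with z hz
      rw [hz, map_sub, map_smul, map_smul, layerIntegrand]
      module
    have hr : Continuous fun z => ramp (t⁻¹ * H.height φ z) :=
      contDiff_ramp.continuous.comp (continuous_const.mul (H.continuous_height hφ.continuous))
    have h7 : IntegrableOn (fun z => ramp (t⁻¹ * H.height φ z) •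
        (A z (gradient u z) + u z • b z)) Ω :=
      hF.bdd_smul 1 hr.aestronglyMeasurable (ae_of_all _ fun z => abs_ramp_le _)
    have h8 : IntegrableOn (layerIntegrand H A u φ t) Ω := by
      obtain ⟨R, hR⟩ := hasCompactSupport_deriv_ramp.exists_bound_of_continuous
        continuous_deriv_ramp
      refine (hAi.norm.const_mul (t⁻¹ * R * N * (K + 1))).mono'
        (aestronglyMeasurable_layerIntegrand H hφ hΩ hA hu hus hopen ht).restrict
        (ae_of_all _ fun z => ?_)
      rw [layerIntegrand, norm_smul, norm_mul, norm_mul, Real.norm_of_nonneg (inv_nonneg.mpr ht.le)]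
      have h9 := ((A z).le_opNorm (H.graphNormal φ (H.proj z))).trans
        (mul_le_mul_of_nonneg_left (H.norm_graphNormal_le hφ _) (norm_nonneg _))
      have h10 : 0 ≤ t⁻¹ := inv_nonneg.mpr ht.le
      have hR0 : 0 ≤ R := (norm_nonneg _).trans (hR 0)
      have hN0 : 0 ≤ N := (norm_nonneg _).trans (hN 0)
      calc t⁻¹ * ‖deriv ramp (t⁻¹ * H.height φ z)‖ * ‖u z‖ *
            ‖A z (H.graphNormal φ (H.proj z))‖
          ≤ t⁻¹ * R * N * (‖A z‖ * (K + 1)) := by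
            gcongr
            · exact hR _
            · exact hN _
        _ = _ := by ring
    rw [integral_congr_ae h6, integral_sub h7 h8, sub_eq_zero] at h4
    rw [h4, h5]
  -- On `Ω ∩ tsupport u` the height is positive, so the ramp of `h / t` is eventually `1`; off the
  -- support of `u` the integrand vanishes.
  have hlim1 : Tendsto (fun t : ℝ => ∫ y in Ω, ramp (t⁻¹ * H.height φ y) •
      (A y (gradient u y) + u y • b y)) (𝓝[>] 0)
      (𝓝 (∫ y in Ω, (A y (gradient u y) + u y • b y))) := by
    refine tendsto_integral_filter_of_dominated_convergence
      (fun y => ‖A y (gradient u y) + u y • b y‖) ?_ ?_ hF.norm ?_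
    · refine Eventually.of_forall fun t => ?_
      have hr : Continuous fun z => ramp (t⁻¹ * H.height φ z) :=
        contDiff_ramp.continuous.comp (continuous_const.mul (H.continuous_height hφ.continuous))
      exact hr.aestronglyMeasurable.smul hF.aestronglyMeasurable
    · refine Eventually.of_forall fun t => ae_of_all _ fun z => ?_
      rw [norm_smul]
      exact mul_le_of_le_one_left (norm_nonneg _) (abs_ramp_le _)
    · filter_upwards [ae_restrict_mem hopen.measurableSet] with z hz
      refine tendsto_const_nhds.congr' ?_
      by_cases hb : z ∈ tsupport u
      · have hpos := (hΩ z (hus hb)).mp hz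
        have h1 : Tendsto (fun t : ℝ => t⁻¹ * H.height φ z) (𝓝[>] 0) atTop :=
          tendsto_inv_nhdsGT_zero.atTop_mul_const hpos
        filter_upwards [h1.eventually_ge_atTop 2] with t ht
        rw [ramp_of_ge ht, one_smul]
      · have h1 : u z = 0 := image_eq_zero_of_notMem_tsupport hb
        have h2 : gradient u z = 0 := by
          rw [gradient, (notMem_tsupport_iff_eventuallyEq.mp hb).fderiv_eq]
          simp
        simp [h1, h2]
  have hlim2 := tendsto_integral_layerIntegrand H hφ hΩ hA hu huc hus hopen
  have hflux : ∫ y, u y • A y (outwardNormal Ω y) ∂(surfaceMeasure Ω) =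
      ∫ p, u (H.graphMap φ p) • A (H.graphMap φ p) (H.graphNormal φ p) :=
    flux_graph H hΩ hφ hV hopen (X := fun z => u z • A z) fun z hz => by
      rw [image_eq_zero_of_notMem_tsupport fun h => hz (hus h), zero_smul]
  rw [hflux]
  refine tendsto_nhds_unique hlim2 (hlim1.congr' ?_)
  filter_upwards [self_mem_nhdsWithin] with t ht using hmain t ht

end Flux

end VekuaCauchy
end

noncomputable section

namespace VekuaCauchy

/-! ### The divergence theorem on a bounded Lipschitz domain -/

section Divergence

variable {n : ℕ} {Ω : Set (Vec n)} {E : Type*} [NormedAddCommGroup E] [NormedSpace ℝ E]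
  {A : Vec n → Vec n →L[ℝ] E} {b : Vec n → E} {x : Vec n} {c : E}

theorem surfaceMeasure_ae_mem_frontier (Ω : Set (Vec n)) :
    ∀ᵐ y ∂(surfaceMeasure Ω), y ∈ frontier Ω :=
  ae_restrict_mem isClosed_frontier.measurableSet

theorem ContinuousOn.aestronglyMeasurable_surfaceMeasure {F : Type*} [TopologicalSpace F]
    [TopologicalSpace.PseudoMetrizableSpace F] [SecondCountableTopologyEither (Vec n) F]
    {f : Vec n → F}
    (hf : ContinuousOn f (frontier Ω)) : AEStronglyMeasurable f (surfaceMeasure Ω) :=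
  hf.aestronglyMeasurable isClosed_frontier.measurableSet

theorem integrable_smul_flux (hopen : IsOpen Ω) (hbdd : Bornology.IsBounded Ω)
    (hlip : HasLipschitzBoundary Ω) (hA : ContinuousOn A (frontier Ω)) {u : Vec n → ℝ}
    (hu : Continuous u) :
    Integrable (fun y => u y • A y (outwardNormal Ω y)) (surfaceMeasure Ω) := by
  have := isFiniteMeasure_surfaceMeasure hopen hbdd hlip
  have hcomp : IsCompact (frontier Ω) :=
    hbdd.isCompact_closure.of_isClosed_subset isClosed_frontier frontier_subset_closure
  obtain ⟨M, hM⟩ := hcomp.exists_bound_of_continuousOn (hu.continuousOn.smul hA)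
  have hAm : AEStronglyMeasurable A (surfaceMeasure Ω) :=
    ContinuousOn.aestronglyMeasurable_surfaceMeasure hA
  refine Integrable.of_bound (C := M) (hu.aestronglyMeasurable.smul
    (ContinuousLinearMap.aestronglyMeasurable_comp₂ (ContinuousLinearMap.id ℝ (Vec n →L[ℝ] E))
      hAm (aestronglyMeasurable_outwardNormal hopen hbdd hlip))) ?_
  filter_upwards [surfaceMeasure_ae_mem_frontier Ω] with y hy
  change ‖(u y • A y) (outwardNormal Ω y)‖ ≤ M
  refine ((ContinuousLinearMap.le_opNorm _ _).trans
    (mul_le_of_le_one_right (norm_nonneg _) (norm_outwardNormal_le y))).trans (hM y hy)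

theorem integrableOn_apply_gradient (hopen : IsOpen Ω) (hbdd : Bornology.IsBounded Ω)
    (hAi : IntegrableOn A Ω) {u : Vec n → ℝ} (hu : ContDiff ℝ 1 u) :
    IntegrableOn (fun y => A y (gradient u y)) Ω := by
  have hg : Continuous (gradient u) :=
    (InnerProductSpace.toDual ℝ (Vec n)).symm.continuous.comp (hu.continuous_fderiv (by simp))
  obtain ⟨L, hL⟩ := hbdd.isCompact_closure.exists_bound_of_continuousOn hg.continuousOn
  refine (hAi.norm.mul_const L).mono' (ContinuousLinearMap.aestronglyMeasurable_comp₂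
    (ContinuousLinearMap.id ℝ (Vec n →L[ℝ] E)) hAi.aestronglyMeasurable
      hg.aestronglyMeasurable) ((ae_restrict_mem hopen.measurableSet).mono fun z hz => ?_)
  exact ((A z).le_opNorm _).trans
    (mul_le_mul_of_nonneg_left (hL z (subset_closure hz)) (norm_nonneg _))

theorem integrableOn_smul_of_continuous (hopen : IsOpen Ω) (hbdd : Bornology.IsBounded Ω)
    (hbi : IntegrableOn b Ω) {u : Vec n → ℝ} (hu : Continuous u) :
    IntegrableOn (fun y => u y • b y) Ω := by
  obtain ⟨N, hN⟩ := hbdd.isCompact_closure.exists_bound_of_continuousOn hu.continuousOn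
  exact hbi.bdd_smul N hu.aestronglyMeasurable
    ((ae_restrict_mem hopen.measurableSet).mono fun z hz => hN z (subset_closure hz))

theorem integrableOn_gradient_add (hopen : IsOpen Ω) (hbdd : Bornology.IsBounded Ω)
    (hAi : IntegrableOn A Ω) (hbi : IntegrableOn b Ω) {u : Vec n → ℝ} (hu : ContDiff ℝ 1 u) :
    IntegrableOn (fun y => A y (gradient u y) + u y • b y) Ω :=
  (integrableOn_apply_gradient hopen hbdd hAi hu).add
    (integrableOn_smul_of_continuous hopen hbdd hbi hu.continuous)

/-- The divergence theorem for test functions with small support. -/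
theorem exists_nhds_divergence_theorem [CompleteSpace E] (hopen : IsOpen Ω)
    (hbdd : Bornology.IsBounded Ω) (hlip : HasLipschitzBoundary Ω)
    (hA : ContinuousOn A (closure Ω \ {x})) (hAi : IntegrableOn A Ω) (hbi : IntegrableOn b Ω)
    (hd : HasDistribDiv Ω A b x c) (hx : x ∉ frontier Ω) {y₀ : Vec n} (hy : y₀ ∈ closure Ω) :
    ∃ U : Set (Vec n), IsOpen U ∧ y₀ ∈ U ∧ ∀ u : Vec n → ℝ, ContDiff ℝ 1 u → tsupport u ⊆ U →
      ∫ y, u y • A y (outwardNormal Ω y) ∂(surfaceMeasure Ω) =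
        (∫ y in Ω, (A y (gradient u y) + u y • b y)) - Ω.indicator (fun z => u z • c) x := by
  by_cases hyΩ : y₀ ∈ Ω
  · refine ⟨Ω, hopen, hyΩ, fun u hu hus => ?_⟩
    have huc : HasCompactSupport u :=
      hbdd.isCompact_closure.of_isClosed_subset (isClosed_tsupport u) (hus.trans subset_closure)
    obtain ⟨L, huL⟩ := hu.lipschitzWith_of_hasCompactSupport huc (by simp)
    rw [hd.lipschitz hopen hAi hbi huL huc hus]
    have h1 : ∫ y, u y • A y (outwardNormal Ω y) ∂(surfaceMeasure Ω) = 0 := by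
      refine integral_eq_zero_of_ae ?_
      filter_upwards [surfaceMeasure_ae_mem_frontier Ω] with y hy
      have h2 : y ∉ tsupport u := fun h =>
        (hopen.frontier_eq ▸ hy : y ∈ closure Ω \ Ω).2 (hus h)
      rw [image_eq_zero_of_notMem_tsupport h2, zero_smul, Pi.zero_apply]
    rw [h1]
    by_cases hxΩ : x ∈ Ω
    · rw [indicator_of_mem hxΩ, sub_self]
    · rw [indicator_of_notMem hxΩ, image_eq_zero_of_notMem_tsupport fun h => hxΩ (hus h),
        zero_smul, sub_zero]
  · have hyf : y₀ ∈ frontier Ω := hopen.frontier_eq ▸ ⟨hy, hyΩ⟩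
    have hne : y₀ ≠ x := fun h => hx (h ▸ hyf)
    obtain ⟨e, he, φ, K, r, hr, hV, hφ, hz⟩ := hlip.exists_chart hyf
    -- Shrinking the chart ball keeps the pole outside it, so there the field is continuous up to
    -- the boundary and the indicator term is zero.
    have hx' : x ∉ Metric.ball y₀ (min r (dist x y₀)) := fun h =>
      (lt_min_iff.mp (Metric.mem_ball.mp h)).2.false
    refine ⟨Metric.ball y₀ (min r (dist x y₀)), Metric.isOpen_ball,
      Metric.mem_ball_self (lt_min hr (dist_pos.mpr hne.symm)), fun u hu hus => ?_⟩
    have huc : HasCompactSupport u :=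
      Metric.isCompact_of_isClosed_isBounded (isClosed_tsupport u) (Metric.isBounded_ball.subset hus)
    rw [divergence_theorem_graph (HyperplaneSplitting.ofUnit he) hφ
      (fun z hzb => hz z (Metric.ball_subset_ball (min_le_left _ _) hzb))
      (hA.mono fun z hzb => ⟨hzb.1, ?_⟩) hopen hV hAi hbi hd hx' hu huc hus]
    · classical
      have hux : u x = 0 := image_eq_zero_of_notMem_tsupport fun h => hx' (hus h)
      rw [indicator_apply, hux, zero_smul, ite_self, sub_zero]
    · rintro rfl
      exact hx' hzb.2

open scoped Manifold in
/-- **Divergence theorem** on a bounded Lipschitz domain, for a field which is continuous up to the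
boundary and whose distributional divergence is the sum of an integrable function and a point mass
at `x`. -/
theorem divergence_theorem [CompleteSpace E] (hopen : IsOpen Ω)
    (hbdd : Bornology.IsBounded Ω) (hlip : HasLipschitzBoundary Ω)
    (hA : ContinuousOn A (closure Ω \ {x})) (hAi : IntegrableOn A Ω) (hbi : IntegrableOn b Ω)
    (hd : HasDistribDiv Ω A b x c) (hx : x ∉ frontier Ω) {u : Vec n → ℝ} (hu : ContDiff ℝ 1 u) :
    ∫ y, u y • A y (outwardNormal Ω y) ∂(surfaceMeasure Ω) =
      (∫ y in Ω, (A y (gradient u y) + u y • b y)) - Ω.indicator (fun z => u z • c) x := by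
  have hloc := fun (y₀ : Vec n) (hy : y₀ ∈ closure Ω) =>
    exists_nhds_divergence_theorem hopen hbdd hlip hA hAi hbi hd hx hy
  choose! U hUo hUm hU using hloc
  obtain ⟨t, ht, hcov⟩ := hbdd.isCompact_closure.elim_nhds_subcover U
    fun y hy => (hUo y hy).mem_nhds (hUm y hy)
  -- All terms of the formula are additive in `u`. The functions sum to `1` only on the closure of
  -- `Ω`; the identity for gradients is therefore used on the open set `Ω`.
  obtain ⟨f, hf⟩ := SmoothPartitionOfUnity.exists_isSubordinate 𝓘(ℝ, Vec n)
    isClosed_closure (fun i : t => U i) (fun i => hUo i (ht i i.2))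
    (fun z hz => by simpa using hcov hz)
  have hfA : ContinuousOn A (frontier Ω) :=
    hA.mono fun z hz => ⟨frontier_subset_closure hz, fun h => hx (h ▸ hz)⟩
  set v : t → Vec n → ℝ := fun i z => f i z * u z with hv
  have hv1 : ∀ i, ContDiff ℝ 1 (v i) := fun i =>
    ((f i).contMDiff.contDiff.of_le (by exact_mod_cast le_top)).mul hu
  have hsum : ∀ z ∈ closure Ω, ∑ i, v i z = u z := by
    intro z hz
    simp only [hv]
    rw [← Finset.sum_mul, ← finsum_eq_sum_of_fintype, f.sum_eq_one hz, one_mul]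
  have hvU : ∀ i, tsupport (v i) ⊆ U i := fun i =>
    (tsupport_mul_subset_left).trans (hf i)
  have hgrad : ∀ z ∈ Ω, ∑ i, gradient (v i) z = gradient u z := by
    intro z hz
    have h1 : (fun z => ∑ i, v i z) =ᶠ[𝓝 z] u := by
      filter_upwards [hopen.mem_nhds hz] with w hw using hsum w (subset_closure hw)
    have h2 : fderiv ℝ (fun z => ∑ i, v i z) z = ∑ i, fderiv ℝ (v i) z :=
      fderiv_fun_sum fun i _ => (hv1 i).differentiable (by simp) z
    simp only [gradient]
    rw [← map_sum, ← h2, h1.fderiv_eq]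
  have hL : ∫ y, u y • A y (outwardNormal Ω y) ∂(surfaceMeasure Ω) =
      ∑ i, ∫ y, v i y • A y (outwardNormal Ω y) ∂(surfaceMeasure Ω) := by
    rw [← integral_finsetSum _ fun i _ =>
      integrable_smul_flux hopen hbdd hlip hfA (hv1 i).continuous]
    refine integral_congr_ae ?_
    filter_upwards [surfaceMeasure_ae_mem_frontier Ω] with y hy
    rw [← hsum y (frontier_subset_closure hy), Finset.sum_smul]
  have hR : ∫ y in Ω, (A y (gradient u y) + u y • b y) =
      ∑ i, ∫ y in Ω, (A y (gradient (v i) y) + v i y • b y) := by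
    rw [← integral_finsetSum _ fun i _ => integrableOn_gradient_add hopen hbdd hAi hbi (hv1 i)]
    refine integral_congr_ae ?_
    filter_upwards [ae_restrict_mem hopen.measurableSet] with y hy
    rw [← hsum y (subset_closure hy), ← hgrad y hy, map_sum, Finset.sum_smul,
      Finset.sum_add_distrib]
  have hI : Ω.indicator (fun z => u z • c) x = ∑ i, Ω.indicator (fun z => v i z • c) x := by
    by_cases hxΩ : x ∈ Ω
    · simp only [indicator_of_mem hxΩ]
      rw [← hsum x (subset_closure hxΩ), Finset.sum_smul]
    · simp only [indicator_of_notMem hxΩ, Finset.sum_const_zero]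
  rw [hL, hR, hI, ← Finset.sum_sub_distrib]
  exact Finset.sum_congr rfl fun i _ => hU i (ht i i.2) (v i) (hv1 i) (hvU i)

end Divergence

end VekuaCauchy
end

noncomputable section

namespace VekuaCauchy

/-! ### The Cauchy-Pompeiu formula for Clifford-valued functions -/

variable {n : ℕ} {Ω : Set (Vec n)}

/-- The field `h ↦ a h` of right multiplications by vectors. -/
def rightField (n : ℕ) : Cl n →L[ℝ] Vec n →L[ℝ] Cl n :=
  ((ContinuousLinearMap.compL ℝ (Vec n) (Cl n) (Cl n)).flip (vecL n)).comp (mulL n)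

@[simp] theorem rightField_apply (a : Cl n) (h : Vec n) : rightField n a h = a * vec h := rfl

theorem vec_gradient (u : Vec n → ℝ) (y : Vec n) :
    vec (gradient u y) = ∑ i, fderiv ℝ u y (unitVec i) • vec (unitVec i) := by
  have h := (EuclideanSpace.basisFun (Fin n) ℝ).sum_repr' (gradient u y)
  conv_lhs => rw [← h]
  rw [← vecL_apply, map_sum]
  refine Finset.sum_congr rfl fun i _ => ?_
  rw [map_smul, real_inner_comm, gradient, InnerProductSpace.toDual_symm_apply,
    EuclideanSpace.basisFun_apply]
  rfl

theorem dirac_smul {u : Vec n → ℝ} {v : Vec n → Cl n} {y : Vec n} (hu : DifferentiableAt ℝ u y)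
    (hv : DifferentiableAt ℝ v y) :
    dirac (fun z => u z • v z) y = vec (gradient u y) * v y + u y • dirac v y := by
  have h : fderiv ℝ (fun z => u z • v z) y = u y • fderiv ℝ v y + (fderiv ℝ u y).smulRight (v y) :=
    fderiv_fun_smul hu hv
  rw [dirac, h, vec_gradient, dirac, Finset.sum_mul, Finset.smul_sum, ← Finset.sum_add_distrib]
  refine Finset.sum_congr rfl fun i _ => ?_
  change vec (unitVec i) * (u y • fderiv ℝ v y (unitVec i) + fderiv ℝ u y (unitVec i) • v y) = _
  rw [mul_add, mul_smul_comm, mul_smul_comm, smul_mul_assoc, add_comm]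

theorem dirac_sum {ι : Type*} (s : Finset ι) {v : ι → Vec n → Cl n} {y : Vec n}
    (hv : ∀ i ∈ s, DifferentiableAt ℝ (v i) y) :
    dirac (fun z => ∑ i ∈ s, v i z) y = ∑ i ∈ s, dirac (v i) y := by
  simp only [dirac, fderiv_fun_sum hv, sum_apply, Finset.mul_sum]
  rw [Finset.sum_comm]

theorem dirac_const (a : Cl n) (y : Vec n) : dirac (fun _ => a) y = 0 := by
  simp [dirac]

theorem continuous_dirac {v : Vec n → Cl n} (hv : ContDiff ℝ 1 v) : Continuous (dirac v) := by
  unfold dirac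
  refine continuous_finsetSum _ fun i _ => ?_
  exact ((mulL n) (vec (unitVec i))).continuous.comp
    ((hv.continuous_fderiv (by simp)).clm_apply continuous_const)

/-- The coordinate functionals of the Clifford algebra. -/
def coordL (s : Finset (Fin n)) : Cl n →L[ℝ] ℝ :=
  LinearMap.toContinuousLinearMap ((blade n).coord s)

theorem sum_coordL_smul (a : Cl n) : ∑ s, coordL s a • blade n s = a := (blade n).sum_repr a

/-- **Cauchy-Pompeiu formula.** -/
theorem cauchy_pompeiu (hopen : IsOpen Ω) (hbdd : Bornology.IsBounded Ω)
    (hlip : HasLipschitzBoundary Ω) {K g : Vec n → Cl n} {x : Vec n}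
    (hK : ContinuousOn K (closure Ω \ {x})) (hKi : IntegrableOn K Ω) (hgi : IntegrableOn g Ω)
    (hd : HasDistribDiv Ω (fun y => rightField n (K y)) g x (-1)) (hx : x ∉ frontier Ω)
    {v : Vec n → Cl n} (hv : ContDiff ℝ 1 v) :
    boundaryIntegral Ω K v =
      (∫ y in Ω, (K y * dirac v y + g y * v y)) + Ω.indicator v x := by
  have hA : ContinuousOn (fun y => rightField n (K y)) (closure Ω \ {x}) :=
    (rightField n).continuous.comp_continuousOn hK
  have hAi : IntegrableOn (fun y => rightField n (K y)) Ω := (rightField n).integrable_comp hKi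
  have hfA : ContinuousOn (fun y => rightField n (K y)) (frontier Ω) :=
    hA.mono fun z hz => ⟨frontier_subset_closure hz, fun h => hx (h ▸ hz)⟩
  -- Expanding `v` in the basis reduces the claim to real test functions. The divergence theorem is
  -- applied to the field `h ↦ K h` and each coordinate, and the result is multiplied by the basis
  -- element on the right.
  set u : Finset (Fin n) → Vec n → ℝ := fun s y => coordL s (v y) with hu
  have hu1 : ∀ s, ContDiff ℝ 1 (u s) := fun s => (coordL s).contDiff.comp hv
  have hsum : ∀ y, v y = ∑ s, u s y • blade n s := fun y => (sum_coordL_smul (v y)).symm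
  have hdir : ∀ y, dirac v y = ∑ s, vec (gradient (u s) y) * blade n s := by
    intro y
    have h1 : v = fun y => ∑ s, u s y • blade n s := funext hsum
    have h2 : ∀ s, DifferentiableAt ℝ (u s) y := fun s => (hu1 s).differentiable (by simp) y
    conv_lhs => rw [h1]
    rw [dirac_sum _ fun s _ => (h2 s).smul_const _]
    refine Finset.sum_congr rfl fun s _ => ?_
    rw [dirac_smul (h2 s) (differentiableAt_const _), dirac_const, smul_zero, add_zero]
  set ρ : Finset (Fin n) → Cl n →L[ℝ] Cl n := fun s => (mulL n).flip (blade n s) with hρ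
  have hint1 := fun s => integrable_smul_flux hopen hbdd hlip hfA (hu1 s).continuous
  have hint2 := fun s => integrableOn_gradient_add hopen hbdd hAi hgi (hu1 s)
  have hL : boundaryIntegral Ω K v = ∑ s, ρ s
      (∫ y, u s y • rightField n (K y) (outwardNormal Ω y) ∂(surfaceMeasure Ω)) := by
    simp only [← ContinuousLinearMap.integral_comp_comm _ (hint1 _)]
    rw [← integral_finsetSum _ fun s _ => (ρ s).integrable_comp (hint1 s), boundaryIntegral]
    refine integral_congr_ae (ae_of_all _ fun y => ?_)
    simp only [boundaryIntegrand]
    rw [hsum y, Finset.mul_sum]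
    refine Finset.sum_congr rfl fun s _ => ?_
    simp only [hρ, ContinuousLinearMap.flip_apply, mulL_apply, rightField_apply, smul_mul_assoc,
      mul_smul_comm]
  have hR : (∫ y in Ω, (K y * dirac v y + g y * v y)) = ∑ s, ρ s
      (∫ y in Ω, (rightField n (K y) (gradient (u s) y) + u s y • g y)) := by
    simp only [← ContinuousLinearMap.integral_comp_comm _ (hint2 _)]
    rw [← integral_finsetSum _ fun s _ => (ρ s).integrable_comp (hint2 s)]
    refine integral_congr_ae (ae_of_all _ fun y => ?_)
    simp only
    rw [hdir y, hsum y, Finset.mul_sum, Finset.mul_sum, ← Finset.sum_add_distrib]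
    refine Finset.sum_congr rfl fun s _ => ?_
    simp only [hρ, ContinuousLinearMap.flip_apply, mulL_apply, rightField_apply, add_mul,
      smul_mul_assoc, mul_smul_comm, mul_assoc]
  have hI : Ω.indicator v x = -∑ s, ρ s (Ω.indicator (fun z => u s z • (-1 : Cl n)) x) := by
    by_cases hxΩ : x ∈ Ω
    · simp only [indicator_of_mem hxΩ]
      rw [hsum x, ← Finset.sum_neg_distrib]
      refine Finset.sum_congr rfl fun s _ => ?_
      simp only [hρ, ContinuousLinearMap.flip_apply, mulL_apply, smul_mul_assoc, neg_mul, one_mul,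
        smul_neg, neg_neg]
    · simp only [indicator_of_notMem hxΩ, map_zero, Finset.sum_const_zero, neg_zero]
  rw [hL, hR, hI, ← sub_eq_add_neg, ← Finset.sum_sub_distrib]
  refine Finset.sum_congr rfl fun s _ => ?_
  rw [← map_sub, divergence_theorem hopen hbdd hlip hA hAi hgi hd hx (hu1 s)]

/-- The conjugate of the distributional equation of a fundamental solution. -/
theorem IsFundamentalSolution.hasDistribDiv (hopen : IsOpen Ω) (hbdd : Bornology.IsBounded Ω)
    {T : (Vec n → Cl n) → Vec n → Cl n} {K : Vec n → Cl n} {x : Vec n}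
    (h : IsFundamentalSolution T Ω x fun y => -star (K y)) (hKi : IntegrableOn K Ω)
    (hTi : IntegrableOn (T fun y => -star (K y)) Ω) :
    HasDistribDiv Ω (fun y => rightField n (K y)) (fun y => star (T (fun y => -star (K y)) y))
      x (-1) := by
  intro φ hφ
  have hφ1 : ContDiff ℝ 1 φ := hφ.smooth.of_le (by exact_mod_cast le_top)
  have hAi : IntegrableOn (fun y => rightField n (K y)) Ω := (rightField n).integrable_comp hKi
  have h1 := integrableOn_apply_gradient hopen hbdd hAi hφ1
  have h2 := integrableOn_smul_of_continuous hopen hbdd hTi hφ1.continuous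
  have h3 := integrableOn_smul_of_continuous hopen hbdd ((starL n).integrable_comp hTi)
    hφ1.continuous
  -- Conjugation reverses the order and changes the sign of the vector, which cancels the sign in
  -- `-star (K y)`: left multiplication by the gradient becomes right multiplication of `K`.
  have hG : ∀ y, ∑ i, fderiv ℝ φ y (unitVec i) • (vec (unitVec i) * -star (K y)) =
      starL n (rightField n (K y) (gradient φ y)) := by
    intro y
    rw [rightField_apply, vec_gradient, Finset.mul_sum, map_sum]
    refine Finset.sum_congr rfl fun i _ => ?_
    rw [starL_apply, mul_smul_comm, CliffordAlgebra.star_smul, star_mul, star_vec, neg_mul, mul_neg]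
  have heq := h.equation φ hφ
  rw [distPairing] at heq
  simp only [hG] at heq
  rw [(starL n).integral_comp_comm h1] at heq
  have h4 := congrArg (starL n) heq
  rw [map_sub, map_neg, starL_apply (starL n _), starL_apply, star_star,
    ← (starL n).integral_comp_comm h2, map_smul, starL_apply, star_one] at h4
  refine (integral_add h1 h3).trans ?_
  rw [smul_neg, ← h4]
  simp only [map_smul, starL_apply]
  abel

end VekuaCauchy
end

noncomputable section

/-! ### Limits in the mean -/

section L1Limits

variable {X E F : Type*} [MeasurableSpace X] {μ : Measure X} [NormedAddCommGroup E]
  [NormedSpace ℝ E] [NormedAddCommGroup F] [NormedSpace ℝ F]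

omit [NormedSpace ℝ E] in
theorem integrable_of_tendsto_lintegral {f : ℕ → X → E} {g : X → E}
    (hf : ∀ k, Integrable (f k) μ) (hg : AEStronglyMeasurable g μ)
    (h : Tendsto (fun k => ∫⁻ y, ‖f k y - g y‖ₑ ∂μ) atTop (𝓝 0)) : Integrable g μ := by
  obtain ⟨k, hk⟩ := (h.eventually (gt_mem_nhds ENNReal.zero_lt_top)).exists
  have h1 : Integrable (fun y => f k y - g y) μ := ⟨(hf k).aestronglyMeasurable.sub hg, hk⟩
  have h2 := (hf k).sub h1
  refine h2.congr (ae_of_all _ fun y => ?_)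
  simp

/-- Convergence in the mean survives multiplication by a bounded operator-valued function. It is
used on the boundary and, away from the pole, in the domain. -/
theorem tendsto_integral_clm_of_L1 {P : X → E →L[ℝ] F} {M : ℝ} (hP : AEStronglyMeasurable P μ)
    (hM : ∀ᵐ y ∂μ, ‖P y‖ ≤ M) {f : ℕ → X → E} {g : X → E}
    (hf : ∀ k, Integrable (f k) μ) (hg : Integrable g μ)
    (h : Tendsto (fun k => ∫⁻ y, ‖f k y - g y‖ₑ ∂μ) atTop (𝓝 0)) :
    Integrable (fun y => P y (g y)) μ ∧ (∀ k, Integrable (fun y => P y (f k y)) μ) ∧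
      Tendsto (fun k => ∫ y, P y (f k y) ∂μ) atTop (𝓝 (∫ y, P y (g y) ∂μ)) := by
  have hint : ∀ u : X → E, Integrable u μ → Integrable (fun y => P y (u y)) μ := by
    intro u hu
    refine (hu.norm.const_mul M).mono' (ContinuousLinearMap.aestronglyMeasurable_comp₂
      (ContinuousLinearMap.id ℝ (E →L[ℝ] F)) hP hu.aestronglyMeasurable) ?_
    filter_upwards [hM] with y hy
    exact ((P y).le_opNorm _).trans (mul_le_mul_of_nonneg_right hy (norm_nonneg _))
  refine ⟨hint g hg, fun k => hint _ (hf k), ?_⟩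
  refine tendsto_integral_of_L1 _ (hint g hg).aestronglyMeasurable
    (Eventually.of_forall fun k => hint _ (hf k)) ?_
  have h1 : Tendsto (fun k => ENNReal.ofReal M * ∫⁻ y, ‖f k y - g y‖ₑ ∂μ) atTop (𝓝 0) := by
    simpa using ENNReal.Tendsto.const_mul h (Or.inr ENNReal.ofReal_ne_top)
  refine tendsto_of_tendsto_of_tendsto_of_le_of_le tendsto_const_nhds h1 (fun _ => bot_le)
    fun k => ?_
  rw [← lintegral_const_mul' _ _ ENNReal.ofReal_ne_top]
  refine lintegral_mono_ae ?_
  filter_upwards [hM] with y hy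
  rw [← map_sub, ← ofReal_norm, ← ofReal_norm,
    ← ENNReal.ofReal_mul ((norm_nonneg _).trans hy)]
  exact ENNReal.ofReal_le_ofReal
    (((P y).le_opNorm _).trans (mul_le_mul_of_nonneg_right hy (norm_nonneg _)))

end L1Limits

/-! ### Distributional solutions: integration by parts and mollification -/

namespace VekuaCauchy

open Mollify

variable {n : ℕ} {Ω : Set (Vec n)} {T : (Vec n → Cl n) → Vec n → Cl n} {w : Vec n → Cl n}

theorem sum_fderiv_smul (φ : Vec n → ℝ) (y : Vec n) (a : Cl n) :
    ∑ i, fderiv ℝ φ y (unitVec i) • (vec (unitVec i) * a) = vec (gradient φ y) * a := by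
  rw [vec_gradient, Finset.sum_mul]
  simp only [smul_mul_assoc]

theorem continuous_vec_gradient {φ : Vec n → ℝ} (hφ : ContDiff ℝ 1 φ) :
    Continuous fun y => vec (gradient φ y) :=
  (vecL n).continuous.comp ((InnerProductSpace.toDual ℝ (Vec n)).symm.continuous.comp
    (hφ.continuous_fderiv (by simp)))

theorem gradient_eq_zero_of_notMem {φ : Vec n → ℝ} {y : Vec n} (hy : y ∉ tsupport φ) :
    gradient φ y = 0 := by
  rw [gradient, (notMem_tsupport_iff_eventuallyEq.mp hy).fderiv_eq]
  simp

/-- Integration by parts for the Moisil-Teodorescu operator. -/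
theorem integral_smul_dirac {φ : Vec n → ℝ} (hφ : ContDiff ℝ 1 φ) (hφc : HasCompactSupport φ)
    {v : Vec n → Cl n} (hv : ContDiff ℝ 1 v) :
    ∫ y, φ y • dirac v y = -∫ y, vec (gradient φ y) * v y := by
  have hv0 := hv.continuous
  have hv1 := hv.continuous_fderiv (by simp)
  have hφ0 := hφ.continuous
  have hφ1 := hφ.continuous_fderiv (by simp)
  have hfc : ∀ i : Fin n, HasCompactSupport fun y => fderiv ℝ φ y (unitVec i) := fun i =>
    (hφc.fderiv ℝ).comp_left (g := fun L : Vec n →L[ℝ] ℝ => L (unitVec i)) rfl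
  have i1 : ∀ i : Fin n, Integrable fun y => fderiv ℝ φ y (unitVec i) • v y := fun i =>
    ((hφ1.clm_apply continuous_const).smul hv0).integrable_of_hasCompactSupport (hfc i).smul_right
  have i2 : ∀ i : Fin n, Integrable fun y => φ y • fderiv ℝ v y (unitVec i) := fun i =>
    (hφ0.smul (hv1.clm_apply continuous_const)).integrable_of_hasCompactSupport hφc.smul_right
  have i3 : Integrable fun y => φ y • v y :=
    (hφ0.smul hv0).integrable_of_hasCompactSupport hφc.smul_right
  have key : ∀ i : Fin n, ∫ y, φ y • fderiv ℝ v y (unitVec i) =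
      -∫ y, fderiv ℝ φ y (unitVec i) • v y := fun i =>
    integral_smul_fderiv_eq_neg_fderiv_smul_of_integrable (i1 i) (i2 i) i3
      (fun y _ => hφ.differentiable (by simp) y) fun y _ => hv.differentiable (by simp) y
  have e1 : ∀ y, φ y • dirac v y =
      ∑ i, mulL n (vec (unitVec i)) (φ y • fderiv ℝ v y (unitVec i)) := by
    intro y
    simp only [dirac, Finset.smul_sum, mulL_apply, mul_smul_comm]
  have e2 : ∀ y, vec (gradient φ y) * v y =
      ∑ i, mulL n (vec (unitVec i)) (fderiv ℝ φ y (unitVec i) • v y) := by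
    intro y
    simp only [← sum_fderiv_smul, mulL_apply, mul_smul_comm]
  simp only [e1, e2]
  rw [integral_finsetSum _ fun i _ => (mulL n (vec (unitVec i))).integrable_comp (i2 i),
    integral_finsetSum _ fun i _ => (mulL n (vec (unitVec i))).integrable_comp (i1 i),
    ← Finset.sum_neg_distrib]
  refine Finset.sum_congr rfl fun i _ => ?_
  rw [ContinuousLinearMap.integral_comp_comm _ (i1 i), ContinuousLinearMap.integral_comp_comm _
    (i2 i), key i, map_neg]

theorem IsSolution.integral_eq (hw : IsSolution T Ω w) {φ : Vec n → ℝ} (hφ : IsTestFunction Ω φ) :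
    -(∫ y in Ω, vec (gradient φ y) * w y) = ∫ y in Ω, φ y • T w y := by
  have h := hw.equation φ hφ
  rw [distPairing, sub_eq_zero] at h
  simpa only [sum_fderiv_smul] using h

/-- The limit of `D v_k` in the mean is the distributional derivative of the limit of the `v_k`. -/
theorem IsSolution.ae_eq_of_tendsto (hw : IsSolution T Ω w) (hopen : IsOpen Ω)
    (hbdd : Bornology.IsBounded Ω) (hwi : IntegrableOn w Ω) (hTi : IntegrableOn (T w) Ω)
    {d : Vec n → Cl n} {v : ℕ → Vec n → Cl n} (hdi : IntegrableOn d Ω)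
    (hv : ∀ k, ContDiff ℝ 1 (v k)) (hvi : ∀ k, IntegrableOn (v k) Ω)
    (hvd : ∀ k, IntegrableOn (dirac (v k)) Ω)
    (h1 : Tendsto (fun k => ∫⁻ y in Ω, ‖v k y - w y‖ₑ) atTop (𝓝 0))
    (h2 : Tendsto (fun k => ∫⁻ y in Ω, ‖dirac (v k) y - d y‖ₑ) atTop (𝓝 0)) :
    ∀ᵐ y ∂(volume.restrict Ω), d y = T w y := by
  have key : ∀ φ : Vec n → ℝ, ContDiff ℝ ∞ φ → HasCompactSupport φ → tsupport φ ⊆ Ω →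
      ∫ y, φ y • (d y - T w y) = 0 := by
    intro φ hφ hφc hφs
    have hφ1 : ContDiff ℝ 1 φ := hφ.of_le (by exact_mod_cast le_top)
    have hz : ∀ y ∉ Ω, φ y = 0 := fun y hy =>
      image_eq_zero_of_notMem_tsupport fun h => hy (hφs h)
    have hgz : ∀ y ∉ Ω, gradient φ y = 0 := fun y hy =>
      gradient_eq_zero_of_notMem fun h => hy (hφs h)
    obtain ⟨M, hM⟩ := hφc.exists_bound_of_continuous hφ1.continuous
    have hgc : HasCompactSupport fun y => mulL n (vec (gradient φ y)) := by
      refine HasCompactSupport.of_support_subset_isCompact hφc.isCompact fun y hy => ?_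
      by_contra h
      refine hy ?_
      change mulL n (vecL n (gradient φ y)) = 0
      rw [gradient_eq_zero_of_notMem h, map_zero, map_zero]
    have hgcont : Continuous fun y => mulL n (vec (gradient φ y)) :=
      (mulL n).continuous.comp (continuous_vec_gradient hφ1)
    obtain ⟨M', hM'⟩ := hgc.exists_bound_of_continuous hgcont
    obtain ⟨-, -, l1⟩ := tendsto_integral_clm_of_L1 (μ := volume.restrict Ω)
      hgcont.aestronglyMeasurable (ae_of_all _ hM') hvi hwi h1
    have hPc : Continuous fun y => φ y • ContinuousLinearMap.id ℝ (Cl n) :=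
      hφ1.continuous.smul continuous_const
    obtain ⟨N, hN⟩ := (hφc.smul_right (f' := fun _ : Vec n =>
      ContinuousLinearMap.id ℝ (Cl n))).exists_bound_of_continuous hPc
    obtain ⟨-, -, l2⟩ := tendsto_integral_clm_of_L1 (μ := volume.restrict Ω)
      hPc.aestronglyMeasurable (ae_of_all _ hN) hvd hdi h2
    have e : ∀ k, ∫ y in Ω, (φ y • ContinuousLinearMap.id ℝ (Cl n)) (dirac (v k) y) =
        -∫ y in Ω, mulL n (vec (gradient φ y)) (v k y) := by
      intro k
      have a1 : ∫ y in Ω, φ y • dirac (v k) y = ∫ y, φ y • dirac (v k) y :=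
        setIntegral_eq_integral_of_forall_compl_eq_zero fun y hy => by rw [hz y hy, zero_smul]
      have a2 : ∫ y in Ω, vec (gradient φ y) * v k y = ∫ y, vec (gradient φ y) * v k y :=
        setIntegral_eq_integral_of_forall_compl_eq_zero fun y hy => by
          rw [hgz y hy, ← vecL_apply, map_zero, zero_mul]
      change ∫ y in Ω, φ y • dirac (v k) y = -∫ y in Ω, vec (gradient φ y) * v k y
      rw [a1, a2, integral_smul_dirac hφ1 hφc (hv k)]
    -- Integration by parts for each `v k` passes to the limit: one side converges by `h2`, the
    -- other by `h1`, and the equation for `w` identifies the limit.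
    have e' : ∫ y in Ω, φ y • d y = ∫ y in Ω, φ y • T w y := by
      rw [← hw.integral_eq ⟨hφ, hφc, hφs⟩]
      exact tendsto_nhds_unique l2 (by simp only [e]; exact l1.neg)
    have hsub : ∫ y in Ω, φ y • (d y - T w y) = 0 := by
      simp only [smul_sub]
      rw [integral_sub (integrableOn_smul_of_continuous hopen hbdd hdi hφ1.continuous)
        (integrableOn_smul_of_continuous hopen hbdd hTi hφ1.continuous), e', sub_self]
    rw [← hsub]
    exact (setIntegral_eq_integral_of_forall_compl_eq_zero fun y hy => by
      rw [hz y hy, zero_smul]).symm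
  have := hopen.ae_eq_zero_of_integral_contDiff_smul_eq_zero
    (hdi.sub hTi).locallyIntegrableOn key
  rw [ae_restrict_iff' hopen.measurableSet]
  filter_upwards [this] with y hy hyΩ using sub_eq_zero.mp (hy hyΩ)

open scoped Convolution in
-- Since `W` is only locally integrable, the derivatives fall on the kernel.
theorem dirac_moll {W : Vec n → Cl n} (hW : LocallyIntegrable W) (k : ℕ) (y : Vec n) :
    dirac (moll k W) y = ∫ z, vec (gradient (kernel k) (y - z)) * W z := by
  have hk1 : ContDiff ℝ 1 (kernel k : Vec n → ℝ) :=
    (contDiff_kernel k).of_le (by exact_mod_cast le_top)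
  have h1 := (hasCompactSupport_kernel k).hasFDerivAt_convolution_left
    (ContinuousLinearMap.lsmul ℝ ℝ) hk1 hW y
  have h2 : fderiv ℝ (moll k W) y = ((fderiv ℝ (kernel k))
    ⋆[(ContinuousLinearMap.lsmul ℝ ℝ).precompL (Vec n), volume] W) y := h1.fderiv
  have hex := ((hasCompactSupport_kernel (G := Vec n) k).fderiv ℝ).convolutionExists_left
    ((ContinuousLinearMap.lsmul ℝ ℝ).precompL (Vec n)) (hk1.continuous_fderiv (by simp)) hW y
  have hex' := hex.integrable_swap
  rw [convolution_eq_swap] at h2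
  have h3 : ∀ i : Fin n, fderiv ℝ (moll k W) y (unitVec i) =
      ∫ z, fderiv ℝ (kernel k) (y - z) (unitVec i) • W z := by
    intro i
    rw [h2, ContinuousLinearMap.integral_apply hex']
    rfl
  have h4 : ∀ i : Fin n, Integrable fun z => fderiv ℝ (kernel k) (y - z) (unitVec i) • W z :=
    fun i => hex'.apply_continuousLinearMap (unitVec i)
  simp only [dirac, h3]
  have h5 : ∀ z, vec (gradient (kernel k) (y - z)) * W z =
      ∑ i, mulL n (vec (unitVec i)) (fderiv ℝ (kernel k) (y - z) (unitVec i) • W z) := by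
    intro z
    simp only [← sum_fderiv_smul, mulL_apply, mul_smul_comm]
  simp only [h5]
  rw [integral_finsetSum _ fun i _ => (mulL n (vec (unitVec i))).integrable_comp (h4 i)]
  refine Finset.sum_congr rfl fun i _ => ?_
  rw [ContinuousLinearMap.integral_comp_comm _ (h4 i), mulL_apply]

/-- Mollification commutes with the Vekua operator. -/
theorem IsSolution.dirac_moll_indicator (hw : IsSolution T Ω w) {C : Set (Vec n)}
    (hC : MeasurableSet C) (hCΩ : C ⊆ Ω) (hwC : IntegrableOn w C)
    {k : ℕ} {y : Vec n} (hy : Metric.closedBall y (bump (Vec n) k).rOut ⊆ C) :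
    dirac (moll k (C.indicator w)) y = moll k (C.indicator (T w)) y := by
  have hW : LocallyIntegrable (C.indicator w) :=
    ((integrable_indicator_iff hC).mpr hwC).locallyIntegrable
  rw [dirac_moll hW, moll_eq_swap]
  -- The reflected kernel is itself a test function supported in the ball about `y`, hence in `C`,
  -- where the indicator is invisible. The minus sign in its gradient matches the sign of the weak
  -- equation.
  set ψ : Vec n → ℝ := fun z => kernel k (y - z) with hψ
  have hψs : tsupport ψ ⊆ Metric.closedBall y (bump (Vec n) k).rOut := by
    refine closure_minimal (fun z hz => ?_) Metric.isClosed_closedBall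
    by_contra h
    rw [Metric.mem_closedBall, dist_eq_norm, norm_sub_rev, not_le] at h
    exact hz (kernel_eq_zero h)
  have htest : IsTestFunction Ω ψ :=
    ⟨(contDiff_kernel k).comp (contDiff_const.sub contDiff_id),
      (isCompact_closedBall _ _).of_isClosed_subset (isClosed_tsupport ψ) hψs,
      hψs.trans (hy.trans hCΩ)⟩
  have hgrad : ∀ z, gradient ψ z = -gradient (kernel k) (y - z) := by
    intro z
    have h1 : HasFDerivAt (fun z : Vec n => y - z) (-ContinuousLinearMap.id ℝ (Vec n)) z :=
      (hasFDerivAt_id z).const_sub y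
    have h2 : HasFDerivAt ψ ((fderiv ℝ (kernel k) (y - z)).comp
        (-ContinuousLinearMap.id ℝ (Vec n))) z :=
      ((contDiff_kernel k).differentiable (by simp) _).hasFDerivAt.comp z h1
    rw [gradient, gradient, h2.fderiv, ← map_neg]
    congr 1
    ext v
    simp
  have hz : ∀ z ∉ C, ψ z = 0 := fun z hz =>
    image_eq_zero_of_notMem_tsupport fun h => hz (hy (hψs h))
  have hgz : ∀ z ∉ C, gradient ψ z = 0 := fun z hz =>
    gradient_eq_zero_of_notMem fun h => hz (hy (hψs h))
  have heq := hw.integral_eq htest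
  have a1 : ∫ z in Ω, vec (gradient ψ z) * w z =
      -∫ z, vec (gradient (kernel k) (y - z)) * C.indicator w z := by
    rw [setIntegral_eq_integral_of_forall_compl_eq_zero, ← integral_neg]
    · refine integral_congr_ae (ae_of_all _ fun z => ?_)
      simp only
      by_cases hzC : z ∈ C
      · rw [indicator_of_mem hzC, hgrad, ← vecL_apply, map_neg, neg_mul, vecL_apply]
      · rw [indicator_of_notMem hzC, hgz z hzC, ← vecL_apply, map_zero, zero_mul, mul_zero,
          neg_zero]
    · intro z hzΩ
      rw [hgz z fun h => hzΩ (hCΩ h), ← vecL_apply, map_zero, zero_mul]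
  have a2 : ∫ z in Ω, ψ z • T w z = ∫ z, kernel k (y - z) • C.indicator (T w) z := by
    rw [setIntegral_eq_integral_of_forall_compl_eq_zero]
    · refine integral_congr_ae (ae_of_all _ fun z => ?_)
      simp only
      by_cases hzC : z ∈ C
      · rw [indicator_of_mem hzC]
      · rw [indicator_of_notMem hzC, hz z hzC, zero_smul, smul_zero]
    · intro z hzΩ
      rw [hz z fun h => hzΩ (hCΩ h), zero_smul]
  rw [a1, a2, neg_neg] at heq
  exact heq

end VekuaCauchy
end

noncomputable section

namespace VekuaCauchy

/-! ### Bounded zero-order terms -/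

variable {n : ℕ} {Ω : Set (Vec n)} {T T' : (Vec n → Cl n) → Vec n → Cl n}

/-- `T` is a pointwise bounded operator on functions on `Ω` which preserves measurability. -/
structure IsBoundedTerm (T : (Vec n → Cl n) → Vec n → Cl n) (Ω : Set (Vec n)) : Prop where
  bound : ∃ M : ℝ, 0 ≤ M ∧ ∀ f, ∀ᵐ y ∂(volume.restrict Ω), ‖T f y‖ ≤ M * ‖f y‖
  aestronglyMeasurable : ∀ f, AEStronglyMeasurable f (volume.restrict Ω) →
    AEStronglyMeasurable (T f) (volume.restrict Ω)

theorem IsBoundedTerm.integrableOn (hT : IsBoundedTerm T Ω) {f : Vec n → Cl n} {S : Set (Vec n)}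
    (hSΩ : S ⊆ Ω) (hfm : AEStronglyMeasurable f (volume.restrict Ω)) (hf : IntegrableOn f S) :
    IntegrableOn (T f) S := by
  obtain ⟨M, -, hM⟩ := hT.bound
  exact (hf.norm.const_mul M).mono' ((hT.aestronglyMeasurable f hfm).mono_set hSΩ)
    (ae_restrict_of_ae_restrict_of_subset hSΩ (hM f))

theorem ae_norm_le_of_memLp_top {α : Vec n → Cl n} (hα : MemLp α ⊤ (volume.restrict Ω)) :
    ∃ A : ℝ, 0 ≤ A ∧ ∀ᵐ y ∂(volume.restrict Ω), ‖α y‖ ≤ A :=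
  ⟨_, lpNorm_nonneg, ae_le_lpNorm_exponent_top hα⟩

theorem norm_mul_star_le (a b : Cl n) : ‖a * star b‖ ≤ ‖mulL n‖ * ‖a‖ * (‖starL n‖ * ‖b‖) :=
  (norm_mul_le' _ _).trans (mul_le_mul_of_nonneg_left (norm_star_le b) (by positivity))

theorem norm_star_mul_le (a b : Cl n) : ‖star a * b‖ ≤ ‖mulL n‖ * (‖starL n‖ * ‖a‖) * ‖b‖ :=
  (norm_mul_le' _ _).trans (mul_le_mul_of_nonneg_right
    (mul_le_mul_of_nonneg_left (norm_star_le a) (by positivity)) (norm_nonneg _))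

theorem isBoundedTerm_vekuaTerm {α : Vec n → Cl n} (hα : MemLp α ⊤ (volume.restrict Ω)) :
    IsBoundedTerm (vekuaTerm α) Ω := by
  obtain ⟨A, hA0, hA⟩ := ae_norm_le_of_memLp_top hα
  refine ⟨⟨‖mulL n‖ * A * ‖starL n‖, by positivity, fun f => ?_⟩, fun f hf => ?_⟩
  · filter_upwards [hA] with y hy
    refine (norm_mul_star_le (α y) (f y)).trans ?_
    rw [mul_assoc _ ‖starL n‖]
    gcongr
  · exact (mulL n).aestronglyMeasurable_comp₂ hα.aestronglyMeasurable
      ((starL n).continuous.comp_aestronglyMeasurable hf)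

theorem isBoundedTerm_vekuaAdjTerm {α : Vec n → Cl n} (hα : MemLp α ⊤ (volume.restrict Ω)) :
    IsBoundedTerm (vekuaAdjTerm α) Ω := by
  obtain ⟨A, hA0, hA⟩ := ae_norm_le_of_memLp_top hα
  refine ⟨⟨‖mulL n‖ * A * ‖starL n‖, by positivity, fun f => ?_⟩, fun f hf => ?_⟩
  · filter_upwards [hA] with y hy
    refine (norm_star_mul_le (f y) (α y)).trans ?_
    have : ‖mulL n‖ * (‖starL n‖ * ‖f y‖) * ‖α y‖ ≤ ‖mulL n‖ * (‖starL n‖ * ‖f y‖) * A := by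
      gcongr
    linarith
  · exact (mulL n).aestronglyMeasurable_comp₂
      ((starL n).continuous.comp_aestronglyMeasurable hf) hα.aestronglyMeasurable

/-! ### The Cauchy formula away from the pole and near the pole -/

/-- It makes a kernel multiplied by a cutoff continuous across the pole, where the kernel itself is
uncontrolled. -/
theorem continuousOn_of_eventuallyEq_zero {X E : Type*} [TopologicalSpace X] [T1Space X]
    [TopologicalSpace E] [Zero E] {f : X → E} {S : Set X} {x : X}
    (hf : ContinuousOn f (S \ {x})) (h0 : x ∈ S → f =ᶠ[𝓝 x] 0) : ContinuousOn f S := by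
  intro y hy
  by_cases hyx : y = x
  · subst hyx
    exact ((continuousAt_const (y := (0 : E))).congr (h0 hy).symm).continuousWithinAt
  · have h1 : {x}ᶜ ∈ 𝓝 y := isOpen_compl_singleton.mem_nhds hyx
    have h2 := hf y ⟨hy, hyx⟩
    rwa [sdiff_eq, continuousWithinAt_inter h1] at h2

/-- A kernel which is locally integrable in `Ω` and continuous up to the boundary off the pole is
integrable. -/
theorem integrableOn_of_continuousOn_diff (hopen : IsOpen Ω) (hbdd : Bornology.IsBounded Ω)
    {K : Vec n → Cl n} {x : Vec n} (hx : x ∉ frontier Ω)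
    (hK : ContinuousOn K (closure Ω \ {x})) (hKl : LocallyIntegrableOn K Ω) :
    IntegrableOn K Ω := by
  by_cases hxΩ : x ∈ Ω
  · obtain ⟨r, hr, hrΩ⟩ := Metric.nhds_basis_closedBall.mem_iff.mp (hopen.mem_nhds hxΩ)
    have h1 : IntegrableOn K (Metric.closedBall x r) :=
      hKl.integrableOn_compact_subset hrΩ (isCompact_closedBall x r)
    have h2 : IntegrableOn K (closure Ω \ Metric.ball x r) :=
      (hK.mono (sdiff_subset_sdiff_right (singleton_subset_iff.mpr
        (Metric.mem_ball_self hr)))).integrableOn_compact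
          (hbdd.isCompact_closure.diff Metric.isOpen_ball)
    refine (h1.union h2).mono_set fun y hy => ?_
    by_cases h : y ∈ Metric.ball x r
    · exact Or.inl (Metric.ball_subset_closedBall h)
    · exact Or.inr ⟨subset_closure hy, h⟩
  · have hxc : x ∉ closure Ω := fun h => hx ⟨h, by rwa [hopen.interior_eq]⟩
    rw [sdiff_singleton_eq_self hxc] at hK
    exact (hK.integrableOn_compact hbdd.isCompact_closure).mono_set subset_closure

/-- The Cauchy formula with a cutoff which vanishes near the pole. -/
theorem boundaryIntegral_eq_of_cutoff (hopen : IsOpen Ω) (hbdd : Bornology.IsBounded Ω)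
    (hlip : HasLipschitzBoundary Ω) {K g w d : Vec n → Cl n} {x : Vec n} {M : ℝ}
    (hK : ContinuousOn K (closure Ω \ {x})) (hKi : IntegrableOn K Ω) (hgi : IntegrableOn g Ω)
    (hgK : ∀ᵐ y ∂(volume.restrict Ω), ‖g y‖ ≤ M * ‖K y‖)
    (hd : HasDistribDiv Ω (fun y => rightField n (K y)) g x (-1)) (hx : x ∉ frontier Ω)
    {v : ℕ → Vec n → Cl n} (hv : ∀ k, ContDiff ℝ 1 (v k)) (hwi : IntegrableOn w Ω)
    (hdi : IntegrableOn d Ω) (hwb : Integrable w (surfaceMeasure Ω))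
    (h1 : Tendsto (fun k => ∫⁻ y in Ω, ‖v k y - w y‖ₑ) atTop (𝓝 0))
    (h2 : Tendsto (fun k => ∫⁻ y in Ω, ‖dirac (v k) y - d y‖ₑ) atTop (𝓝 0))
    (h3 : Tendsto (fun k => ∫⁻ y, ‖v k y - w y‖ₑ ∂(surfaceMeasure Ω)) atTop (𝓝 0))
    {u : Vec n → ℝ} (hu : ContDiff ℝ 1 u) (hux : x ∈ closure Ω → u =ᶠ[𝓝 x] 0)
    (hu1 : ∀ y ∈ frontier Ω, u y = 1) :
    Integrable (boundaryIntegrand Ω K w) (surfaceMeasure Ω) ∧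
      IntegrableOn (fun y => (K y * vec (gradient u y) + u y • g y) * w y) Ω ∧
      IntegrableOn (fun y => (u y • K y) * d y) Ω ∧
      boundaryIntegral Ω K w =
        (∫ y in Ω, (K y * vec (gradient u y) + u y • g y) * w y) +
          ∫ y in Ω, (u y • K y) * d y := by
  have := isFiniteMeasure_surfaceMeasure hopen hbdd hlip
  have hcomp := hbdd.isCompact_closure
  have hfcomp : IsCompact (frontier Ω) :=
    hcomp.of_isClosed_subset isClosed_frontier frontier_subset_closure
  have hfK : ContinuousOn K (frontier Ω) :=
    hK.mono fun z hz => ⟨frontier_subset_closure hz, fun h => hx (h ▸ hz)⟩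
  have hvi : ∀ k, IntegrableOn (v k) Ω := fun k =>
    ((hv k).continuous.continuousOn.integrableOn_compact hcomp).mono_set subset_closure
  have hvd : ∀ k, IntegrableOn (dirac (v k)) Ω := fun k =>
    ((continuous_dirac (hv k)).continuousOn.integrableOn_compact hcomp).mono_set subset_closure
  have hvb : ∀ k, Integrable (v k) (surfaceMeasure Ω) := fun k => by
    obtain ⟨N, hN⟩ := hfcomp.exists_bound_of_continuousOn (hv k).continuous.continuousOn
    exact Integrable.of_bound (C := N) (hv k).continuous.aestronglyMeasurable
      ((surfaceMeasure_ae_mem_frontier Ω).mono hN)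
  -- the boundary multiplier
  obtain ⟨B0, hB0⟩ := hfcomp.exists_bound_of_continuousOn
    ((rightField n).continuous.comp_continuousOn hfK)
  have hP0 : AEStronglyMeasurable (fun y => mulL n (K y * vec (outwardNormal Ω y)))
      (surfaceMeasure Ω) :=
    (mulL n).continuous.comp_aestronglyMeasurable ((mulL n).aestronglyMeasurable_comp₂
      (ContinuousOn.aestronglyMeasurable_surfaceMeasure hfK)
      ((vecL n).continuous.comp_aestronglyMeasurable
        (aestronglyMeasurable_outwardNormal hopen hbdd hlip)))
  have hN0 : ∀ᵐ y ∂(surfaceMeasure Ω), ‖mulL n (K y * vec (outwardNormal Ω y))‖ ≤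
      ‖mulL n‖ * B0 := by
    filter_upwards [surfaceMeasure_ae_mem_frontier Ω] with y hy
    refine ((mulL n).le_opNorm _).trans (mul_le_mul_of_nonneg_left ?_ (norm_nonneg _))
    exact ((rightField n (K y)).le_opNorm _).trans
      ((mul_le_of_le_one_right (norm_nonneg _) (norm_outwardNormal_le y)).trans (hB0 y hy))
  obtain ⟨i0, -, l0⟩ := tendsto_integral_clm_of_L1 hP0 hN0 hvb hwb h3
  -- the multipliers in the domain
  have huK : ContinuousOn (fun y => u y • K y) (closure Ω) :=
    continuousOn_of_eventuallyEq_zero (hu.continuous.continuousOn.smul hK) fun h => by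
      filter_upwards [hux h] with y hy
      simp [hy]
  have hgradK : ContinuousOn (fun y => K y * vec (gradient u y)) (closure Ω) := by
    refine continuousOn_of_eventuallyEq_zero (((mulL n).continuous₂.comp_continuousOn
      (hK.prodMk (continuous_vec_gradient hu).continuousOn))) fun h => ?_
    have h4 : (fun y => gradient u y) =ᶠ[𝓝 x] 0 := by
      filter_upwards [(hux h).eventuallyEq_nhds] with y hy
      rw [gradient, hy.fderiv_eq]
      simp
    filter_upwards [h4] with y hy
    simp only [hy]
    change mulL n (K y) (vecL n 0) = 0
    rw [map_zero, map_zero]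
  obtain ⟨B1, hB1⟩ := hcomp.exists_bound_of_continuousOn hgradK
  obtain ⟨B2, hB2⟩ := hcomp.exists_bound_of_continuousOn huK
  have hΩ := hopen.measurableSet
  have hm2 : AEStronglyMeasurable (fun y => u y • K y) (volume.restrict Ω) :=
    (huK.mono subset_closure).aestronglyMeasurable hΩ
  have hm1 : AEStronglyMeasurable (fun y => K y * vec (gradient u y) + u y • g y)
      (volume.restrict Ω) :=
    ((hgradK.mono subset_closure).aestronglyMeasurable hΩ).add
      (hu.continuous.aestronglyMeasurable.smul hgi.aestronglyMeasurable)
  have hb1 : ∀ᵐ y ∂(volume.restrict Ω),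
      ‖mulL n (K y * vec (gradient u y) + u y • g y)‖ ≤ ‖mulL n‖ * (B1 + |M| * B2) := by
    filter_upwards [hgK, ae_restrict_mem hΩ] with y hy hyΩ
    refine ((mulL n).le_opNorm _).trans (mul_le_mul_of_nonneg_left ?_ (norm_nonneg _))
    refine (norm_add_le _ _).trans (add_le_add (hB1 y (subset_closure hyΩ)) ?_)
    have h5 := hB2 y (subset_closure hyΩ)
    rw [norm_smul] at h5 ⊢
    calc ‖u y‖ * ‖g y‖ ≤ ‖u y‖ * (|M| * ‖K y‖) :=
          mul_le_mul_of_nonneg_left (hy.trans (mul_le_mul_of_nonneg_right (le_abs_self M)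
            (norm_nonneg _))) (norm_nonneg _)
      _ = |M| * (‖u y‖ * ‖K y‖) := by ring
      _ ≤ |M| * B2 := mul_le_mul_of_nonneg_left h5 (abs_nonneg M)
  have hb2 : ∀ᵐ y ∂(volume.restrict Ω), ‖mulL n (u y • K y)‖ ≤ ‖mulL n‖ * B2 := by
    filter_upwards [ae_restrict_mem hΩ] with y hyΩ
    exact ((mulL n).le_opNorm _).trans
      (mul_le_mul_of_nonneg_left (hB2 y (subset_closure hyΩ)) (norm_nonneg _))
  obtain ⟨i1, j1, l1⟩ := tendsto_integral_clm_of_L1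
    ((mulL n).continuous.comp_aestronglyMeasurable hm1) hb1 hvi hwi h1
  obtain ⟨i2, j2, l2⟩ := tendsto_integral_clm_of_L1
    ((mulL n).continuous.comp_aestronglyMeasurable hm2) hb2 hvd hdi h2
  refine ⟨i0, i1, i2, tendsto_nhds_unique l0 ((l1.add l2).congr fun k => ?_)⟩
  -- For each `k` the claim is the Cauchy-Pompeiu formula for `u (v k)`, which agrees with `v k` on
  -- the boundary and has no contribution at the pole.
  have huv : ContDiff ℝ 1 fun y => u y • v k y := hu.smul (hv k)
  have hcp := cauchy_pompeiu hopen hbdd hlip hK hKi hgi hd hx huv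
  have hind : Ω.indicator (fun y => u y • v k y) x = 0 := by
    by_cases hxΩ : x ∈ Ω
    · rw [indicator_of_mem hxΩ, (hux (subset_closure hxΩ)).self_of_nhds]
      simp
    · exact indicator_of_notMem hxΩ _
  rw [hind, add_zero] at hcp
  have hb : boundaryIntegral Ω K (fun y => u y • v k y) =
      ∫ y, mulL n (K y * vec (outwardNormal Ω y)) (v k y) ∂(surfaceMeasure Ω) := by
    refine integral_congr_ae ?_
    filter_upwards [surfaceMeasure_ae_mem_frontier Ω] with y hy
    rw [boundaryIntegrand, hu1 y hy, one_smul, mulL_apply]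
  rw [← hb, hcp]
  refine (integral_add (j1 k) (j2 k)).symm.trans (integral_congr_ae (ae_of_all _ fun y => ?_))
  simp only [mulL_apply]
  rw [dirac_smul (hu.differentiable (by simp) y) ((hv k).differentiable (by simp) y)]
  simp only [mul_add, add_mul, smul_mul_assoc, mul_smul_comm, mul_assoc]
  abel

/-- The Cauchy formula with a cutoff supported in the domain. -/
theorem IsSolution.integral_cutoff (hopen : IsOpen Ω) (hbdd : Bornology.IsBounded Ω)
    (hlip : HasLipschitzBoundary Ω) (hT : IsBoundedTerm T Ω) {K g w : Vec n → Cl n} {x : Vec n}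
    (hw : IsSolution T Ω w)
    (hK : ContinuousOn K (closure Ω \ {x})) (hKi : IntegrableOn K Ω) (hgi : IntegrableOn g Ω)
    (hd : HasDistribDiv Ω (fun y => rightField n (K y)) g x (-1)) (hx : x ∉ frontier Ω)
    {χ : Vec n → ℝ} (hχ : ContDiff ℝ 1 χ) (hχc : HasCompactSupport χ) (hχΩ : tsupport χ ⊆ Ω) :
    IntegrableOn (fun y => (K y * vec (gradient χ y) + χ y • g y) * w y) Ω ∧
      IntegrableOn (fun y => (χ y • K y) * T w y) Ω ∧
      (∫ y in Ω, (K y * vec (gradient χ y) + χ y • g y) * w y) +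
        (∫ y in Ω, (χ y • K y) * T w y) + χ x • w x = 0 := by
  have hΩ := hopen.measurableSet
  -- On a compact neighbourhood `C` of the support of `χ` inside `Ω`, `w` and `T w` are bounded (the
  -- latter almost everywhere), so truncating to `C` permits mollification without changing anything
  -- near the support.
  obtain ⟨δ, hδ, hδΩ⟩ := hχc.isCompact.exists_cthickening_subset_open hopen hχΩ
  set C := Metric.cthickening δ (tsupport χ) with hC
  have hCc : IsCompact C := hχc.isCompact.cthickening
  have hCm : MeasurableSet C := hCc.measurableSet
  have hCn : ∀ y ∈ tsupport χ, C ∈ 𝓝 y := fun y hy =>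
    mem_of_superset (Metric.closedBall_mem_nhds y hδ) (Metric.closedBall_subset_cthickening hy δ)
  have hwm : AEStronglyMeasurable w (volume.restrict Ω) := hw.continuousOn.aestronglyMeasurable hΩ
  have hwC : IntegrableOn w C := (hw.continuousOn.mono hδΩ).integrableOn_compact hCc
  have hTC : IntegrableOn (T w) C := hT.integrableOn hδΩ hwm hwC
  obtain ⟨B, hB⟩ := hCc.exists_bound_of_continuousOn (hw.continuousOn.mono hδΩ)
  obtain ⟨M, hM0, hM⟩ := hT.bound
  set W := C.indicator w with hW
  set H := C.indicator (T w) with hH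
  have hWl : LocallyIntegrable W := ((integrable_indicator_iff hCm).mpr hwC).locallyIntegrable
  have hHl : LocallyIntegrable H := ((integrable_indicator_iff hCm).mpr hTC).locallyIntegrable
  have hWb : ∀ y, ‖W y‖ ≤ |B| := fun y => by
    by_cases hy : y ∈ C
    · rw [hW, indicator_of_mem hy]
      exact (hB y hy).trans (le_abs_self B)
    · rw [hW, indicator_of_notMem hy, norm_zero]
      exact abs_nonneg B
  have hHb : ∀ᵐ y, ‖H y‖ ≤ M * |B| := by
    have hMw := hM w
    rw [ae_restrict_iff' hΩ] at hMw
    filter_upwards [hMw] with y hy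
    by_cases hyC : y ∈ C
    · rw [hH, indicator_of_mem hyC]
      exact (hy (hδΩ hyC)).trans
        (mul_le_mul_of_nonneg_left ((hB y hyC).trans (le_abs_self B)) hM0)
    · rw [hH, indicator_of_notMem hyC, norm_zero]
      positivity
  have hmW : ∀ k y, ‖Mollify.moll k W y‖ ≤ |B| := fun k y =>
    Mollify.norm_moll_le (ae_of_all _ fun z _ => hWb z)
  have hmH : ∀ k y, ‖Mollify.moll k H y‖ ≤ M * |B| := fun k y =>
    Mollify.norm_moll_le (hHb.mono fun z hz _ => hz)
  have hlW : ∀ y ∈ tsupport χ, Tendsto (fun k => Mollify.moll k W y) atTop (𝓝 (w y)) := by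
    intro y hy
    have hWw : W =ᶠ[𝓝 y] w := by
      filter_upwards [hCn y hy] with z hz
      exact indicator_of_mem hz w
    rw [← hWw.self_of_nhds]
    refine Mollify.tendsto_moll (ContinuousAt.congr ?_ hWw.symm) hWl.aestronglyMeasurable
    exact hw.continuousOn.continuousAt (hopen.mem_nhds (hχΩ hy))
  have hlH : ∀ᵐ y, y ∈ tsupport χ → Tendsto (fun k => Mollify.moll k H y) atTop (𝓝 (T w y)) := by
    filter_upwards [Mollify.ae_tendsto_moll hHl] with y hy hyχ
    rwa [hH, indicator_of_mem (mem_of_mem_nhds (hCn y hyχ))] at hy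
  have hmc : ∀ k, ContDiff ℝ 1 (Mollify.moll k W) := fun k =>
    (Mollify.contDiff_moll k hWl).of_le (by exact_mod_cast le_top)
  have hχ0 : ∀ y ∉ tsupport χ, χ y = 0 := fun y hy => image_eq_zero_of_notMem_tsupport hy
  have hχg : ∀ y ∉ tsupport χ, K y * vec (gradient χ y) = 0 := fun y hy => by
    rw [gradient_eq_zero_of_notMem hy, ← vecL_apply, map_zero, mul_zero]
  -- the multipliers
  set P1 : Vec n → Cl n := fun y => K y * vec (gradient χ y) + χ y • g y with hP1
  set P2 : Vec n → Cl n := fun y => χ y • K y with hP2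
  have hP1i : IntegrableOn P1 Ω := integrableOn_gradient_add hopen hbdd
    ((rightField n).integrable_comp hKi) hgi hχ
  have hP2i : IntegrableOn P2 Ω := integrableOn_smul_of_continuous hopen hbdd hKi hχ.continuous
  have hP1z : ∀ y ∉ tsupport χ, P1 y = 0 := fun y hy => by
    simp only [hP1]
    rw [hχg y hy, hχ0 y hy, zero_smul, add_zero]
  have hP2z : ∀ y ∉ tsupport χ, P2 y = 0 := fun y hy => by
    simp only [hP2]
    rw [hχ0 y hy, zero_smul]
  -- Dominated convergence against an integrable multiplier `P`: a uniform bound on the `f k` and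
  -- almost everywhere convergence on the support of `χ` are enough, so `K` may be unbounded at the
  -- pole.
  have lim : ∀ {P F : Vec n → Cl n} {f : ℕ → Vec n → Cl n} {N : ℝ}, IntegrableOn P Ω →
      (∀ k, AEStronglyMeasurable (f k) (volume.restrict Ω)) → (∀ k y, ‖f k y‖ ≤ N) →
      (∀ y ∉ tsupport χ, P y = 0) →
      (∀ᵐ y ∂(volume.restrict Ω), y ∈ tsupport χ → Tendsto (fun k => f k y) atTop (𝓝 (F y))) →
      AEStronglyMeasurable F (volume.restrict Ω) →
      IntegrableOn (fun y => P y * F y) Ω ∧ (∀ k, IntegrableOn (fun y => P y * f k y) Ω) ∧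
      Tendsto (fun k => ∫ y in Ω, P y * f k y) atTop (𝓝 (∫ y in Ω, P y * F y)) := by
    intro P F f N hP hfm hfN hPz hlim hFm
    have hbd : ∀ k y, ‖P y * f k y‖ ≤ ‖mulL n‖ * ‖P y‖ * N := fun k y =>
      (norm_mul_le' _ _).trans (mul_le_mul_of_nonneg_left (hfN k y) (by positivity))
    have hli : ∀ᵐ y ∂(volume.restrict Ω),
        Tendsto (fun k => P y * f k y) atTop (𝓝 (P y * F y)) := by
      filter_upwards [hlim] with y hy
      by_cases h : y ∈ tsupport χ
      · exact ((mulL n (P y)).continuous.tendsto _).comp (hy h)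
      · simp only [hPz y h, zero_mul]
        exact tendsto_const_nhds
    have hbi : Integrable (fun y => ‖mulL n‖ * ‖P y‖ * N) (volume.restrict Ω) :=
      (hP.norm.const_mul _).mul_const _
    have hmeas : ∀ k, AEStronglyMeasurable (fun y => P y * f k y) (volume.restrict Ω) := fun k =>
      (mulL n).aestronglyMeasurable_comp₂ hP.aestronglyMeasurable (hfm k)
    refine ⟨hbi.mono' ((mulL n).aestronglyMeasurable_comp₂ hP.aestronglyMeasurable hFm) ?_,
      fun k => hbi.mono' (hmeas k) (ae_of_all _ (hbd k)),
      tendsto_integral_of_dominated_convergence _ hmeas hbi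
        (fun k => ae_of_all _ (hbd k)) hli⟩
    filter_upwards [hli] with y hy
    exact le_of_tendsto' hy.norm fun k => hbd k y
  obtain ⟨i1, j1, l1⟩ := lim hP1i (fun k => (hmc k).continuous.aestronglyMeasurable) hmW hP1z
    (ae_of_all _ hlW) hwm
  obtain ⟨i2, j2, l2⟩ := lim hP2i
    (fun k => (Mollify.contDiff_moll k hHl).continuous.aestronglyMeasurable) hmH hP2z
    (ae_restrict_of_ae hlH) (hT.aestronglyMeasurable w hwm)
  have l3 : Tendsto (fun k => χ x • Mollify.moll k W x) atTop (𝓝 (χ x • w x)) := by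
    by_cases hxχ : x ∈ tsupport χ
    · exact (hlW x hxχ).const_smul _
    · simp only [hχ0 x hxχ, zero_smul]
      exact tendsto_const_nhds
  refine ⟨i1, i2, tendsto_nhds_unique ((l1.add l2).add l3) (tendsto_const_nhds.congr' ?_)⟩
  -- Once the mollification radius is below `δ`, balls about points of the support lie in `C`, so
  -- there `D` of the mollified `w` is the mollified `T w`.
  filter_upwards [(Mollify.tendsto_bump_rOut (G := Vec n)).eventually_lt_const hδ] with k hk
  have hχm : ContDiff ℝ 1 fun y => χ y • Mollify.moll k W y := hχ.smul (hmc k)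
  have hcp := cauchy_pompeiu hopen hbdd hlip hK hKi hgi hd hx hχm
  have hb : boundaryIntegral Ω K (fun y => χ y • Mollify.moll k W y) = 0 := by
    refine integral_eq_zero_of_ae ?_
    filter_upwards [surfaceMeasure_ae_mem_frontier Ω] with y hy
    have hyΩ : y ∉ Ω := fun h => hy.2 (by rwa [hopen.interior_eq])
    rw [boundaryIntegrand, hχ0 y fun h => hyΩ (hχΩ h), zero_smul, mul_zero]
    rfl
  have hind : Ω.indicator (fun y => χ y • Mollify.moll k W y) x = χ x • Mollify.moll k W x := by
    by_cases hxΩ : x ∈ Ω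
    · exact indicator_of_mem hxΩ _
    · rw [indicator_of_notMem hxΩ, hχ0 x fun h => hxΩ (hχΩ h), zero_smul]
  rw [← hb, ← hind]
  refine hcp.trans (congrArg (· + _) ?_)
  refine Eq.trans (integral_congr_ae (ae_of_all _ fun y => ?_)) (integral_add (j1 k) (j2 k))
  simp only [hP1, hP2]
  rw [dirac_smul (hχ.differentiable (by simp) y) ((hmc k).differentiable (by simp) y)]
  have hfin : χ y • dirac (Mollify.moll k W) y = χ y • Mollify.moll k H y := by
    by_cases hy : y ∈ tsupport χ
    · rw [hw.dirac_moll_indicator hCm hδΩ hwC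
        ((Metric.closedBall_subset_closedBall hk.le).trans
          (Metric.closedBall_subset_cthickening hy δ))]
    · rw [hχ0 y hy, zero_smul, zero_smul]
  rw [hfin]
  simp only [mul_add, add_mul, smul_mul_assoc, mul_smul_comm, mul_assoc]
  abel

end VekuaCauchy
end

/-! ### The Borel-Pompeiu formula and its scalar part -/

noncomputable section

namespace VekuaCauchy

variable {n : ℕ} {Ω : Set (Vec n)} {T T' : (Vec n → Cl n) → Vec n → Cl n}

theorem exists_cutoff (hopen : IsOpen Ω) {x : Vec n} (hx : x ∉ frontier Ω) :
    ∃ χ : Vec n → ℝ, ContDiff ℝ 1 χ ∧ HasCompactSupport χ ∧ tsupport χ ⊆ Ω ∧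
      (x ∈ closure Ω → χ =ᶠ[𝓝 x] 1) := by
  by_cases hxΩ : x ∈ Ω
  · obtain ⟨r, hr, hrΩ⟩ := Metric.nhds_basis_closedBall.mem_iff.mp (hopen.mem_nhds hxΩ)
    let b : ContDiffBump x := ⟨r / 2, r, half_pos hr, half_lt_self hr⟩
    exact ⟨b, b.contDiff, b.hasCompactSupport, b.tsupport_eq.trans_subset hrΩ,
      fun _ => b.eventuallyEq_one⟩
  · refine ⟨fun _ => 0, contDiff_const, HasCompactSupport.zero, ?_, fun h => ?_⟩
    · simp [tsupport]
    · exact absurd ⟨h, by rwa [hopen.interior_eq]⟩ hx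

/-- The Borel-Pompeiu formula for a solution and a fundamental solution of the adjoint equation. -/
theorem IsSolution.boundaryIntegral_eq (hopen : IsOpen Ω) (hbdd : Bornology.IsBounded Ω)
    (hlip : HasLipschitzBoundary Ω) (hT : IsBoundedTerm T Ω) (hT' : IsBoundedTerm T' Ω)
    {w K : Vec n → Cl n} {x : Vec n} (hw : IsSolution T Ω w) (hbv : HasBoundaryValues Ω w)
    (hx : x ∉ frontier Ω) (hK : ContinuousOn K (closure Ω \ {x}))
    (hG : IsFundamentalSolution T' Ω x fun y => -star (K y)) :
    Integrable (boundaryIntegrand Ω K w) (surfaceMeasure Ω) ∧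
      IntegrableOn (fun y => K y * T w y + star (T' (fun y => -star (K y)) y) * w y) Ω ∧
      boundaryIntegral Ω K w =
        (∫ y in Ω, (K y * T w y + star (T' (fun y => -star (K y)) y) * w y)) +
          Ω.indicator w x := by
  have hΩ := hopen.measurableSet
  have hcomp := hbdd.isCompact_closure
  have := isFiniteMeasure_surfaceMeasure hopen hbdd hlip
  have hGK : ∀ y, K y = -star (-star (K y)) := fun y => by rw [star_neg, star_star, neg_neg]
  have hKl : LocallyIntegrableOn K Ω := fun y hy =>
    let ⟨t, ht, hi⟩ := hG.locallyIntegrable y hy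
    ⟨t, ht, ((starL n).integrable_comp hi).neg.congr (ae_of_all _ fun y => (hGK y).symm)⟩
  have hKi := integrableOn_of_continuousOn_diff hopen hbdd hx hK hKl
  set G : Vec n → Cl n := fun y => -star (K y) with hGdef
  have hGi : IntegrableOn G Ω := ((starL n).integrable_comp hKi).neg
  have hTG : IntegrableOn (T' G) Ω := hT'.integrableOn Subset.rfl hGi.aestronglyMeasurable hGi
  have hd := hG.hasDistribDiv hopen hbdd hKi hTG
  set g : Vec n → Cl n := fun y => star (T' G y) with hg
  have hgi : IntegrableOn g Ω := (starL n).integrable_comp hTG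
  obtain ⟨M, hM0, hM⟩ := hT'.bound
  have hgK : ∀ᵐ y ∂(volume.restrict Ω), ‖g y‖ ≤ ‖starL n‖ * (M * ‖starL n‖) * ‖K y‖ := by
    filter_upwards [hM G] with y hy
    refine (norm_star_le _).trans ?_
    rw [mul_assoc, mul_assoc]
    refine mul_le_mul_of_nonneg_left (hy.trans (mul_le_mul_of_nonneg_left ?_ hM0)) (by positivity)
    rw [hGdef, norm_neg]
    exact norm_star_le _
  obtain ⟨hwbm, d, v, hdm, hv, h1, h2, h3⟩ := hbv
  have hwm : AEStronglyMeasurable w (volume.restrict Ω) := hw.continuousOn.aestronglyMeasurable hΩ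
  have hvi : ∀ k, IntegrableOn (v k) Ω := fun k =>
    ((hv k).continuous.continuousOn.integrableOn_compact hcomp).mono_set subset_closure
  have hvd : ∀ k, IntegrableOn (dirac (v k)) Ω := fun k =>
    ((continuous_dirac (hv k)).continuousOn.integrableOn_compact hcomp).mono_set subset_closure
  have hvb : ∀ k, Integrable (v k) (surfaceMeasure Ω) := fun k => by
    obtain ⟨N, hN⟩ := hcomp.exists_bound_of_continuousOn (hv k).continuous.continuousOn
    exact Integrable.of_bound (C := N) (hv k).continuous.aestronglyMeasurable
      ((surfaceMeasure_ae_mem_frontier Ω).mono fun y hy => hN y (frontier_subset_closure hy))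
  have hwi : IntegrableOn w Ω := integrable_of_tendsto_lintegral hvi hwm h1
  have hdi : IntegrableOn d Ω := integrable_of_tendsto_lintegral hvd hdm h2
  have hwb : Integrable w (surfaceMeasure Ω) := integrable_of_tendsto_lintegral hvb hwbm h3
  have hTi : IntegrableOn (T w) Ω := hT.integrableOn Subset.rfl hwm hwi
  have hdT := hw.ae_eq_of_tendsto hopen hbdd hwi hTi hdi hv hvi hvd h1 h2
  -- The formula is the sum of its versions for `1 - χ`, which carries the boundary integral, and
  -- for `χ`, which carries the value at the pole; the gradient terms of the two cutoffs cancel.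
  obtain ⟨χ, hχ, hχc, hχΩ, hχ1⟩ := exists_cutoff hopen hx
  have hu : ContDiff ℝ 1 fun y => 1 - χ y := contDiff_const.sub hχ
  have hχf : ∀ y ∉ Ω, χ y = 0 := fun y hy =>
    image_eq_zero_of_notMem_tsupport fun h => hy (hχΩ h)
  obtain ⟨i0, i1, i2, e1⟩ := boundaryIntegral_eq_of_cutoff hopen hbdd hlip hK hKi hgi hgK hd hx hv
    hwi hdi hwb h1 h2 h3 hu
    (fun h => by filter_upwards [hχ1 h] with y hy; simp [hy])
    (fun y hy => by rw [hχf y fun h => hy.2 (by rwa [hopen.interior_eq]), sub_zero])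
  obtain ⟨i3, i4, e2⟩ := hw.integral_cutoff hopen hbdd hlip hT hK hKi hgi hd hx hχ hχc hχΩ
  have hgrad : ∀ y, gradient (fun y => 1 - χ y) y = -gradient χ y := fun y => by
    rw [gradient, gradient, fderiv_const_sub, map_neg]
  have hsum : ∀ᵐ y ∂(volume.restrict Ω), K y * T w y + g y * w y =
      ((K y * vec (gradient (fun y => 1 - χ y) y) + (1 - χ y) • g y) * w y +
        ((1 - χ y) • K y) * d y) +
      ((K y * vec (gradient χ y) + χ y • g y) * w y + (χ y • K y) * T w y) := by
    filter_upwards [hdT] with y hy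
    rw [hy, hgrad, ← vecL_apply, map_neg, vecL_apply]
    simp only [sub_smul, one_smul, add_mul, sub_mul, mul_neg, neg_mul]
    abel
  have hxw : χ x • w x = Ω.indicator w x := by
    by_cases hxΩ : x ∈ Ω
    · rw [indicator_of_mem hxΩ, (hχ1 (subset_closure hxΩ)).self_of_nhds, Pi.one_apply, one_smul]
    · rw [indicator_of_notMem hxΩ, hχf x hxΩ, zero_smul]
  refine ⟨i0, ((i1.add i2).add (i3.add i4)).congr (hsum.mono fun y hy => hy.symm), ?_⟩
  have e3 : (∫ y in Ω, (K y * T w y + g y * w y)) = _ :=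
    (integral_congr_ae hsum).trans ((integral_add (i1.add i2) (i3.add i4)).trans
      (congrArg₂ (· + ·) (integral_add i1 i2) (integral_add i3 i4)))
  rw [e3, ← hxw, e1, add_assoc, e2, add_zero]

/-- The scalar part of the Cauchy integral, if the zero-order terms are adjoint to each other. -/
theorem IsSolution.Sc_boundaryIntegral_eq (hopen : IsOpen Ω) (hbdd : Bornology.IsBounded Ω)
    (hlip : HasLipschitzBoundary Ω) (hT : IsBoundedTerm T Ω) (hT' : IsBoundedTerm T' Ω)
    (hadj : ∀ (w K : Vec n → Cl n) (y : Vec n),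
      Sc (K y * T w y + star (T' (fun y => -star (K y)) y) * w y) = 0)
    {w K : Vec n → Cl n} {x : Vec n} (hw : IsSolution T Ω w) (hbv : HasBoundaryValues Ω w)
    (hx : x ∉ frontier Ω) (hK : ContinuousOn K (closure Ω \ {x}))
    (hG : IsFundamentalSolution T' Ω x fun y => -star (K y)) :
    Integrable (boundaryIntegrand Ω K w) (surfaceMeasure Ω) ∧
      (x ∈ Ω → Sc (boundaryIntegral Ω K w) = Sc (w x)) ∧
      (x ∉ closure Ω → Sc (boundaryIntegral Ω K w) = 0) := by
  obtain ⟨h1, h2, h3⟩ := hw.boundaryIntegral_eq hopen hbdd hlip hT hT' hbv hx hK hG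
  have h4 : Sc (boundaryIntegral Ω K w) = Sc (Ω.indicator w x) := by
    rw [h3, Sc_add, ← scL_apply (∫ y in Ω, _), ← (scL n).integral_comp_comm h2]
    simp only [scL_apply, hadj, integral_zero, zero_add]
  refine ⟨h1, fun hxΩ => ?_, fun hxc => ?_⟩
  · rw [h4, indicator_of_mem hxΩ]
  · rw [h4, indicator_of_notMem fun h => hxc (subset_closure h)]
    exact map_zero (scL n)

/-- The expression is `Sc (K α w̄) - Sc (ᾱ K̄ w)`. The conjugate of `ᾱ K̄ w` is `w̄ K α`, a cyclic
permutation of `K α w̄`. -/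
theorem Sc_vekuaTerm_add (α w K : Vec n → Cl n) (y : Vec n) :
    Sc (K y * vekuaTerm α w y + star (vekuaAdjTerm α (fun y => -star (K y)) y) * w y) = 0 := by
  have h : Sc (star (α y) * star (K y) * w y) = Sc (K y * (α y * star (w y))) := by
    rw [← Sc_star]
    simp only [star_mul, star_star]
    rw [Sc_mul_comm, mul_assoc]
  simp only [vekuaTerm, vekuaAdjTerm, star_neg, star_star, neg_mul, star_mul]
  rw [Sc_add, ← scL_apply (-_), map_neg, scL_apply, h, add_neg_cancel]

/-- Here the conjugate of `K̄ ᾱ w` is `w̄ α K`, a cyclic permutation of `K w̄ α`. -/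
theorem Sc_vekuaAdjTerm_add (α w K : Vec n → Cl n) (y : Vec n) :
    Sc (K y * vekuaAdjTerm α w y + star (vekuaTerm α (fun y => -star (K y)) y) * w y) = 0 := by
  have h : Sc (star (K y) * star (α y) * w y) = Sc (K y * (star (w y) * α y)) := by
    rw [← Sc_star]
    simp only [star_mul, star_star]
    rw [← mul_assoc, Sc_mul_comm]
  simp only [vekuaTerm, vekuaAdjTerm, star_neg, star_star, mul_neg, neg_mul, star_mul]
  rw [Sc_add, ← scL_apply (-_), map_neg, scL_apply, h, add_neg_cancel]

end VekuaCauchy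
end

theorem mainTheorem6 {n : ℕ} (hn : 3 ≤ n) (Ω : Set (VekuaCauchy.Vec n))
    (hopen : IsOpen Ω) (hconn : IsConnected Ω) (hbdd : Bornology.IsBounded Ω)
    (hlip : VekuaCauchy.HasLipschitzBoundary Ω)
    (α : VekuaCauchy.Vec n → VekuaCauchy.Cl n)
    (hα : MeasureTheory.MemLp α ⊤ (MeasureTheory.volume.restrict Ω)) :
    (∀ w : VekuaCauchy.Vec n → VekuaCauchy.Cl n,
      VekuaCauchy.IsSolution (VekuaCauchy.vekuaTerm α) Ω w →
      VekuaCauchy.HasBoundaryValues Ω w →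
      ∀ (x : VekuaCauchy.Vec n) (Φ : VekuaCauchy.Vec n → VekuaCauchy.Cl n),
        x ∉ frontier Ω →
        ContinuousOn (fun y => Φ (y - x)) (closure Ω \ {x}) →
        VekuaCauchy.IsFundamentalSolution (VekuaCauchy.vekuaAdjTerm α) Ω x
          (fun y => -star (Φ (y - x))) →
        (x ∈ Ω → VekuaCauchy.PoleConstraint x (fun y => Φ (y - x))) →
        MeasureTheory.Integrable
            (VekuaCauchy.boundaryIntegrand Ω (fun y => Φ (y - x)) w)
            (VekuaCauchy.surfaceMeasure Ω) ∧
          (x ∈ Ω →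
            VekuaCauchy.Sc (VekuaCauchy.boundaryIntegral Ω (fun y => Φ (y - x)) w) =
              VekuaCauchy.Sc (w x)) ∧
          (x ∉ closure Ω →
            VekuaCauchy.Sc (VekuaCauchy.boundaryIntegral Ω (fun y => Φ (y - x)) w) = 0)) ∧
    (∀ w : VekuaCauchy.Vec n → VekuaCauchy.Cl n,
      VekuaCauchy.IsSolution (VekuaCauchy.vekuaAdjTerm α) Ω w →
      VekuaCauchy.HasBoundaryValues Ω w →
      ∀ (x : VekuaCauchy.Vec n) (Ψ : VekuaCauchy.Vec n → VekuaCauchy.Cl n),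
        x ∉ frontier Ω →
        ContinuousOn (fun y => Ψ (y - x)) (closure Ω \ {x}) →
        VekuaCauchy.IsFundamentalSolution (VekuaCauchy.vekuaTerm α) Ω x
          (fun y => -star (Ψ (y - x))) →
        (x ∈ Ω → VekuaCauchy.PoleConstraint x (fun y => Ψ (y - x))) →
        MeasureTheory.Integrable
            (VekuaCauchy.boundaryIntegrand Ω (fun y => Ψ (y - x)) w)
            (VekuaCauchy.surfaceMeasure Ω) ∧
          (x ∈ Ω →
            VekuaCauchy.Sc (VekuaCauchy.boundaryIntegral Ω (fun y => Ψ (y - x)) w) =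
              VekuaCauchy.Sc (w x)) ∧
          (x ∉ closure Ω →
            VekuaCauchy.Sc (VekuaCauchy.boundaryIntegral Ω (fun y => Ψ (y - x)) w) = 0)) := by
  have hT := VekuaCauchy.isBoundedTerm_vekuaTerm hα
  have hT' := VekuaCauchy.isBoundedTerm_vekuaAdjTerm hα
  -- The two zero-order terms are adjoint to each other with respect to the scalar part, so both
  -- assertions are one statement with `T` and `T'` exchanged.
  exact ⟨fun w hw hbv x Φ hx hK hG _ => hw.Sc_boundaryIntegral_eq hopen hbdd hlip hT hT'
      (VekuaCauchy.Sc_vekuaTerm_add α) hbv hx hK hG,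
    fun w hw hbv x Ψ hx hK hG _ => hw.Sc_boundaryIntegral_eq hopen hbdd hlip hT' hT
      (VekuaCauchy.Sc_vekuaAdjTerm_add α) hbv hx hK hG⟩
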